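/- Let $\mathbb D$ be the open unit disc, $\mathbb D^*=\{|w|>1\}\cup\{\infty\}$, $S^1$ the unit circle. By a $C^1$ homeomorphism of the Riemann sphere $\hat{\mathbb C}$ we mean a homeomorphism which is $C^1$ together with its inverse. Let $\mathfrak D$ be the set of pairs $(f,g)$ such that * $f$ is univalent on $\mathbb D$ with $f(w)=a_1w+a_2w^2+\cdots$, $a_1\ne0$, and extends to a $C^1$ homeomorphism of $\hat{\mathbb C}$ with $\infty\notin f(\overline{\mathbb D})$; * $g$ is univalent on $\mathbb D^*$ with $g(w)=bw+b_0+b_1w^{-1}+\cdots$, $b\neq0$, and extends to a $C^1$ homeomorphism of $\hat{\mathbb C}$ with $0\notin g(\overline{\mathbb D^*})$; * $f'(0)g'(\infty)=a_1b=1$. For $n\ge1$ define functions on $\mathfrak D$ by $$t_n=\frac1{2\pi i n}\oint_{S^1}\frac{g(w)^{-n}}{f(w)}\,dg(w),\qquad t_{-n}=\frac{-1}{2\pi i n}\oint_{S^1}g(w)f(w)^{n-2}\,df(w),\qquad t_0=\frac1{2\pi i}\oint_{S^1}\frac{dg(w)}{f(w)} .$$ Write $t_n=x_n+iy_n$. A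 $C^1$ curve in $\mathfrak D$ through $p$ is a family $s\mapsto(f_s,g_s)\in\mathfrak D$, $s$ real and near $0$, with $(f_0,g_0)=p$ and with $(s,\theta)\mapsto f_s(e^{i\theta}),\,g_s(e^{i\theta})$ of class $C^1$. It has direction $\partial/\partial x_n$ (respectively $\partial/\partial y_n$) at $p$ if at $s=0$ one has $dt_m/ds=\delta_{mn}$ (respectively $i\,\delta_{mn}$) for all $m\in\mathbb Z$. For a function $\Phi$ on $\mathfrak D$, put $\dfrac{\partial\Phi}{\partial\bar t_n}=\dfrac12\Bigl(\dfrac{\partial\Phi}{\partial x_n}+i\dfrac{\partial\Phi}{\partial y_n}\Bigr)$, the derivatives being taken along curves with these directions. **Theorem.** For $(f,g)\in\mathfrak D$ let $\bar g(z)=\overline{g(\bar z)}$, $\bar f(z)=\overline{f(\bar z)}$, and put $\mathcal L=\bar g$, $\tilde{\mathcal L}=\bar f$. Then the pair $(\mathcal L,\tilde{\mathcal L})=(\bar g,\bar f)$ evolves with respect to the times $\bar t_n$, $n\in\mathbb Z$, according to the dispersionless Toda hierarchy. That is, $\mathcal L=rw+O(1)$ at $w=\infty$ and $\tilde{\mathcal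 L}^{-1}=rw^{-1}+O(1)$ at $w=0$ with the same $r\ne0$; and at every point of $\mathfrak D$ and for every $n\ge1$, whatever curves with the required directions are used to compute the derivatives, all the derivatives below exist and $$\frac{\partial\mathcal L}{\partial\bar t_n}=\{\mathcal B_n,\mathcal L\}_T,\qquad \frac{\partial\mathcal L}{\partial\bar t_{-n}}=\{\tilde{\mathcal B}_n,\mathcal L\}_T,\qquad \frac{\partial\tilde{\mathcal L}}{\partial\bar t_n}=\{\mathcal B_n,\tilde{\mathcal L}\}_T,\qquad \frac{\partial\tilde{\mathcal L}}{\partial\bar t_{-n}}=\{\tilde{\mathcal B}_n,\tilde{\mathcal L}\}_T,$$ the equations for $\mathcal L$ for all $|w|>1$ and those for $\tilde{\mathcal L}$ for all $0<|w|<1$. Here $$\{A,B\}_T=w\frac{\partial A}{\partial w}\frac{\partial B}{\partial\bar t_0}-w\frac{\partial A}{\partial\bar t_0}\frac{\partial B}{\partial w},\qquad \mathcal B_n=(\mathcal L^n)_{>0}+\tfrac12(\mathcal L^n)_0,\qquad \tilde{\mathcal B}_n=(\tilde{\mathcal L}^{-n})_{<0}+\tfrac12(\tilde{\mathcal L}^{-n})_0,$$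 where $(\cdot)_{>0}$, $(\cdot)_{<0}$, $(\cdot)_0$ denote the parts with positive, negative and zero powers of $w$ of the Laurent expansion of $\mathcal L^n$ at $\infty$, respectively of $\tilde{\mathcal L}^{-n}$ at $0$. -/

import Mathlib

open Complex Filter Topology MeasureTheory Set

noncomputable section

namespace DToda

/-! ### `C¹` homeomorphisms of the Riemann sphere -/

/-- The inversion `z ↦ 1 / z` of the Riemann sphere, exchanging `0` and `∞`. -/
def sphereInv : OnePoint ℂ → OnePoint ℂ
  | none => ((0 : ℂ) : OnePoint ℂ)
  | some z => if z = 0 then OnePoint.infty else ((z⁻¹ : ℂ) : OnePoint ℂ)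

/-- The affine coordinate of a finite point of the sphere (the value at `∞` is never relevant). -/
def affine : OnePoint ℂ → ℂ
  | none => 0
  | some z => z

open Classical in
/-- The change of coordinate that makes `P` a finite point: the identity for finite `P` (affine
coordinate `z`), the inversion for `P = ∞` (affine coordinate `1 / z`).  It is an involution. -/
def centre (P : OnePoint ℂ) : OnePoint ℂ → OnePoint ℂ :=
  if P = OnePoint.infty then sphereInv else id

/-- `F` is continuously (real) differentiable as a self-map of the Riemann sphere: so it is near
every point `P` in the coordinate `z` or `1 / z` around `P` and around `F P`. -/
def IsC1Sphere (F : OnePoint ℂ → OnePoint ℂ) : Prop :=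
  ∀ P : OnePoint ℂ,
    ContDiffAt ℝ 1 (fun u : ℂ => affine (centre (F P) (F (centre P (u : OnePoint ℂ)))))
      (affine (centre P P))

/-- A `C¹` homeomorphism of the Riemann sphere (the inverse is `C¹` too, that is, the differential
is nowhere singular). -/
def IsC1Homeo (F : OnePoint ℂ ≃ₜ OnePoint ℂ) : Prop :=
  IsC1Sphere F ∧ IsC1Sphere F.symm

/-! ### The space of pairs of conformal maps -/

/-- The open unit disc. -/
def disc : Set ℂ := {w | ‖w‖ < 1}

/-- The (finite part of the) exterior of the closed unit disc. -/
def exterior : Set ℂ := {w | 1 < ‖w‖}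

/-- Univalent functions on the disc with `f 0 = 0`, `f' 0 ≠ 0`, extendable to a `C¹` homeomorphism
of the sphere and finite on the closed disc.  The values of `f` on the unit circle are those of
the extension; the values of `f` outside the closed disc are irrelevant. -/
structure MemS0 (f : ℂ → ℂ) : Prop where
  holo : DifferentiableOn ℂ f disc
  inj : InjOn f disc
  map_zero : f 0 = 0
  deriv_ne : deriv f 0 ≠ 0
  ext : ∃ F : OnePoint ℂ ≃ₜ OnePoint ℂ, IsC1Homeo F ∧
    ∀ w : ℂ, ‖w‖ ≤ 1 → F (w : OnePoint ℂ) = ((f w : ℂ) : OnePoint ℂ)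

/-- Univalent functions on the exterior with expansion `g w = b w + b₀ + b₁ / w + ⋯` at `∞`,
`b = g'(∞) ≠ 0`, extendable to a `C¹` homeomorphism of the sphere and without zeros on the closed
exterior.  The values of `g` inside the open disc are irrelevant. -/
structure MemSInf (g : ℂ → ℂ) (b : ℂ) : Prop where
  holo : DifferentiableOn ℂ g exterior
  inj : InjOn g exterior
  lead : Tendsto (fun w => g w / w) (Bornology.cobounded ℂ) (𝓝 b)
  lead_ne : b ≠ 0
  ne_zero : ∀ w : ℂ, 1 ≤ ‖w‖ → g w ≠ 0
  ext : ∃ G : OnePoint ℂ ≃ₜ OnePoint ℂ, IsC1Homeo G ∧ G OnePoint.infty = OnePoint.infty ∧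
    ∀ w : ℂ, 1 ≤ ‖w‖ → G (w : OnePoint ℂ) = ((g w : ℂ) : OnePoint ℂ)

/-- A pair of functions `(f, g)`. -/
structure MapPair where
  f : ℂ → ℂ
  g : ℂ → ℂ

/-- The space `𝔇` of pairs of conformal maps with `f'(0) g'(∞) = 1`. -/
def spaceD : Set MapPair :=
  {p | MemS0 p.f ∧ ∃ b : ℂ, MemSInf p.g b ∧ deriv p.f 0 * b = 1}

/-! ### The time variables -/

/-- `(2πi)⁻¹ ∮ A(w) dB(w)` over the unit circle, positively oriented. -/
def contour (A B : ℂ → ℂ) : ℂ :=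
  (2 * Real.pi * I)⁻¹ * ∫ θ in (0 : ℝ)..(2 * Real.pi),
    A (circleMap 0 1 θ) * deriv (fun x : ℝ => B (circleMap 0 1 x)) θ

/-- The time variables `t_n`, `n ∈ ℤ`:
`t_n = (2πi n)⁻¹ ∮ g⁻ⁿ f⁻¹ dg` and `t_{-n} = -(2πi n)⁻¹ ∮ g fⁿ⁻² df` for `n ≥ 1`,
`t_0 = (2πi)⁻¹ ∮ f⁻¹ dg`. -/
def time (p : MapPair) (n : ℤ) : ℂ :=
  if 0 < n then (n : ℂ)⁻¹ * contour (fun w => p.g w ^ (-n) / p.f w) p.g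
  else if n = 0 then contour (fun w => 1 / p.f w) p.g
  else (n : ℂ)⁻¹ * contour (fun w => p.g w * p.f w ^ (-n - 2)) p.f

/-! ### Partial derivatives with respect to the conjugate times -/

/-- `γ` is a `C¹` curve in `𝔇`, defined for parameters near `0`, that passes through `p` at `0`.
It suffices to control the maps on the unit circle, as their values in the interior are given by
Cauchy integrals. -/
structure IsCurveAt (p : MapPair) (γ : ℝ → MapPair) : Prop where
  base : γ 0 = p
  smooth : ∃ ε : ℝ, 0 < ε ∧ (∀ s ∈ Ioo (-ε) ε, γ s ∈ spaceD) ∧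
    ContDiffOn ℝ 1 (fun q : ℝ × ℝ => (γ q.1).f (circleMap 0 1 q.2)) (Ioo (-ε) ε ×ˢ univ) ∧
    ContDiffOn ℝ 1 (fun q : ℝ × ℝ => (γ q.1).g (circleMap 0 1 q.2)) (Ioo (-ε) ε ×ˢ univ)

/-- `γ` passes through `p` with `t_n` moving at velocity `c` and all other times at velocity `0`. -/
structure IsCoordCurve (p : MapPair) (n : ℤ) (c : ℂ) (γ : ℝ → MapPair) : Prop where
  curve : IsCurveAt p γ
  velocity : ∀ m : ℤ, HasDerivAt (fun s => time (γ s) m) (if m = n then c else 0) 0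

/-- Curves through `p` in the coordinate directions `∂/∂x_n` and `∂/∂y_n`, where
`t_n = x_n + i y_n`. -/
structure CoordFrame (p : MapPair) (n : ℤ) where
  x : ℝ → MapPair
  y : ℝ → MapPair
  hx : IsCoordCurve p n 1 x
  hy : IsCoordCurve p n I y

/-- The function `Φ` on `𝔇` is differentiable in the coordinate directions `∂/∂x_n`, `∂/∂y_n` and
`∂Φ/∂t̄_n = (∂Φ/∂x_n + i ∂Φ/∂y_n) / 2` equals `d`. -/
def HasTBarDeriv {p : MapPair} {n : ℤ} (e : CoordFrame p n) (Φ : MapPair → ℂ) (d : ℂ) : Prop :=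
  ∃ dx dy : ℂ, HasDerivAt (fun s => Φ (e.x s)) dx 0 ∧ HasDerivAt (fun s => Φ (e.y s)) dy 0 ∧
    d = (dx + I * dy) / 2

/-! ### The dispersionless Toda hierarchy -/

/-- The coefficient of `w ^ k` in the Laurent expansion of `h`, computed on the unit circle. -/
def laurentCoeff (h : ℂ → ℂ) (k : ℤ) : ℂ :=
  (2 * Real.pi * I)⁻¹ * ∮ w in C(0, 1), h w * w ^ (-k - 1)

/-- `𝓑_n = (𝓛ⁿ)_{>0} + (𝓛ⁿ)_0 / 2`; as `𝓛` is of order `w` at `∞`, no power above `w ^ n` occurs. -/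
def todaB (n : ℕ) (L : ℂ → ℂ) (w : ℂ) : ℂ :=
  ∑ k ∈ Finset.Icc 1 n, laurentCoeff (fun z => L z ^ n) (k : ℤ) * w ^ (k : ℤ) +
    laurentCoeff (fun z => L z ^ n) 0 / 2

/-- `𝓑̃_n = (𝓛̃⁻ⁿ)_{<0} + (𝓛̃⁻ⁿ)_0 / 2`; as `𝓛̃` is of order `w` at `0`, no power below `w ^ (-n)`
occurs. -/
def todaBt (n : ℕ) (Lt : ℂ → ℂ) (w : ℂ) : ℂ :=
  ∑ k ∈ Finset.Icc 1 n, laurentCoeff (fun z => Lt z ^ (-(n : ℤ))) (-(k : ℤ)) * w ^ (-(k : ℤ)) +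
    laurentCoeff (fun z => Lt z ^ (-(n : ℤ))) 0 / 2

/-- At the point `p` of `𝔇` and at `w`, the Poisson bracket with respect to `w` and `t̄_0`,
`{A, B}_T = w ∂A/∂w ∂B/∂t̄_0 - w ∂A/∂t̄_0 ∂B/∂w`, exists and equals `d`. -/
def HasBracket {p : MapPair} (e₀ : CoordFrame p 0) (A B : MapPair → ℂ → ℂ) (w d : ℂ) : Prop :=
  ∃ Aw Bw A₀ B₀ : ℂ, HasDerivAt (A p) Aw w ∧ HasDerivAt (B p) Bw w ∧
    HasTBarDeriv e₀ (fun q => A q w) A₀ ∧ HasTBarDeriv e₀ (fun q => B q w) B₀ ∧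
    d = w * Aw * B₀ - w * A₀ * Bw

/-- The equation `∂𝓛/∂t̄_n = {𝓑, 𝓛}_T` at the point `p` of `𝔇` and at `w`. -/
def LaxAt {p : MapPair} {n : ℤ} (e : CoordFrame p n) (e₀ : CoordFrame p 0)
    (B L : MapPair → ℂ → ℂ) (w : ℂ) : Prop :=
  ∃ d : ℂ, HasTBarDeriv e (fun q => L q w) d ∧ HasBracket e₀ B L w d

/-- The form of a pair of series of the hierarchy: `𝓛 = r w + u₁ + u₂ / w + ⋯` and
`1 / 𝓛̃ = r / w + ũ₁ + ũ₂ w + ⋯`, here convergent on the exterior and on the disc. -/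
def IsTodaPair (L Lt : ℂ → ℂ) : Prop :=
  ∃ r : ℂ, r ≠ 0 ∧ DifferentiableOn ℂ L exterior ∧
    Tendsto (fun w => L w / w) (Bornology.cobounded ℂ) (𝓝 r) ∧
    DifferentiableOn ℂ Lt disc ∧ Lt 0 = 0 ∧ (∀ w ∈ disc, w ≠ 0 → Lt w ≠ 0) ∧ deriv Lt 0 = r⁻¹

/-- The pair `(𝓛, 𝓛̃)` of functions of `w`, depending on the point of `𝔇`, evolves with respect to
the times `t̄_n`, `n ∈ ℤ`, according to the dispersionless Toda hierarchy: all four families of Lax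
equations hold at every point of `𝔇`, for `n ≥ 1`, and for all `w` in the domains of `𝓛` and `𝓛̃`
(except the pole `w = 0` of `𝓑̃_n`). -/
structure EvolvesByDToda (L Lt : MapPair → ℂ → ℂ) : Prop where
  form : ∀ p ∈ spaceD, IsTodaPair (L p) (Lt p)
  lax_pos : ∀ p ∈ spaceD, ∀ n : ℕ, 1 ≤ n →
    ∀ (e : CoordFrame p (n : ℤ)) (e₀ : CoordFrame p 0),
      (∀ w ∈ exterior, LaxAt e e₀ (fun q => todaB n (L q)) L w) ∧
      (∀ w ∈ disc, w ≠ 0 → LaxAt e e₀ (fun q => todaB n (L q)) Lt w)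
  lax_neg : ∀ p ∈ spaceD, ∀ n : ℕ, 1 ≤ n →
    ∀ (e : CoordFrame p (-(n : ℤ))) (e₀ : CoordFrame p 0),
      (∀ w ∈ exterior, LaxAt e e₀ (fun q => todaBt n (Lt q)) L w) ∧
      (∀ w ∈ disc, w ≠ 0 → LaxAt e e₀ (fun q => todaBt n (Lt q)) Lt w)

/-- The conjugate function `h̄(z) = conj (h (conj z))`. -/
def conjMap (h : ℂ → ℂ) (z : ℂ) : ℂ :=
  (starRingEnd ℂ) (h ((starRingEnd ℂ) z))

end DToda

end

noncomputable section

namespace DToda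

/-! Write f(w) = w / p(w) and g(w) = w k(1/w), with p and k holomorphic in the disc, continuous and
zero-free on its closure; the normalisation f'(0) g'(∞) = 1 becomes p(0) = k(0). A first variation
of (f, g) is a pair (a, c) = (δp, δk) of disc functions with a(0) = c(0). With P = p - w p' and K =
k - ζ k', the form δ(1/f) dg - δg d(1/f) equals Λ dw/w on the circle, where Λ(w) = a(w) K(1/w) +
c(1/w) P(w) (`crossForm`). Integration by parts shows that n δt_n is the moment of Λ against g⁻ⁿ,
that -n δt_{-n} is its moment against fⁿ, and that δt_0 is its mean (`IsVariation.hasDerivAt_time`).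

Two uniqueness facts carry the proof. First, Λ is determined by these moments: a continuous density
orthogonal to all powers of f is orthogonal to all wᵐ, by a Cauchy transform argument
(`DiscC1.circleMean_pow_mul_eq_zero`), and likewise for 1/g and w⁻ᵐ. Second, (a, c) is determined by
Λ (`RegularMap.crossForm_injective`). Hence the derivatives do not depend on the chosen curves, and
they are complex linear in the velocity.

Computing moments identifies Λ: it is 1 for ∂/∂t_0, w d/dw (gⁿ)_{>0} for ∂/∂t_n, and w d/dw
(f⁻ⁿ)_{<0} for ∂/∂t_{-n}. Let (p₀, k₀) be the t_0-variation, B = (gⁿ)_{>0} + (gⁿ)_0 / 2 and b =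
∂B/∂t_0. The pair a = w B' p₀ + b P, c(1/w) = w B' k₀(1/w) - b K(1/w) has cross form w B' · 1, as
the b-terms cancel. It is admissible: gⁿ - B is regular at ∞, which removes the pole of c, and the
factor 1/2 in B gives a(0) = c(0). By uniqueness it is the t_n-variation
(`RegularMap.variation_eq_bracket`), which is the Lax equation before conjugation. The times t_{-n}
follow by the symmetry w ↦ 1/w, which exchanges p and k. Complex linearity lets conjugation turn
∂/∂t_n into ∂/∂t̄_n. -/

/-! ### Means over the circle and Taylor coefficients of disc functions. -/

/-- The mean value over the unit circle. -/
def circleMean (u : ℂ → ℂ) : ℂ := Real.circleAverage u 0 1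

/-- Functions holomorphic on the unit disc and continuous on its closure. -/
abbrev DiscAlg (u : ℂ → ℂ) : Prop := DiffContOnCl ℂ u (Metric.ball 0 1)

lemma DiscAlg.continuousOn' {u : ℂ → ℂ} (hu : DiscAlg u) :
    ContinuousOn u (Metric.closedBall 0 1) := hu.continuousOn_ball

lemma discAlg_iff {u : ℂ → ℂ} :
    DiscAlg u ↔ DifferentiableOn ℂ u (Metric.ball 0 1) ∧ ContinuousOn u (Metric.closedBall 0 1) :=
  ⟨fun h => ⟨h.1, h.continuousOn_ball⟩, fun h => ⟨h.1, by
    rw [closure_ball (0 : ℂ) one_ne_zero]; exact h.2⟩⟩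

lemma circleMean_congr {u v : ℂ → ℂ} (h : ∀ w, ‖w‖ = 1 → u w = v w) :
    circleMean u = circleMean v :=
  Real.circleAverage_congr_sphere (fun w hw => h w (by simpa using hw))

lemma circleMean_inv (u : ℂ → ℂ) : circleMean (fun w => u w⁻¹) = circleMean u :=
  Real.circleAverage_zero_one_congr_inv

lemma circleMean_discAlg {u : ℂ → ℂ} (hu : DiscAlg u) : circleMean u = u 0 :=
  DiffContOnCl.circleAverage (by simpa using hu)

lemma circleMean_discAlg_inv {u : ℂ → ℂ} (hu : DiscAlg u) :
    circleMean (fun w => u w⁻¹) = u 0 := by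
  rw [circleMean_inv, circleMean_discAlg hu]

lemma circleMean_sub {u v : ℂ → ℂ} (hu : ContinuousOn u (Metric.sphere 0 1))
    (hv : ContinuousOn v (Metric.sphere 0 1)) :
    circleMean (fun w => u w - v w) = circleMean u - circleMean v :=
  Real.circleAverage_fun_sub (hu.circleIntegrable zero_le_one) (hv.circleIntegrable zero_le_one)

lemma circleMean_const_mul (c : ℂ) (u : ℂ → ℂ) :
    circleMean (fun w => c * u w) = c * circleMean u := by
  simpa [circleMean] using Real.circleAverage_fun_smul (a := c) (f := u) (c := 0) (R := 1)

/-- A continuous function on the unit circle all of whose Fourier coefficients vanish is zero. -/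
lemma eq_zero_of_circleMean_eq_zero {u : ℂ → ℂ} (hu : ContinuousOn u (Metric.sphere 0 1))
    (h₁ : ∀ m : ℕ, circleMean (fun w => w ^ m * u w) = 0)
    (h₂ : ∀ m : ℕ, circleMean (fun w => w⁻¹ ^ m * u w) = 0) {w : ℂ} (hw : ‖w‖ = 1) : u w = 0 := by
  have : Fact (0 < 2 * Real.pi) := ⟨Real.two_pi_pos⟩
  let φ : C(AddCircle (2 * Real.pi), ℂ) :=
    ⟨fun x => u (AddCircle.toCircle x), by
      refine hu.comp_continuous (by fun_prop) (fun x => by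
        rw [mem_sphere_zero_iff_norm]; exact Circle.norm_coe _)⟩
  have key : ∀ n : ℤ, fourierCoeff φ n = circleMean (fun w => w ^ (-n) * u w) := by
    intro n
    rw [fourierCoeff_eq_intervalIntegral _ _ 0, circleMean, Real.circleAverage_def]
    rw [zero_add, one_div]
    congr 1
    apply intervalIntegral.integral_congr
    intro x _
    simp only [φ, ContinuousMap.coe_mk, fourier_apply, smul_eq_mul, circleMap]
    rw [AddCircle.toCircle_zsmul]
    simp only [Circle.coe_zpow, AddCircle.toCircle_apply_mk, Circle.coe_exp]
    have : (2 * Real.pi / (2 * Real.pi) * x : ℝ) = x := by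
      field_simp
    simp
  have hz : ∀ n : ℤ, fourierCoeff φ n = 0 := by
    intro n
    rw [key]
    obtain ⟨m, rfl | rfl⟩ := n.eq_nat_or_neg
    · simpa using h₂ m
    · simpa using h₁ m
  -- The zero coefficients are trivially summable, so the Fourier series converges to `φ` pointwise.
  have hs := hasSum_fourier_series_of_summable (f := φ) (by
    rw [show fourierCoeff (φ : AddCircle (2 * Real.pi) → ℂ) = 0 from funext hz]; exact summable_zero)
  simp only [hz, zero_smul] at hs
  have h0 : φ = 0 := hs.unique hasSum_zero
  have := DFunLike.congr_fun h0 ((arg w : ℝ) : AddCircle (2 * Real.pi))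
  simp only [φ, ContinuousMap.coe_mk, AddCircle.toCircle_apply_mk, Circle.coe_exp] at this
  have hT : (2 * Real.pi / (2 * Real.pi) * arg w : ℝ) = arg w := by field_simp
  have hw' : Complex.exp ((arg w : ℝ) * I) = w := by
    have := Complex.norm_mul_exp_arg_mul_I w
    rwa [hw, ofReal_one, one_mul] at this
  rw [hT, hw'] at this
  simpa using this

/-- Two disc functions related by inversion on the circle are constant. -/
lemma DiscAlg.const_of_inv {A C : ℂ → ℂ} (hA : DiscAlg A) (hC : DiscAlg C)
    (h : ∀ w, ‖w‖ = 1 → A w = C w⁻¹) : A 0 = C 0 ∧ ∀ w, ‖w‖ ≤ 1 → A w = A 0 := by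
  have h0 : A 0 = C 0 := by
    rw [← circleMean_discAlg hA, ← circleMean_discAlg_inv hC]
    exact circleMean_congr h
  refine ⟨h0, ?_⟩
  have hid : DiscAlg (fun w => w) := differentiable_id.diffContOnCl
  have hA' : DiscAlg (fun w => A w - A 0) := hA.sub_const _
  have hC' : DiscAlg (fun w => C w - C 0) := hC.sub_const _
  -- The moments against nonnegative powers vanish because A is a disc function, those against
  -- nonpositive powers because C is.
  have hcirc : ∀ w, ‖w‖ = 1 → A w - A 0 = 0 := by
    intro w hw
    refine eq_zero_of_circleMean_eq_zero (u := fun w => A w - A 0)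
      (hA'.continuousOn'.mono Metric.sphere_subset_closedBall) ?_ ?_ hw
    · intro m
      have : DiscAlg (fun w => w ^ m * (A w - A 0)) :=
        (differentiable_id.pow m).diffContOnCl.smul hA'
      rw [circleMean_discAlg this]; simp
    · intro m
      have : DiscAlg (fun w => w ^ m * (C w - C 0)) :=
        (differentiable_id.pow m).diffContOnCl.smul hC'
      have h2 := circleMean_discAlg_inv this
      rw [sub_self, mul_zero] at h2
      exact (circleMean_congr fun w hw => by simp only [h w hw, h0]).trans h2
  intro w hw
  have hE := Complex.eqOn_closure_of_eqOn_frontier (f := A) (g := fun _ => A 0)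
    Metric.isBounded_ball hA diffContOnCl_const (by
      rw [frontier_ball (0 : ℂ) one_ne_zero]
      intro w hw
      exact sub_eq_zero.1 (hcirc w (by simpa using hw)))
  rw [closure_ball (0 : ℂ) one_ne_zero] at hE
  exact hE (by simpa using hw)

/-- The Taylor coefficients at `0` of a disc function. -/
def taylorCoeff (h : ℂ → ℂ) (j : ℕ) : ℂ := circleMean (fun w => w⁻¹ ^ j * h w)

lemma taylorCoeff_zero {h : ℂ → ℂ} (hh : DiscAlg h) : taylorCoeff h 0 = h 0 := by
  simp only [taylorCoeff, pow_zero, one_mul]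
  exact circleMean_discAlg hh

lemma DiscAlg.dslope {h : ℂ → ℂ} (hh : DiscAlg h) : DiscAlg (dslope h 0) := by
  rw [discAlg_iff] at hh ⊢
  have hb : Metric.ball (0 : ℂ) 1 ∈ 𝓝 (0 : ℂ) := Metric.ball_mem_nhds _ one_pos
  refine ⟨(Complex.differentiableOn_dslope hb).2 hh.1, ?_⟩
  rw [continuousOn_dslope (mem_of_superset hb Metric.ball_subset_closedBall)]
  exact ⟨hh.2, hh.1.differentiableAt hb⟩

lemma taylorCoeff_dslope {h : ℂ → ℂ} (hh : DiscAlg h) (j : ℕ) :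
    taylorCoeff (_root_.dslope h 0) j = taylorCoeff h (j + 1) := by
  have hmon : circleMean (fun w => w⁻¹ ^ (j + 1) * h 0) = 0 := by
    rw [circleMean_discAlg_inv (u := fun w => w ^ (j + 1) * h 0)
      ((differentiable_id.pow _).mul_const _).diffContOnCl]
    simp
  have hc : ContinuousOn (fun w : ℂ => w⁻¹ ^ (j + 1)) (Metric.sphere 0 1) :=
    (continuousOn_id.inv₀ (fun w hw => by
      rintro rfl; simp at hw)).pow _
  have := circleMean_sub (u := fun w => w⁻¹ ^ (j + 1) * h w) (v := fun w => w⁻¹ ^ (j + 1) * h 0)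
    (hc.mul (hh.continuousOn'.mono Metric.sphere_subset_closedBall))
    (hc.mul (continuousOn_const (c := h 0)))
  rw [hmon, sub_zero] at this
  rw [taylorCoeff, taylorCoeff, ← this]
  refine circleMean_congr fun w hw => ?_
  have hw0 : w ≠ 0 := by rintro rfl; simp at hw
  rw [dslope_of_ne _ hw0, slope_def_field, pow_succ, sub_zero]
  field_simp

/-- Taylor expansion with remainder of a disc function. -/
lemma DiscAlg.exists_taylor {h : ℂ → ℂ} (hh : DiscAlg h) (N : ℕ) : ∃ S, DiscAlg S ∧
    ∀ z, h z = ∑ j ∈ Finset.range N, taylorCoeff h j * z ^ j + z ^ N * S z := by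
  induction N generalizing h with
  | zero => exact ⟨h, hh, fun z => by simp⟩
  | succ N ih =>
    obtain ⟨S, hS, hz⟩ := ih hh.dslope
    refine ⟨S, hS, fun z => ?_⟩
    have : h z = h 0 + z * _root_.dslope h 0 z := by
      have := sub_smul_dslope h 0 z
      simp only [sub_zero, smul_eq_mul] at this
      rw [this]; ring
    rw [this, hz z, Finset.sum_range_succ', taylorCoeff_zero hh]
    simp only [taylorCoeff_dslope hh]
    rw [mul_add, Finset.mul_sum]
    simp only [pow_succ, pow_zero]
    have : ∀ j, z * (taylorCoeff h (j + 1) * z ^ j) = taylorCoeff h (j + 1) * (z ^ j * z) :=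
      fun j => by ring
    simp only [this]
    ring

/-! ### The Cauchy–Pompeiu formula and integrability of the Cauchy kernel. -/

/-- The Wirtinger derivative `∂u/∂z̄`. -/
def dbar (u : ℂ → ℂ) (z : ℂ) : ℂ := (fderiv ℝ u z 1 + I * fderiv ℝ u z I) / 2

lemma continuous_dbar {u : ℂ → ℂ} (hu : ContDiff ℝ 1 u) : Continuous (dbar u) := by
  have := hu.continuous_fderiv (by norm_num)
  unfold dbar
  fun_prop

/-- For e = e^{iθ} this is ∂/∂z̄ in polar form: e and ie are the radial and tangential directions.
-/
lemma clm_polar (D : ℂ →L[ℝ] ℂ) (e : ℂ) :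
    (D 1 + I * D I) * (starRingEnd ℂ) e = D e + I * D (I * e) := by
  have h1 : ∀ z : ℂ, D z = z.re * D 1 + z.im * D I := by
    intro z
    have : z = z.re • (1 : ℂ) + z.im • I := by
      apply Complex.ext <;> simp
    conv_lhs => rw [this, map_add, map_smul, map_smul]
    simp
  rw [h1 e, h1 (I * e)]
  apply Complex.ext <;> simp <;> ring

/-- The Cauchy–Pompeiu formula at the origin. -/
lemma integral_dbar_div {u : ℂ → ℂ} (hu : ContDiff ℝ 1 u) {R : ℝ} (hR : 0 < R)
    (hsupp : ∀ z, R ≤ ‖z‖ → u z = 0) :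
    ∫ z, dbar u z / z = -Real.pi * u 0 := by
  set e : ℝ → ℂ := fun θ => exp (θ * I) with he
  have hec : Continuous e := by fun_prop
  have hne : ∀ θ, ‖e θ‖ = 1 := fun θ => Complex.norm_exp_ofReal_mul_I θ
  have hDc : Continuous (fderiv ℝ u) := hu.continuous_fderiv (by norm_num)
  set X : ℝ × ℝ → ℂ := fun q => fderiv ℝ u (q.1 * e q.2) (e q.2) with hX
  set Y : ℝ × ℝ → ℂ := fun q => fderiv ℝ u (q.1 * e q.2) (I * e q.2) with hY
  have hXc : Continuous X := by fun_prop
  have hYc : Continuous Y := by fun_prop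
  have hnorm : ∀ (r θ : ℝ), 0 ≤ r → ‖(r : ℂ) * e θ‖ = r := fun r θ h => by
    simp [hne, abs_of_nonneg h]
  -- The Jacobian r cancels the 1/r of the kernel, and e⁻¹ = ē leaves half of radial derivative plus
  -- i times tangential derivative.
  have hpol : ∀ q ∈ polarCoord.target, q.1 • (dbar u (Complex.polarCoord.symm q) /
      Complex.polarCoord.symm q) = (X q + I * Y q) / 2 := by
    rintro ⟨r, θ⟩ hq
    simp only [polarCoord_target, mem_prod, mem_Ioi] at hq
    have h1 : Complex.polarCoord.symm (r, θ) = r * e θ := by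
      rw [Complex.polarCoord_symm_apply, he]; simp [Complex.exp_mul_I]
    have hr : (r : ℂ) ≠ 0 := ofReal_ne_zero.2 hq.1.ne'
    have he0 : e θ ≠ 0 := exp_ne_zero _
    have hc : (e θ)⁻¹ = (starRingEnd ℂ) (e θ) := Complex.inv_eq_conj (hne θ)
    rw [h1]
    simp only [hX, hY]
    rw [← clm_polar, ← hc, dbar, real_smul]
    field_simp
  rw [← Complex.integral_comp_polarCoord_symm, setIntegral_congr_fun
    polarCoord.open_target.measurableSet hpol]
  have hsub : Ioc 0 R ×ˢ Ioc (-Real.pi) Real.pi ⊆ Ioi (0:ℝ) ×ˢ Ioc (-Real.pi) Real.pi :=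
    prod_mono Ioc_subset_Ioi_self subset_rfl
  -- The polar chart omits the angle π, a null set.
  have htarget : ∫ q in polarCoord.target, (X q + I * Y q) / 2
      = ∫ q in Ioi (0:ℝ) ×ˢ Ioc (-Real.pi) Real.pi, (X q + I * Y q) / 2 := by
    apply setIntegral_congr_set
    rw [polarCoord_target]
    exact Measure.set_prod_ae_eq (ae_eq_refl _) Ioo_ae_eq_Ioc
  have hvan : ∀ q : ℝ × ℝ, R < q.1 → (X q + I * Y q) / 2 = 0 := by
    intro q hq
    have : fderiv ℝ u (q.1 * e q.2) = 0 := by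
      have h2 : u =ᶠ[𝓝 (q.1 * e q.2)] fun _ => 0 := by
        have : R < ‖(q.1 : ℂ) * e q.2‖ := by rwa [hnorm _ _ (hR.trans hq).le]
        filter_upwards [(isOpen_lt continuous_const continuous_norm).mem_nhds this] with y hy
        exact hsupp y (le_of_lt hy)
      simp [h2.fderiv_eq]
    simp [hX, hY, this]
  rw [htarget, setIntegral_eq_of_subset_of_forall_sdiff_eq_zero
    (measurableSet_Ioi.prod measurableSet_Ioc) hsub (by
      rintro ⟨r, θ⟩ ⟨⟨h1, h2⟩, h3⟩
      refine hvan _ ?_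
      by_contra h
      exact h3 ⟨⟨h1, not_lt.1 h⟩, h2⟩)]
  have hint : ∀ Z : ℝ × ℝ → ℂ, Continuous Z →
      IntegrableOn Z (Ioc 0 R ×ˢ Ioc (-Real.pi) Real.pi) (volume.prod volume) := fun Z hZ =>
    (hZ.continuousOn.integrableOn_compact (isCompact_Icc.prod isCompact_Icc)).mono_set
      (prod_mono Ioc_subset_Icc_self Ioc_subset_Icc_self)
  have hsplit : ∫ q in Ioc 0 R ×ˢ Ioc (-Real.pi) Real.pi, (X q + I * Y q) / 2 =
      ((∫ q in Ioc 0 R ×ˢ Ioc (-Real.pi) Real.pi, X q ∂(volume.prod volume)) + 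
        I * ∫ q in Ioc 0 R ×ˢ Ioc (-Real.pi) Real.pi, Y q ∂(volume.prod volume)) / 2 := by
    rw [integral_div, Measure.volume_eq_prod, integral_add (hint _ hXc)
      ((hint _ hYc).const_mul I), integral_const_mul]
  have hu' : ∀ z, HasFDerivAt u (fderiv ℝ u z) z :=
    fun z => (hu.differentiable (by norm_num) z).hasFDerivAt
  have hpi : -Real.pi ≤ Real.pi := by linarith [Real.pi_pos]
  -- On each circle the tangential derivative is 1/r times an angular derivative, so it integrates
  -- to zero by periodicity.
  have hYint : ∫ q in Ioc 0 R ×ˢ Ioc (-Real.pi) Real.pi, Y q ∂(volume.prod volume) = 0 := by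
    rw [setIntegral_prod _ (hint _ hYc)]
    refine (setIntegral_congr_fun measurableSet_Ioc fun r hr => ?_).trans (integral_zero _ _)
    rw [← intervalIntegral.integral_of_le hpi]
    have hd : ∀ θ : ℝ, HasDerivAt (fun θ : ℝ => u (r * e θ)) (r * Y (r, θ)) θ := by
      intro θ
      have h1 : HasDerivAt (fun θ : ℝ => (r : ℂ) * e θ) (r • (I * e θ)) θ := by
        have : HasDerivAt e (e θ * I) θ := by
          have := ((ofRealCLM.hasDerivAt (x := θ)).mul_const I).cexp
          simpa [he] using this
        exact (this.const_mul (r : ℂ)).congr_deriv (by rw [real_smul]; ring)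
      have := (hu' _).comp_hasDerivAt θ h1
      rw [map_smul, real_smul] at this
      exact this
    have hi := intervalIntegral.integral_eq_sub_of_hasDerivAt (a := -Real.pi) (b := Real.pi)
      (fun θ _ => hd θ) ((by fun_prop : Continuous fun θ => (r : ℂ) * Y (r, θ)).intervalIntegrable _ _)
    rw [intervalIntegral.integral_const_mul] at hi
    have hper : e Real.pi = e (-Real.pi) := by
      simp [he, Complex.exp_neg]
    rw [hper, sub_self] at hi
    exact (mul_eq_zero.1 hi).resolve_left (ofReal_ne_zero.2 hr.1.ne')
  -- On each ray the radial derivative integrates to u(R e) - u(0) = -u(0).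
  have hXint : ∫ q in Ioc 0 R ×ˢ Ioc (-Real.pi) Real.pi, X q ∂(volume.prod volume)
      = -(2 * Real.pi) * u 0 := by
    rw [← setIntegral_prod_swap, setIntegral_prod (fun z => X z.swap) (hint _ hXc).swap]
    have : ∀ θ ∈ Ioc (-Real.pi) Real.pi, ∫ r in Ioc 0 R, X ((θ, r) : ℝ × ℝ).swap = - u 0 := by
      intro θ _
      rw [← intervalIntegral.integral_of_le hR.le]
      have hd : ∀ r : ℝ, HasDerivAt (fun r : ℝ => u (r * e θ)) (X (r, θ)) r := by
        intro r
        have h1 : HasDerivAt (fun r : ℝ => (r : ℂ) * e θ) (e θ) r := by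
          simpa using (ofRealCLM.hasDerivAt (x := r)).mul_const (e θ)
        exact (hu' _).comp_hasDerivAt r h1
      have hi := intervalIntegral.integral_eq_sub_of_hasDerivAt (a := 0) (b := R)
        (fun r _ => hd r) ((by fun_prop : Continuous fun r => X (r, θ)).intervalIntegrable _ _)
      rw [hsupp _ (by rw [hnorm _ _ hR.le])] at hi
      simpa using hi
    rw [setIntegral_congr_fun measurableSet_Ioc this, setIntegral_const]
    have hv : volume.real (Ioc (-Real.pi) Real.pi) = 2 * Real.pi := by
      rw [Real.volume_real_Ioc_of_le hpi]; ring
    rw [hv, real_smul]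
    push_cast
    ring
  rw [hsplit, hXint, hYint]
  ring

/-- The Cauchy–Pompeiu formula. -/
lemma integral_dbar_div_sub {u : ℂ → ℂ} (hu : ContDiff ℝ 1 u) (hc : HasCompactSupport u) (z : ℂ) :
    ∫ ζ, dbar u ζ / (ζ - z) = -Real.pi * u z := by
  obtain ⟨R, hR, hRu⟩ : ∃ R : ℝ, 0 < R ∧ ∀ ζ, R ≤ ‖ζ‖ → u (ζ + z) = 0 := by
    obtain ⟨r, hr⟩ := hc.isCompact.isBounded.subset_closedBall z
    refine ⟨max r 0 + 1, by positivity, fun ζ hζ => ?_⟩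
    by_contra h
    have := hr (subset_tsupport _ h)
    simp at this
    linarith [le_max_left r 0]
  have h1 := integral_dbar_div (u := fun ζ => u (ζ + z)) (by fun_prop) hR hRu
  have h2 : ∀ ζ, dbar (fun ζ => u (ζ + z)) ζ = dbar u (ζ + z) := fun ζ => by
    simp [dbar, fderiv_comp_add_right]
  simp only [h2, zero_add] at h1
  rw [← h1, ← integral_add_right_eq_self (fun ζ => dbar u ζ / (ζ - z)) z]
  simp

/-- The Cauchy kernel is uniformly integrable against a bounded function of bounded support. -/
lemma exists_cauchyKernel_bound {D : ℂ → ℂ} (hD : Continuous D) (hc : HasCompactSupport D) (ρ : ℝ) :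
    ∃ C : ℝ, ∀ z : ℂ, ‖z‖ ≤ ρ → Integrable (fun ζ => D ζ / (ζ - z)) ∧
      ∫ ζ, ‖D ζ / (ζ - z)‖ ≤ C := by
  obtain ⟨M, hM⟩ := hD.bounded_above_of_compact_support hc
  have hM0 : 0 ≤ M := (norm_nonneg _).trans (hM 0)
  obtain ⟨r, hr⟩ := hc.isCompact.isBounded.subset_closedBall 0
  -- If ζ + z lies in the support of D and ‖z‖ ≤ ρ, then ‖ζ‖ ≤ r + ρ < R. After translation, one
  -- multiple of 1/‖ζ‖ on this ball dominates all the kernels, and it is integrable in real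
  -- dimension two.
  set R := max (r + ρ) 0 + 1
  have hi : IntegrableOn (fun ζ : ℂ => (ζ : ℂ)⁻¹) (Metric.ball 0 R) := by
    refine integrableOn_ball_of_norm_le_rpow (C := 1) (α := 1) (by simp) (by simp)
      (ae_of_all _ fun ζ => ?_) measurable_inv.aestronglyMeasurable
    rw [Real.rpow_neg_one, norm_inv, one_mul]
  have hg : Integrable ((Metric.ball (0:ℂ) R).indicator fun ζ => M * ‖ζ⁻¹‖) :=
    IntegrableOn.integrable_indicator ((hi.norm).const_mul M) measurableSet_ball
  refine ⟨∫ ζ, (Metric.ball (0:ℂ) R).indicator (fun ζ => M * ‖ζ⁻¹‖) ζ, fun z hz => ?_⟩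
  have hle : ∀ ζ, ‖D (ζ + z) / ζ‖ ≤ (Metric.ball (0:ℂ) R).indicator (fun ζ => M * ‖ζ⁻¹‖) ζ := by
    intro ζ
    by_cases h : ζ ∈ Metric.ball (0:ℂ) R
    · rw [indicator_of_mem h, div_eq_mul_inv, norm_mul]
      gcongr
      exact hM _
    · rw [indicator_of_notMem h]
      have : D (ζ + z) = 0 := by
        by_contra h'
        have h3 := hr (subset_tsupport _ h')
        simp only [Metric.mem_ball, dist_zero_right, not_lt, mem_closedBall_zero_iff] at h h3
        have h4 : ‖ζ‖ ≤ ‖ζ + z‖ + ‖z‖ := by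
          simpa using norm_sub_le (ζ + z) z
        have : r + ρ ≤ max (r + ρ) 0 := le_max_left _ _
        simp only [R] at h
        linarith
      simp [this]
  have hint : Integrable (fun ζ => D (ζ + z) / ζ) :=
    hg.mono' (by
      have : Measurable fun ζ => D (ζ + z) / ζ :=
        (hD.measurable.comp (measurable_id.add_const z)).div measurable_id
      exact this.aestronglyMeasurable) (ae_of_all _ hle)
  constructor
  · have := hint.comp_sub_right z
    simpa using this
  · rw [← integral_add_right_eq_self _ z]
    simp only [add_sub_cancel_right]
    exact integral_mono hint.norm hg hle

/-! ### Boundary regularity and completeness of the powers of a conformal map. -/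

/-- Conformal maps of the disc that are `C¹` diffeomorphisms up to the boundary and onto the
closure of a domain with connected complement. -/
structure DiscC1 (h : ℂ → ℂ) : Prop where
  holo : DifferentiableOn ℂ h (Metric.ball 0 1)
  map_zero : h 0 = 0
  ext : ∃ H : ℂ → ℂ, ∀ w : ℂ, ‖w‖ ≤ 1 → H w = h w ∧ ContDiffAt ℝ 1 H w
  inv : ∃ ψ : ℂ → ℂ, ∀ w : ℂ, ‖w‖ ≤ 1 → ψ (h w) = w ∧ ContDiffAt ℝ 1 ψ (h w)
  compl : IsPreconnected (h '' Metric.closedBall 0 1)ᶜ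

lemma ContDiffAt.continuousAt_fderiv_one {H : ℂ → ℂ} {w : ℂ} (h : ContDiffAt ℝ 1 H w) :
    ContinuousAt (fderiv ℝ H) w :=
  (h.fderiv_right (m := 0) (by norm_num)).continuousAt

lemma DiscC1.discAlg {h : ℂ → ℂ} (hh : DiscC1 h) : DiscAlg h := by
  obtain ⟨H, hH⟩ := hh.ext
  refine discAlg_iff.2 ⟨hh.holo, ?_⟩
  have : ContinuousOn H (Metric.closedBall 0 1) := fun w hw =>
    (hH w (by simpa using hw)).2.continuousAt.continuousWithinAt
  exact this.congr fun w hw => ((hH w (by simpa using hw)).1).symm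

lemma DiscC1.injOn {h : ℂ → ℂ} (hh : DiscC1 h) {w z : ℂ} (hw : ‖w‖ ≤ 1) (hz : ‖z‖ ≤ 1)
    (he : h w = h z) : w = z := by
  obtain ⟨ψ, hψ⟩ := hh.inv
  rw [← (hψ w hw).1, ← (hψ z hz).1, he]

/-- Boundary regularity: the complex derivative extends continuously and without zeros to the
closed disc, and the `C¹` inverse satisfies the Cauchy–Riemann equation up to the boundary. -/
lemma DiscC1.exists_deriv {h : ℂ → ℂ} (hh : DiscC1 h) :
    (∃ h₁ : ℂ → ℂ, DiscAlg h₁ ∧ (∀ w, ‖w‖ ≤ 1 → h₁ w ≠ 0) ∧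
      (∀ w, ‖w‖ < 1 → HasDerivAt h (h₁ w) w) ∧
      ∀ θ : ℝ, HasDerivAt (fun x : ℝ => h (circleMap 0 1 x))
        (I * circleMap 0 1 θ * h₁ (circleMap 0 1 θ)) θ) ∧
    ∃ ψ : ℂ → ℂ, ∀ w : ℂ, ‖w‖ ≤ 1 → ψ (h w) = w ∧ ContDiffAt ℝ 1 ψ (h w) ∧ dbar ψ (h w) = 0 := by
  obtain ⟨H, hH⟩ := hh.ext
  obtain ⟨ψ, hψ⟩ := hh.inv
  have hsub : Metric.ball (0 : ℂ) 1 ⊆ Metric.closedBall 0 1 := Metric.ball_subset_closedBall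
  have hcl : Metric.closedBall (0 : ℂ) 1 ⊆ closure (Metric.ball 0 1) := by
    rw [closure_ball (0 : ℂ) one_ne_zero]
  have hHc : ContinuousOn H (Metric.closedBall 0 1) := fun w hw =>
    (hH w (by simpa using hw)).2.continuousAt.continuousWithinAt
  have hA : ContinuousOn (fderiv ℝ H) (Metric.closedBall 0 1) := fun w hw =>
    (ContDiffAt.continuousAt_fderiv_one (hH w (by simpa using hw)).2).continuousWithinAt
  have hB : ContinuousOn (fun w => fderiv ℝ ψ (H w)) (Metric.closedBall 0 1) := fun w hw => by
    have hw' : ‖w‖ ≤ 1 := by simpa using hw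
    have h1 := ContDiffAt.continuousAt_fderiv_one (hψ w hw').2
    rw [← (hH w hw').1] at h1
    exact h1.comp_continuousWithinAt (hHc w hw)
  have hint : ∀ w ∈ Metric.ball (0 : ℂ) 1, HasDerivAt h (fderiv ℝ H w 1) w ∧
      fderiv ℝ H w I = I * fderiv ℝ H w 1 ∧
      fderiv ℝ ψ (H w) (fderiv ℝ H w 1) = 1 ∧ fderiv ℝ ψ (H w) (fderiv ℝ H w I) = I := by
    intro w hw
    have hw' : ‖w‖ ≤ 1 := (by simpa using hw : ‖w‖ < 1).le
    have hd := (hh.holo.differentiableAt (Metric.isOpen_ball.mem_nhds hw)).hasDerivAt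
    have heq : H =ᶠ[𝓝 w] h := by
      filter_upwards [Metric.isOpen_ball.mem_nhds hw] with z hz
      exact (hH z (by simpa using hsub hz)).1
    have hfd := (hd.hasFDerivAt.restrictScalars ℝ).congr_of_eventuallyEq heq
    have hval : ∀ v, fderiv ℝ H w v = v * deriv h w := fun v => by
      rw [hfd.fderiv]; simp
    have hψd : HasFDerivAt ψ (fderiv ℝ ψ (H w)) (H w) := by
      rw [(hH w hw').1]
      exact ((hψ w hw').2.differentiableAt (by norm_num)).hasFDerivAt
    have hcomp := hψd.comp w ((hH w hw').2.differentiableAt (by norm_num)).hasFDerivAt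
    have hid : ψ ∘ H =ᶠ[𝓝 w] id := by
      filter_upwards [Metric.isOpen_ball.mem_nhds hw] with z hz
      have hz' : ‖z‖ ≤ 1 := by simpa using hsub hz
      simp [(hH z hz').1, (hψ z hz').1]
    have huniq := hcomp.unique ((hasFDerivAt_id w).congr_of_eventuallyEq hid)
    have h1 := fun v => DFunLike.congr_fun huniq v
    simp only [ContinuousLinearMap.comp_apply, ContinuousLinearMap.id_apply] at h1
    refine ⟨by rw [hval, one_mul]; exact hd, by rw [hval, hval]; ring, h1 1, h1 I⟩
  have hev : ∀ v : ℂ, ContinuousOn (fun w => fderiv ℝ H w v) (Metric.closedBall 0 1) :=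
    fun v => hA.clm_apply continuousOn_const
  -- The Cauchy–Riemann equation of H and the chain rule for ψ ∘ H = id hold in the open disc; both
  -- sides are continuous on the closed disc.
  have e1 : EqOn (fun w => fderiv ℝ H w I) (fun w => I * fderiv ℝ H w 1)
      (Metric.closedBall 0 1) :=
    EqOn.of_subset_closure (fun w hw => (hint w hw).2.1) (hev I)
      (continuousOn_const.mul (hev 1)) hsub hcl
  have e2 : EqOn (fun w => fderiv ℝ ψ (H w) (fderiv ℝ H w 1)) (fun _ => 1)
      (Metric.closedBall 0 1) :=
    EqOn.of_subset_closure (fun w hw => (hint w hw).2.2.1) (hB.clm_apply (hev 1))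
      continuousOn_const hsub hcl
  have e3 : EqOn (fun w => fderiv ℝ ψ (H w) (fderiv ℝ H w I)) (fun _ => I)
      (Metric.closedBall 0 1) :=
    EqOn.of_subset_closure (fun w hw => (hint w hw).2.2.2) (hB.clm_apply (hev I))
      continuousOn_const hsub hcl
  have hne : ∀ w : ℂ, ‖w‖ ≤ 1 → fderiv ℝ H w 1 ≠ 0 := by
    intro w hw h0
    have := e2 (mem_closedBall_zero_iff.2 hw)
    simp [h0] at this
  refine ⟨⟨fun w => fderiv ℝ H w 1, discAlg_iff.2 ⟨?_, hev 1⟩, hne,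
    fun w hw => (hint w (by simpa using hw)).1, fun θ => ?_⟩, ψ, fun w hw => ?_⟩
  · have : DifferentiableOn ℂ (deriv h) (Metric.ball 0 1) := hh.holo.deriv Metric.isOpen_ball
    exact this.congr fun w hw => (hint w hw).1.deriv.symm
  · have hn : ‖circleMap 0 1 θ‖ ≤ 1 := by simp
    have h1 := ((hH _ hn).2.differentiableAt (by norm_num)).hasFDerivAt.comp_hasDerivAt θ
      (hasDerivAt_circleMap 0 1 θ)
    have h2 : (H ∘ circleMap 0 1) = fun x => h (circleMap 0 1 x) :=
      funext fun x => (hH _ (by simp)).1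
    rw [h2] at h1
    refine h1.congr_deriv ?_
    set c := circleMap 0 1 θ
    have h3 : ∀ (D : ℂ →L[ℝ] ℂ), D I = I * D 1 → ∀ v, D v = v * D 1 := by
      intro D hD v
      have : v = v.re • (1 : ℂ) + v.im • I := by apply Complex.ext <;> simp
      conv_lhs => rw [this, map_add, map_smul, map_smul, hD]
      simp only [real_smul]
      linear_combination D 1 * Complex.re_add_im v
    rw [h3 _ (e1 (mem_closedBall_zero_iff.2 hn))]
    ring
  · refine ⟨(hψ w hw).1, (hψ w hw).2, ?_⟩
    have hw' := mem_closedBall_zero_iff.2 hw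
    have h2 := e2 hw'
    have h3 := e3 hw'
    have h1 := e1 hw'
    simp only at h1 h2 h3
    rw [h1] at h3
    -- With e = DH(1) ≠ 0, Dψ(e) = 1 and Dψ(ie) = i, hence 2 (∂ψ/∂z̄) ē = 1 + i · i = 0.
    have := clm_polar (fderiv ℝ ψ (H w)) (fderiv ℝ H w 1)
    rw [h2, h3, I_mul_I, add_neg_cancel, mul_eq_zero] at this
    rw [dbar, ← (hH w hw).1, this.resolve_right (by simpa using hne w hw), zero_div]

/-- A compactly supported `C¹` function that agrees with the `m`-th power of the inverse of `h` on
the image of the closed disc and satisfies the Cauchy–Riemann equation there. -/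
lemma DiscC1.exists_cutoff {h : ℂ → ℂ} (hh : DiscC1 h) (m : ℕ) : ∃ u : ℂ → ℂ,
    ContDiff ℝ 1 u ∧ HasCompactSupport u ∧ ∀ w, ‖w‖ ≤ 1 → u (h w) = w ^ m ∧ dbar u (h w) = 0 := by
  obtain ⟨-, ψ, hψ⟩ := hh.exists_deriv
  -- Being `C¹` at a point is an open condition, so ψ is `C¹` on a neighbourhood of the compact
  -- image; the cutoff χ is supported there and equals 1 near the image.
  set U : Set ℂ := interior {z | ContDiffAt ℝ 1 ψ z}
  have hK : IsCompact (h '' Metric.closedBall 0 1) :=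
    (isCompact_closedBall _ _).image_of_continuousOn hh.discAlg.continuousOn'
  have hKU : h '' Metric.closedBall 0 1 ⊆ U := by
    rintro _ ⟨w, hw, rfl⟩
    rw [mem_interior_iff_mem_nhds]
    exact (hψ w (by simpa using hw)).2.1.eventually (by simp)
  obtain ⟨K', hK', hKK', hK'U⟩ := exists_compact_between hK isOpen_interior hKU
  obtain ⟨χ, hχ1, hχ0, -⟩ := exists_contMDiffMap_one_nhds_of_subset_interior (n := 1)
    (modelWithCornersSelf ℝ ℂ) hK.isClosed hKK'
  have hχ : ContDiff ℝ 1 χ := χ.contMDiff.contDiff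
  refine ⟨fun z => (χ z : ℂ) * ψ z ^ m, ?_, ?_, ?_⟩
  · rw [contDiff_iff_contDiffAt]
    intro z
    by_cases hz : z ∈ K'
    · have : ContDiffAt ℝ 1 ψ z := interior_subset (hK'U hz)
      exact (ofRealCLM.contDiff.contDiffAt.comp z hχ.contDiffAt).mul (this.pow m)
    · refine (contDiffAt_const (c := (0 : ℂ))).congr_of_eventuallyEq ?_
      filter_upwards [hK'.isClosed.isOpen_compl.mem_nhds hz] with y hy
      simp [hχ0 y hy]
  · refine HasCompactSupport.intro hK' fun z hz => by simp [hχ0 z hz]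
  · intro w hw
    have hmem : h w ∈ h '' Metric.closedBall 0 1 := ⟨w, by simpa using hw, rfl⟩
    have hev : ∀ᶠ z in 𝓝 (h w), χ z = 1 := hχ1.filter_mono (nhds_le_nhdsSet hmem)
    refine ⟨by simp [hev.self_of_nhds, (hψ w hw).1], ?_⟩
    have heq : (fun z => (χ z : ℂ) * ψ z ^ m) =ᶠ[𝓝 (h w)] fun z => ψ z ^ m := by
      filter_upwards [hev] with z hz
      simp [hz]
    have hd := ((hψ w hw).2.1.differentiableAt (by norm_num)).hasFDerivAt.pow m
    have h0 := (hψ w hw).2.2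
    rw [dbar, div_eq_zero_iff] at h0
    rw [dbar, heq.fderiv_eq, hd.fderiv]
    simp only [smul_apply, smul_eq_mul]
    linear_combination (m * ψ (h w) ^ (m - 1) / 2) * (h0.resolve_right two_ne_zero)

/-- The Cauchy transform of a density on the image of the circle that is orthogonal to all powers
of `h` vanishes off the image of the closed disc. -/
lemma DiscC1.cauchyTransform_eq_zero {h φ : ℂ → ℂ} (hh : DiscC1 h)
    (hφ : ContinuousOn φ (Metric.sphere 0 1))
    (hm : ∀ m : ℕ, circleMean (fun w => h w ^ m * φ w) = 0) {ζ : ℂ}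
    (hζ : ζ ∉ h '' Metric.closedBall 0 1) :
    ∫ θ in (0 : ℝ)..2 * Real.pi, φ (circleMap 0 1 θ) / (ζ - h (circleMap 0 1 θ)) = 0 := by
  set K := h '' Metric.closedBall 0 1
  have hK : IsCompact K :=
    (isCompact_closedBall _ _).image_of_continuousOn hh.discAlg.continuousOn'
  have hKo : IsOpen Kᶜ := hK.isClosed.isOpen_compl
  set η : ℝ → ℂ := fun θ => h (circleMap 0 1 θ)
  set ρ : ℝ → ℂ := fun θ => φ (circleMap 0 1 θ)
  have hηc : Continuous η := hh.discAlg.continuousOn'.comp_continuous (continuous_circleMap 0 1)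
    (fun θ => by simp)
  have hρc : Continuous ρ := hφ.comp_continuous (continuous_circleMap 0 1) (fun θ => by simp)
  have hηK : ∀ θ, η θ ∈ K := fun θ => ⟨_, by simp, rfl⟩
  have hint0 : ∀ m : ℕ, ∫ θ in (0 : ℝ)..2 * Real.pi, η θ ^ m * ρ θ = 0 := by
    intro m
    have := hm m
    rw [circleMean, Real.circleAverage_def, smul_eq_zero] at this
    exact this.resolve_left (by positivity)
  set Φ : ℂ → ℂ := fun ζ => ∫ θ in (0 : ℝ)..2 * Real.pi, ρ θ / (ζ - η θ)
  have hdiff : DifferentiableOn ℂ Φ Kᶜ := by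
    intro z hz
    obtain ⟨r, hr, hball⟩ := Metric.nhds_basis_closedBall.mem_iff.1 (hKo.mem_nhds hz)
    have hne : ∀ x ∈ Metric.closedBall z r, ∀ θ, x - η θ ≠ 0 := fun x hx θ h0 =>
      hball hx (sub_eq_zero.1 h0 ▸ hηK θ)
    have hcont : ContinuousOn (fun q : ℂ × ℝ => ‖-ρ q.2 / (q.1 - η q.2) ^ 2‖)
        (Metric.closedBall z r ×ˢ Icc 0 (2 * Real.pi)) := by
      refine (ContinuousOn.div ?_ ?_ ?_).norm
      · exact (hρc.comp continuous_snd).neg.continuousOn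
      · exact ((continuous_fst.sub (hηc.comp continuous_snd)).pow 2).continuousOn
      · exact fun q hq => pow_ne_zero 2 (hne _ hq.1 _)
    obtain ⟨C, hC⟩ := ((isCompact_closedBall z r).prod isCompact_Icc).bddAbove_image hcont
    have := intervalIntegral.hasDerivAt_integral_of_dominated_loc_of_deriv_le (𝕜 := ℂ)
      (μ := volume) (a := 0) (b := 2 * Real.pi) (F := fun x θ => ρ θ / (x - η θ))
      (F' := fun x θ => -ρ θ / (x - η θ) ^ 2) (x₀ := z) (bound := fun _ => C)
      (Metric.closedBall_mem_nhds z hr) ?_ ?_ ?_ ?_ ?_ ?_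
    · exact this.2.differentiableAt.differentiableWithinAt
    · filter_upwards [Metric.closedBall_mem_nhds z hr] with x hx
      exact (hρc.div (by fun_prop) (hne x hx)).aestronglyMeasurable
    · exact (hρc.div (by fun_prop) (hne z (Metric.mem_closedBall_self hr.le))).intervalIntegrable _ _
    · exact (hρc.neg.div (by fun_prop) (fun θ =>
        pow_ne_zero 2 (hne z (Metric.mem_closedBall_self hr.le) θ))).aestronglyMeasurable
    · refine ae_of_all _ fun θ hθ x hx => hC ⟨(x, θ), ⟨hx, ?_⟩, rfl⟩
      rw [uIoc_of_le (by positivity)] at hθ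
      exact Ioc_subset_Icc_self hθ
    · exact intervalIntegrable_const
    · refine ae_of_all _ fun θ _ x hx => ?_
      have := (((hasDerivAt_id x).sub_const (η θ)).inv (hne x hx θ)).const_mul (ρ θ)
      simp only [div_eq_mul_inv]
      refine this.congr_deriv ?_
      simp [div_eq_mul_inv]
  obtain ⟨R, hR0, hR⟩ := hK.isBounded.exists_pos_norm_lt
  -- Far away the kernel is the geometric series Σ ηᵐ / z^{m+1}, whose terms integrate to the
  -- vanishing moments.
  have hfar : ∀ z : ℂ, R < ‖z‖ → Φ z = 0 := by
    intro z hz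
    have hz0 : z ≠ 0 := fun h0 => by simp [h0] at hz; linarith
    obtain ⟨M, hM⟩ := (isCompact_Icc (a := (0:ℝ)) (b := 2 * Real.pi)).bddAbove_image
      (hρc.norm.continuousOn)
    have hs := intervalIntegral.hasSum_integral_of_dominated_convergence (μ := volume)
      (a := 0) (b := 2 * Real.pi) (F := fun (m : ℕ) θ => z⁻¹ ^ (m + 1) * (η θ ^ m * ρ θ))
      (f := fun θ => ρ θ / (z - η θ)) (bound := fun m _ => ‖z‖⁻¹ * (R / ‖z‖) ^ m * M)
      (fun m => (by fun_prop : Continuous _).aestronglyMeasurable) ?_ ?_ ?_ ?_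
    · simp only [intervalIntegral.integral_const_mul, hint0, mul_zero] at hs
      exact hs.unique hasSum_zero
    · refine fun m => ae_of_all _ fun θ hθ => ?_
      rw [uIoc_of_le (by positivity)] at hθ
      have h1 : ‖ρ θ‖ ≤ M := hM ⟨θ, Ioc_subset_Icc_self hθ, rfl⟩
      have h2 : ‖η θ‖ ≤ R := (hR _ (hηK θ)).le
      rw [norm_mul, norm_mul, norm_pow, norm_pow, norm_inv, div_pow, div_eq_mul_inv, ← inv_pow,
        pow_succ]
      calc ‖z‖⁻¹ ^ m * ‖z‖⁻¹ * (‖η θ‖ ^ m * ‖ρ θ‖) ≤ ‖z‖⁻¹ ^ m * ‖z‖⁻¹ * (R ^ m * M) := by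
            gcongr
        _ = _ := by ring
    · refine ae_of_all _ fun θ _ => ?_
      refine ((summable_geometric_of_lt_one (by positivity) ?_).mul_left _).mul_right _
      rw [div_lt_one (hR0.trans hz)]
      exact hz
    · exact intervalIntegrable_const
    · refine ae_of_all _ fun θ _ => ?_
      have h2 : ‖η θ / z‖ < 1 := by
        rw [norm_div, div_lt_one (hR0.trans hz)]
        exact (hR _ (hηK θ)).trans hz
      have := ((hasSum_geometric_of_norm_lt_one h2).mul_left (z⁻¹ * ρ θ))
      have hne : z - η θ ≠ 0 := fun h0 => by
        have := hR _ (hηK θ)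
        rw [← sub_eq_zero.1 h0] at this
        linarith
      have e1 : ∀ m : ℕ, z⁻¹ ^ (m + 1) * (η θ ^ m * ρ θ) = z⁻¹ * ρ θ * (η θ / z) ^ m := fun m => by
        rw [div_eq_mul_inv, mul_pow, pow_succ]
        ring
      have e2 : ρ θ / (z - η θ) = z⁻¹ * ρ θ * (1 - η θ / z)⁻¹ := by
        have : 1 - η θ / z ≠ 0 := by
          rw [one_sub_div hz0]; exact div_ne_zero hne hz0
        field_simp
      simp only [e1, e2]
      exact this
  have han : AnalyticOnNhd ℂ Φ Kᶜ := hdiff.analyticOnNhd hKo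
  have hz₀ : R < ‖((R + 1 : ℝ) : ℂ)‖ := by
    rw [norm_real, Real.norm_of_nonneg (by linarith)]; linarith
  have hmem : ((R + 1 : ℝ) : ℂ) ∈ Kᶜ := fun hk => absurd (hR _ hk) (not_lt.2 hz₀.le)
  -- Connectedness of the complement of the image carries the zero from infinity up to the boundary
  -- curve.
  refine han.eqOn_zero_of_preconnected_of_eventuallyEq_zero hh.compl hmem ?_ hζ
  filter_upwards [(isOpen_lt continuous_const continuous_norm).mem_nhds hz₀] with z hz
  exact hfar z hz

/-- Powers of `h` span a weakly dense subspace of the disc algebra. -/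
lemma DiscC1.circleMean_pow_mul_eq_zero {h φ : ℂ → ℂ} (hh : DiscC1 h)
    (hφ : ContinuousOn φ (Metric.sphere 0 1))
    (hm : ∀ m : ℕ, circleMean (fun w => h w ^ m * φ w) = 0) (m : ℕ) :
    circleMean (fun w => w ^ m * φ w) = 0 := by
  obtain ⟨u, hu, huc, huh⟩ := hh.exists_cutoff m
  set η : ℝ → ℂ := fun θ => h (circleMap 0 1 θ)
  set ρ : ℝ → ℂ := fun θ => φ (circleMap 0 1 θ)
  have hηc : Continuous η := hh.discAlg.continuousOn'.comp_continuous (continuous_circleMap 0 1)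
    (fun θ => by simp)
  have hρc : Continuous ρ := hφ.comp_continuous (continuous_circleMap 0 1) (fun θ => by simp)
  have hDc : Continuous (dbar u) := continuous_dbar hu
  have hDs : HasCompactSupport (dbar u) := by
    have h1 := huc.fderiv (𝕜 := ℝ)
    refine h1.mono fun z hz => ?_
    contrapose! hz
    simp only [Function.mem_support, not_not] at hz ⊢
    simp [dbar, hz]
  have hK : IsCompact (h '' Metric.closedBall 0 1) :=
    (isCompact_closedBall _ _).image_of_continuousOn hh.discAlg.continuousOn'
  obtain ⟨R, hR0, hR⟩ := hK.isBounded.exists_pos_norm_lt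
  have hηR : ∀ θ, ‖η θ‖ ≤ R := fun θ => (hR _ ⟨_, by simp, rfl⟩).le
  obtain ⟨C, hC⟩ := exists_cauchyKernel_bound hDc hDs R
  obtain ⟨M, hM⟩ := (isCompact_Icc (a := (0:ℝ)) (b := 2 * Real.pi)).bddAbove_image
      (hρc.norm.continuousOn)
  have h2pi : (0 : ℝ) ≤ 2 * Real.pi := by positivity
  -- Integrability for Fubini: the Cauchy kernel is bounded in L¹ uniformly over the points η(θ),
  -- and ρ is bounded.
  have hint : Integrable (Function.uncurry fun (θ : ℝ) (ζ : ℂ) => ρ θ * (dbar u ζ / (ζ - η θ)))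
      ((volume.restrict (uIoc 0 (2 * Real.pi))).prod volume) := by
    have hmeas : Measurable (Function.uncurry fun (θ : ℝ) (ζ : ℂ) =>
        ρ θ * (dbar u ζ / (ζ - η θ))) := by
      have h1 := hρc.measurable
      have h2 := hηc.measurable
      have h3 := hDc.measurable
      simp only [Function.uncurry_def]
      fun_prop
    rw [integrable_prod_iff hmeas.aestronglyMeasurable]
    constructor
    · exact ae_of_all _ fun θ => (hC _ (hηR θ)).1.const_mul (ρ θ)
    · have hfin : IsFiniteMeasure (volume.restrict (uIoc 0 (2 * Real.pi))) :=
        ⟨by rw [Measure.restrict_apply_univ, uIoc_of_le h2pi]; exact measure_Ioc_lt_top⟩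
      refine Integrable.mono' (g := fun _ => M * C) (integrable_const _)
        (hmeas.aestronglyMeasurable.norm.integral_prod_right') ?_
      refine (ae_restrict_iff' measurableSet_uIoc).2 (ae_of_all _ fun θ hθ => ?_)
      rw [uIoc_of_le h2pi] at hθ
      rw [Real.norm_of_nonneg (integral_nonneg fun _ => norm_nonneg _)]
      simp only [Function.uncurry_apply_pair, norm_mul, integral_const_mul]
      have h1 : ‖ρ θ‖ ≤ M := hM ⟨θ, Ioc_subset_Icc_self hθ, rfl⟩
      exact mul_le_mul h1 (hC _ (hηR θ)).2 (integral_nonneg fun _ => norm_nonneg _)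
        ((norm_nonneg _).trans h1)
  have hswap := intervalIntegral_integral_swap hint
  -- The integrand in ζ vanishes everywhere: ∂u/∂z̄ is zero on the image of the closed disc, and the
  -- Cauchy transform is zero off it. The other order of integration gives -π ∫ wᵐ φ by
  -- Cauchy–Pompeiu, since u(h(w)) = wᵐ.
  have hright : ∀ ζ, ∫ θ in (0 : ℝ)..2 * Real.pi, ρ θ * (dbar u ζ / (ζ - η θ)) = 0 := by
    intro ζ
    by_cases hζ : ζ ∈ h '' Metric.closedBall 0 1
    · obtain ⟨w, hw, rfl⟩ := hζ
      simp [(huh w (by simpa using hw)).2]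
    · have := hh.cauchyTransform_eq_zero hφ hm hζ
      have h2 : ∀ θ, ρ θ * (dbar u ζ / (ζ - η θ)) = dbar u ζ * (ρ θ / (ζ - η θ)) :=
        fun θ => by ring
      simp only [h2, intervalIntegral.integral_const_mul]
      rw [this, mul_zero]
  simp only [hright, integral_zero, integral_const_mul, integral_dbar_div_sub hu huc] at hswap
  have h3 : ∀ θ, ρ θ * (-Real.pi * u (η θ)) = -Real.pi * (circleMap 0 1 θ ^ m * ρ θ) := by
    intro θ
    rw [(huh _ (by simp)).1]
    ring
  simp only [h3, intervalIntegral.integral_const_mul, mul_eq_zero, neg_eq_zero, ofReal_eq_zero,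
    Real.pi_ne_zero, false_or] at hswap
  rw [circleMean, Real.circleAverage_def, hswap, smul_zero]

/-! ### Differentiation of `C¹` families on the circle. -/

/-- A family of functions whose values on the unit circle are of class `C¹` jointly in the
parameter and the angle. -/
def CircleC1 (ε : ℝ) (u : ℝ → ℂ → ℂ) : Prop :=
  ContDiffOn ℝ 1 (fun q : ℝ × ℝ => u q.1 (circleMap 0 1 q.2)) (Ioo (-ε) ε ×ˢ univ)

/-- The difference quotients of the family at parameter `0`. -/
def diffQuot (u : ℝ → ℂ → ℂ) (s : ℝ) (w : ℂ) : ℂ := (s : ℂ)⁻¹ * (u s w - u 0 w)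

lemma hasDerivAt_iff_tendsto_diffQuot {u : ℝ → ℂ → ℂ} {w d : ℂ} :
    HasDerivAt (fun s => u s w) d 0 ↔ Tendsto (fun s => diffQuot u s w) (𝓝[≠] 0) (𝓝 d) := by
  rw [hasDerivAt_iff_tendsto_slope]
  have : slope (fun s => u s w) 0 = fun s => diffQuot u s w := by
    funext s
    simp [slope, diffQuot, real_smul]
  rw [this]

lemma exists_circleMap_eq {w : ℂ} (hw : ‖w‖ = 1) :
    ∃ θ ∈ Icc (0 : ℝ) (2 * Real.pi), circleMap 0 1 θ = w := by
  have h1 : circleMap 0 1 (arg w) = w := by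
    have := Complex.norm_mul_exp_arg_mul_I w
    rw [hw, ofReal_one, one_mul] at this
    simp [circleMap, this]
  by_cases h : 0 ≤ arg w
  · exact ⟨arg w, ⟨h, by linarith [arg_le_pi w, Real.pi_pos]⟩, h1⟩
  · refine ⟨arg w + 2 * Real.pi, ⟨by linarith [neg_pi_lt_arg w, Real.pi_pos], by linarith⟩, ?_⟩
    rw [periodic_circleMap, h1]

section Regularity

variable {ε : ℝ} {u : ℝ → ℂ → ℂ}

lemma CircleC1.contDiffAt (hu : CircleC1 ε u) {s : ℝ} (hs : s ∈ Ioo (-ε) ε) (θ : ℝ) :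
    ContDiffAt ℝ 1 (fun q : ℝ × ℝ => u q.1 (circleMap 0 1 q.2)) (s, θ) :=
  ContDiffOn.contDiffAt hu ((isOpen_Ioo.prod isOpen_univ).mem_nhds ⟨hs, mem_univ _⟩)

lemma CircleC1.continuousOn_fderiv (hu : CircleC1 ε u) (v : ℝ × ℝ) :
    ContinuousOn (fun q => fderiv ℝ (fun q : ℝ × ℝ => u q.1 (circleMap 0 1 q.2)) q v)
      (Ioo (-ε) ε ×ˢ univ) :=
  (hu.continuousOn_fderiv_of_isOpen (isOpen_Ioo.prod isOpen_univ) le_rfl).clm_apply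
    continuousOn_const

lemma CircleC1.hasDerivAt_fst (hu : CircleC1 ε u) {s : ℝ} (hs : s ∈ Ioo (-ε) ε) (θ : ℝ) :
    HasDerivAt (fun s => u s (circleMap 0 1 θ))
      (fderiv ℝ (fun q : ℝ × ℝ => u q.1 (circleMap 0 1 q.2)) (s, θ) (1, 0)) s := by
  have h := ((hu.contDiffAt hs θ).differentiableAt (by norm_num)).hasFDerivAt
  exact h.comp_hasDerivAt (f := fun s => (s, θ)) s ((hasDerivAt_id s).prodMk (hasDerivAt_const s θ))

lemma CircleC1.hasDerivAt_snd (hu : CircleC1 ε u) {s : ℝ} (hs : s ∈ Ioo (-ε) ε) (θ : ℝ) :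
    HasDerivAt (fun θ => u s (circleMap 0 1 θ))
      (fderiv ℝ (fun q : ℝ × ℝ => u q.1 (circleMap 0 1 q.2)) (s, θ) (0, 1)) θ := by
  have h := ((hu.contDiffAt hs θ).differentiableAt (by norm_num)).hasFDerivAt
  exact h.comp_hasDerivAt (f := fun θ => (s, θ)) θ ((hasDerivAt_const θ s).prodMk (hasDerivAt_id θ))

lemma CircleC1.continuous_snd (hu : CircleC1 ε u) {s : ℝ} (hs : s ∈ Ioo (-ε) ε) (v : ℝ × ℝ) :
    Continuous fun θ : ℝ => fderiv ℝ (fun q : ℝ × ℝ => u q.1 (circleMap 0 1 q.2)) (s, θ) v :=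
  (hu.continuousOn_fderiv v).comp_continuous (by fun_prop) (fun θ => ⟨hs, mem_univ _⟩)

lemma CircleC1.continuous_circle (hu : CircleC1 ε u) {s : ℝ} (hs : s ∈ Ioo (-ε) ε) :
    Continuous fun θ : ℝ => u s (circleMap 0 1 θ) :=
  continuous_iff_continuousAt.2 fun θ => (hu.hasDerivAt_snd hs θ).continuousAt

/-- The difference quotients of a `C¹` family converge uniformly on the circle. -/
lemma CircleC1.tendstoUniformlyOn (hu : CircleC1 ε u) (hε : 0 < ε) {u' : ℂ → ℂ}
    (hu' : ∀ w, ‖w‖ = 1 → HasDerivAt (fun s => u s w) (u' w) 0) :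
    TendstoUniformlyOn (diffQuot u) u' (𝓝[≠] 0) (Metric.sphere 0 1) := by
  have h0 : (0 : ℝ) ∈ Ioo (-ε) ε := ⟨by linarith, hε⟩
  set p : ℝ × ℝ → ℂ := fun q =>
    fderiv ℝ (fun q : ℝ × ℝ => u q.1 (circleMap 0 1 q.2)) q (1, 0) with hp
  have hpc : ContinuousOn p (Ioo (-ε) ε ×ˢ univ) := hu.continuousOn_fderiv _
  have hp0 : ∀ θ, p (0, θ) = u' (circleMap 0 1 θ) := fun θ =>
    (hu.hasDerivAt_fst h0 θ).unique (hu' _ (by simp))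
  rw [Metric.tendstoUniformlyOn_iff]
  intro δ hδ
  have hev : ∀ᶠ s in 𝓝 (0 : ℝ), ∀ θ ∈ Icc (0 : ℝ) (2 * Real.pi),
      ‖p (s, θ) - p (0, θ)‖ < δ / 2 := by
    refine isCompact_Icc.eventually_forall_of_forall_eventually fun θ _ => ?_
    have hc : ContinuousAt p (0, θ) :=
      hpc.continuousAt ((isOpen_Ioo.prod isOpen_univ).mem_nhds ⟨h0, mem_univ _⟩)
    have hc2 : ContinuousAt (fun q : ℝ × ℝ => p q - p (0, q.2)) (0, θ) :=
      hc.sub (ContinuousAt.comp (g := p) (f := fun q : ℝ × ℝ => ((0 : ℝ), q.2)) hc (by fun_prop))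
    have := hc2.norm.eventually_lt (continuousAt_const (y := δ / 2)) (by simpa using half_pos hδ)
    exact this
  obtain ⟨r, hr, hball⟩ := Metric.eventually_nhds_iff.1
    (hev.and (isOpen_Ioo.mem_nhds h0))
  rw [eventually_nhdsWithin_iff]
  refine Metric.eventually_nhds_iff.2 ⟨r, hr, fun s hs hs0 w hw => ?_⟩
  obtain ⟨θ, hθ, rfl⟩ := exists_circleMap_eq (by simpa using hw : ‖w‖ = 1)
  -- The mean value inequality, applied after subtracting the linear part s · ∂ₛu(0, θ), bounds the
  -- error uniformly in θ.
  have hmv := (convex_ball (0 : ℝ) r).norm_image_sub_le_of_norm_hasDerivWithin_le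
    (f := fun s => u s (circleMap 0 1 θ) - s * p (0, θ)) (f' := fun s => p (s, θ) - p (0, θ))
    (C := δ / 2) (x := 0) (y := s) (fun x hx => by
      have h1 := (hu.hasDerivAt_fst (hball hx).2 θ).fun_sub
        ((ofRealCLM.hasDerivAt (x := x)).mul_const (p (0, θ)))
      exact (h1.congr_deriv (by simp [hp])).hasDerivWithinAt) (fun x hx => ((hball hx).1 θ hθ).le)
    (Metric.mem_ball_self hr) hs
  have hs0' : (s : ℂ) ≠ 0 := ofReal_ne_zero.2 hs0
  have hsn : 0 < ‖s‖ := norm_pos_iff.2 hs0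
  rw [dist_eq_norm, ← hp0, norm_sub_rev]
  have heq : diffQuot u s (circleMap 0 1 θ) - p (0, θ) = (s : ℂ)⁻¹ *
      (u s (circleMap 0 1 θ) - s * p (0, θ) - (u 0 (circleMap 0 1 θ) - (0 : ℝ) * p (0, θ))) := by
    rw [diffQuot]
    push_cast
    field_simp
    ring
  rw [heq, norm_mul, norm_inv, norm_real]
  rw [sub_zero] at hmv
  calc ‖s‖⁻¹ * _ ≤ ‖s‖⁻¹ * (δ / 2 * ‖s‖) := by gcongr
    _ = δ / 2 := by field_simp
    _ < δ := by linarith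

lemma CircleC1.exists_hasDerivAt (hu : CircleC1 ε u) (hε : 0 < ε) :
    ∃ u' : ℂ → ℂ, ∀ w, ‖w‖ = 1 → HasDerivAt (fun s => u s w) (u' w) 0 := by
  have h0 : (0 : ℝ) ∈ Ioo (-ε) ε := ⟨by linarith, hε⟩
  have : ∀ w : ℂ, ∃ d, ‖w‖ = 1 → HasDerivAt (fun s => u s w) d 0 := by
    intro w
    by_cases hw : ‖w‖ = 1
    · obtain ⟨θ, -, rfl⟩ := exists_circleMap_eq hw
      exact ⟨_, fun _ => hu.hasDerivAt_fst h0 θ⟩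
    · exact ⟨0, fun h => absurd h hw⟩
  choose u' hu' using this
  exact ⟨u', hu'⟩

lemma CircleC1.continuous_variation (hu : CircleC1 ε u) (hε : 0 < ε) {u' : ℂ → ℂ}
    (hu' : ∀ w, ‖w‖ = 1 → HasDerivAt (fun s => u s w) (u' w) 0) :
    Continuous fun θ => u' (circleMap 0 1 θ) := by
  have h0 : (0 : ℝ) ∈ Ioo (-ε) ε := ⟨by linarith, hε⟩
  have := hu.continuous_snd h0 (1, 0)
  refine this.congr fun θ => (hu.hasDerivAt_fst h0 θ).unique (hu' _ (by simp))

/-- Eventual uniform bound for the difference quotients on the circle. -/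
lemma CircleC1.exists_bound (hu : CircleC1 ε u) (hε : 0 < ε) {u' : ℂ → ℂ}
    (hu' : ∀ w, ‖w‖ = 1 → HasDerivAt (fun s => u s w) (u' w) 0) :
    ∃ C, ∀ᶠ s in 𝓝[≠] (0 : ℝ), ∀ θ, ‖diffQuot u s (circleMap 0 1 θ)‖ ≤ C := by
  obtain ⟨M, hM⟩ := (isCompact_Icc (a := (0:ℝ)) (b := 2 * Real.pi)).bddAbove_image
      (hu.continuous_variation hε hu').norm.continuousOn
  refine ⟨M + 1, ?_⟩
  filter_upwards [Metric.tendstoUniformlyOn_iff.1 (hu.tendstoUniformlyOn hε hu') 1 one_pos]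
    with s hs θ
  obtain ⟨θ', hθ', he⟩ := exists_circleMap_eq (w := circleMap 0 1 θ) (by simp)
  rw [← he]
  have h1 := hs (circleMap 0 1 θ') (by simp)
  have h2 : ‖u' (circleMap 0 1 θ')‖ ≤ M := hM ⟨θ', hθ', rfl⟩
  rw [dist_eq_norm] at h1
  have := norm_sub_norm_le (diffQuot u s (circleMap 0 1 θ')) (u' (circleMap 0 1 θ'))
  rw [norm_sub_rev] at this
  linarith

lemma CircleC1.diffQuot_continuous (hu : CircleC1 ε u) (hε : 0 < ε) {s : ℝ} (hs : s ∈ Ioo (-ε) ε) :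
    Continuous fun θ : ℝ => diffQuot u s (circleMap 0 1 θ) :=
  continuous_const.mul ((hu.continuous_circle hs).sub
    (hu.continuous_circle ⟨by linarith, hε⟩))

lemma eventually_mem_Ioo (hε : 0 < ε) : ∀ᶠ s in 𝓝[≠] (0 : ℝ), s ∈ Ioo (-ε) ε :=
  nhdsWithin_le_nhds (isOpen_Ioo.mem_nhds ⟨by linarith, hε⟩)

/-- Differentiation under the mean value over the circle. -/
lemma CircleC1.hasDerivAt_circleMean (hu : CircleC1 ε u) (hε : 0 < ε) {u' : ℂ → ℂ}
    (hu' : ∀ w, ‖w‖ = 1 → HasDerivAt (fun s => u s w) (u' w) 0) :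
    HasDerivAt (fun s => circleMean (u s)) (circleMean u') 0 := by
  have h0 : (0 : ℝ) ∈ Ioo (-ε) ε := ⟨by linarith, hε⟩
  obtain ⟨C, hC⟩ := hu.exists_bound hε hu'
  have key : Tendsto (fun s => ∫ θ in (0 : ℝ)..2 * Real.pi, diffQuot u s (circleMap 0 1 θ))
      (𝓝[≠] 0) (𝓝 (∫ θ in (0 : ℝ)..2 * Real.pi, u' (circleMap 0 1 θ))) := by
    refine intervalIntegral.tendsto_integral_filter_of_dominated_convergence (fun _ => C) ?_ ?_
      intervalIntegrable_const ?_
    · filter_upwards [eventually_mem_Ioo hε] with s hs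
      exact (hu.diffQuot_continuous hε hs).aestronglyMeasurable
    · filter_upwards [hC] with s hs
      exact ae_of_all _ fun θ _ => hs θ
    · exact ae_of_all _ fun θ _ => hasDerivAt_iff_tendsto_diffQuot.1 (hu' _ (by simp))
  rw [hasDerivAt_iff_tendsto_slope]
  refine (key.const_smul ((2 * Real.pi : ℝ)⁻¹)).congr' ?_
  filter_upwards [eventually_mem_Ioo hε] with s hs
  simp only [slope, diffQuot, circleMean, Real.circleAverage_def, intervalIntegral.integral_const_mul,
    vsub_eq_sub, sub_zero]
  rw [intervalIntegral.integral_sub ((hu.continuous_circle hs).intervalIntegrable _ _)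
    ((hu.continuous_circle h0).intervalIntegrable _ _), ← smul_sub, smul_comm s⁻¹, real_smul (x := s⁻¹)]
  push_cast
  rfl

/-- The variation of a contour integral `∮ A dB`: only first derivatives of `A` and `B` enter. -/
lemma CircleC1.hasDerivAt_contour {A B : ℝ → ℂ → ℂ} (hA : CircleC1 ε A) (hB : CircleC1 ε B)
    (hε : 0 < ε) {A' B' : ℂ → ℂ}
    (hA' : ∀ w, ‖w‖ = 1 → HasDerivAt (fun s => A s w) (A' w) 0)
    (hB' : ∀ w, ‖w‖ = 1 → HasDerivAt (fun s => B s w) (B' w) 0)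
    {a b : ℂ → ℂ}
    (ha : ∀ θ : ℝ, HasDerivAt (fun x : ℝ => A 0 (circleMap 0 1 x)) (I * a (circleMap 0 1 θ)) θ)
    (hb : ∀ θ : ℝ, HasDerivAt (fun x : ℝ => B 0 (circleMap 0 1 x)) (I * b (circleMap 0 1 θ)) θ) :
    HasDerivAt (fun s => contour (A s) (B s))
      (circleMean fun w => A' w * b w - a w * B' w) 0 := by
  have h0 : (0 : ℝ) ∈ Ioo (-ε) ε := ⟨by linarith, hε⟩
  set q : ℝ × ℝ → ℂ := fun q =>
    fderiv ℝ (fun q : ℝ × ℝ => B q.1 (circleMap 0 1 q.2)) q (0, 1) with hq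
  have hqc : ContinuousOn q (Ioo (-ε) ε ×ˢ univ) := hB.continuousOn_fderiv _
  have hdB : ∀ s ∈ Ioo (-ε) ε, ∀ θ, deriv (fun x : ℝ => B s (circleMap 0 1 x)) θ = q (s, θ) :=
    fun s hs θ => (hB.hasDerivAt_snd hs θ).deriv
  have hq0 : ∀ θ, q (0, θ) = I * b (circleMap 0 1 θ) := fun θ =>
    (hB.hasDerivAt_snd h0 θ).unique (hb θ)
  have hac : Continuous fun θ : ℝ => I * a (circleMap 0 1 θ) := by
    refine (hA.continuous_snd h0 (0, 1)).congr fun θ => (hA.hasDerivAt_snd h0 θ).unique (ha θ)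
  have hqcs : ∀ s ∈ Ioo (-ε) ε, Continuous fun θ : ℝ => q (s, θ) :=
    fun s hs => hB.continuous_snd hs (0, 1)
  obtain ⟨CA, hCA⟩ := hA.exists_bound hε hA'
  obtain ⟨CB, hCB⟩ := hB.exists_bound hε hB'
  obtain ⟨M, hM⟩ := ((isCompact_Icc (a := -(ε / 2)) (b := ε / 2)).prod
    (isCompact_Icc (a := (0:ℝ)) (b := 2 * Real.pi))).bddAbove_image (hqc.norm.mono
      (prod_mono (fun x hx => ⟨by linarith [hx.1], by linarith [hx.2]⟩) (subset_univ _)))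
  obtain ⟨N, hN⟩ := (isCompact_Icc (a := (0:ℝ)) (b := 2 * Real.pi)).bddAbove_image
    hac.norm.continuousOn
  have h2pi : (0 : ℝ) ≤ 2 * Real.pi := by positivity
  have k1 : Tendsto (fun s => ∫ θ in (0 : ℝ)..2 * Real.pi,
      diffQuot A s (circleMap 0 1 θ) * q (s, θ)) (𝓝[≠] 0)
      (𝓝 (∫ θ in (0 : ℝ)..2 * Real.pi, A' (circleMap 0 1 θ) * (I * b (circleMap 0 1 θ)))) := by
    refine intervalIntegral.tendsto_integral_filter_of_dominated_convergence (fun _ => CA * M) ?_ ?_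
      intervalIntegrable_const ?_
    · filter_upwards [eventually_mem_Ioo hε] with s hs
      exact ((hA.diffQuot_continuous hε hs).mul (hqcs s hs)).aestronglyMeasurable
    · filter_upwards [hCA, eventually_mem_Ioo (half_pos hε)] with s hs hs2
      refine ae_of_all _ fun θ hθ => ?_
      rw [uIoc_of_le h2pi] at hθ
      have h1 : ‖q (s, θ)‖ ≤ M :=
        hM ⟨(s, θ), ⟨Ioo_subset_Icc_self hs2, Ioc_subset_Icc_self hθ⟩, rfl⟩
      rw [norm_mul]
      exact mul_le_mul (hs θ) h1 (norm_nonneg _) ((norm_nonneg _).trans (hs θ))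
    · refine ae_of_all _ fun θ _ =>
        (hasDerivAt_iff_tendsto_diffQuot.1 (hA' _ (by simp))).mul ?_
      rw [← hq0]
      have hc : ContinuousAt q (0, θ) :=
        hqc.continuousAt ((isOpen_Ioo.prod isOpen_univ).mem_nhds ⟨h0, mem_univ _⟩)
      have : ContinuousAt (fun s : ℝ => q (s, θ)) 0 :=
        ContinuousAt.comp (g := q) (f := fun s : ℝ => (s, θ)) hc (by fun_prop)
      exact this.tendsto.mono_left nhdsWithin_le_nhds
  have k2 : Tendsto (fun s => ∫ θ in (0 : ℝ)..2 * Real.pi,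
      (I * a (circleMap 0 1 θ)) * diffQuot B s (circleMap 0 1 θ)) (𝓝[≠] 0)
      (𝓝 (∫ θ in (0 : ℝ)..2 * Real.pi, (I * a (circleMap 0 1 θ)) * B' (circleMap 0 1 θ))) := by
    refine intervalIntegral.tendsto_integral_filter_of_dominated_convergence (fun _ => N * CB) ?_ ?_
      intervalIntegrable_const ?_
    · filter_upwards [eventually_mem_Ioo hε] with s hs
      exact (hac.mul (hB.diffQuot_continuous hε hs)).aestronglyMeasurable
    · filter_upwards [hCB] with s hs
      refine ae_of_all _ fun θ hθ => ?_
      rw [uIoc_of_le h2pi] at hθ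
      have h1 : ‖I * a (circleMap 0 1 θ)‖ ≤ N := hN ⟨θ, Ioc_subset_Icc_self hθ, rfl⟩
      rw [norm_mul]
      exact mul_le_mul h1 (hs θ) (norm_nonneg _) ((norm_nonneg _).trans h1)
    · exact ae_of_all _ fun θ _ =>
        (hasDerivAt_iff_tendsto_diffQuot.1 (hB' _ (by simp))).const_mul _
  have hlim := (k1.sub k2).const_mul (2 * Real.pi * I)⁻¹
  have hval : (2 * Real.pi * I)⁻¹ *
      ((∫ θ in (0 : ℝ)..2 * Real.pi, A' (circleMap 0 1 θ) * (I * b (circleMap 0 1 θ))) -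
      ∫ θ in (0 : ℝ)..2 * Real.pi, (I * a (circleMap 0 1 θ)) * B' (circleMap 0 1 θ)) =
      circleMean fun w => A' w * b w - a w * B' w := by
    have hbc : Continuous fun θ : ℝ => I * b (circleMap 0 1 θ) :=
      (hqcs 0 h0).congr hq0
    have i1 : Continuous fun θ : ℝ => A' (circleMap 0 1 θ) * (I * b (circleMap 0 1 θ)) :=
      (hA.continuous_variation hε hA').mul hbc
    have i2 : Continuous fun θ : ℝ => (I * a (circleMap 0 1 θ)) * B' (circleMap 0 1 θ) :=
      hac.mul (hB.continuous_variation hε hB')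
    rw [← intervalIntegral.integral_sub (i1.intervalIntegrable _ _) (i2.intervalIntegrable _ _)]
    have : ∀ θ : ℝ, A' (circleMap 0 1 θ) * (I * b (circleMap 0 1 θ)) -
        (I * a (circleMap 0 1 θ)) * B' (circleMap 0 1 θ) = I *
        (A' (circleMap 0 1 θ) * b (circleMap 0 1 θ) - a (circleMap 0 1 θ) * B' (circleMap 0 1 θ)) :=
      fun θ => by ring
    simp only [this, intervalIntegral.integral_const_mul]
    rw [circleMean, Real.circleAverage_def, real_smul]
    push_cast
    have := I_ne_zero
    field_simp
  rw [hval] at hlim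
  rw [hasDerivAt_iff_tendsto_slope]
  refine hlim.congr' ?_
  filter_upwards [eventually_mem_Ioo hε, self_mem_nhdsWithin] with s hs hs0
  have hs0' : (s : ℂ) ≠ 0 := ofReal_ne_zero.2 hs0
  -- The difference quotient of the angular derivative of B need not converge, as a `C¹` family may
  -- lack mixed second derivatives. Integration by parts moves the derivative to A; boundary terms
  -- cancel by periodicity.
  have hparts : ∫ θ in (0 : ℝ)..2 * Real.pi, A 0 (circleMap 0 1 θ) *
      ((s : ℂ)⁻¹ * (q (s, θ) - q (0, θ))) =
      - ∫ θ in (0 : ℝ)..2 * Real.pi, (I * a (circleMap 0 1 θ)) * diffQuot B s (circleMap 0 1 θ) := by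
    have := intervalIntegral.integral_mul_deriv_eq_deriv_mul (a := 0) (b := 2 * Real.pi)
      (u := fun θ => A 0 (circleMap 0 1 θ)) (u' := fun θ => I * a (circleMap 0 1 θ))
      (v := fun θ => diffQuot B s (circleMap 0 1 θ))
      (v' := fun θ => (s : ℂ)⁻¹ * (q (s, θ) - q (0, θ))) (fun θ _ => ha θ)
      (fun θ _ => ((hB.hasDerivAt_snd hs θ).sub (hB.hasDerivAt_snd h0 θ)).const_mul _)
      (hac.intervalIntegrable _ _)
      ((continuous_const.mul ((hqcs s hs).sub (hqcs 0 h0))).intervalIntegrable _ _)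
    rw [this]
    have h2 : circleMap 0 1 (2 * Real.pi) = circleMap 0 1 0 := by
      simpa using periodic_circleMap 0 1 0
    rw [h2, sub_self, zero_sub]
  have hJ : ∀ t ∈ Ioo (-ε) ε, contour (A t) (B t) = (2 * Real.pi * I)⁻¹ *
      ∫ θ in (0 : ℝ)..2 * Real.pi, A t (circleMap 0 1 θ) * q (t, θ) := fun t ht => by
    rw [contour]; simp only [hdB t ht]
  have i1 : Continuous fun θ : ℝ => A s (circleMap 0 1 θ) * q (s, θ) :=
    (hA.continuous_circle hs).mul (hqcs s hs)
  have i2 : Continuous fun θ : ℝ => A 0 (circleMap 0 1 θ) * q (0, θ) :=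
    (hA.continuous_circle h0).mul (hqcs 0 h0)
  have i3 : Continuous fun θ : ℝ => diffQuot A s (circleMap 0 1 θ) * q (s, θ) :=
    (hA.diffQuot_continuous hε hs).mul (hqcs s hs)
  have i4 : Continuous fun θ : ℝ => A 0 (circleMap 0 1 θ) * ((s : ℂ)⁻¹ * (q (s, θ) - q (0, θ))) :=
    (hA.continuous_circle h0).mul (continuous_const.mul ((hqcs s hs).sub (hqcs 0 h0)))
  rw [slope, vsub_eq_sub, sub_zero, hJ s hs, hJ 0 h0, ← mul_sub, real_smul,
    ← intervalIntegral.integral_sub (i1.intervalIntegrable _ _) (i2.intervalIntegrable _ _),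
    sub_eq_add_neg, ← hparts,
    ← intervalIntegral.integral_add (i3.intervalIntegrable _ _) (i4.intervalIntegrable _ _),
    mul_left_comm]
  congr 1
  rw [← intervalIntegral.integral_const_mul]
  congr 1
  funext θ
  rw [diffQuot]
  push_cast
  ring

/-- A family of disc functions that is `C¹` on the circle is differentiable in the parameter on the
whole closed disc, and the derivative is a disc function. -/
lemma CircleC1.exists_discAlg_variation (hu : CircleC1 ε u) (hε : 0 < ε)
    (hd : ∀ s ∈ Ioo (-ε) ε, DiscAlg (u s)) :
    ∃ u' : ℂ → ℂ, DiscAlg u' ∧ ∀ w, ‖w‖ ≤ 1 → HasDerivAt (fun s => u s w) (u' w) 0 := by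
  have h0 : (0 : ℝ) ∈ Ioo (-ε) ε := ⟨by linarith, hε⟩
  obtain ⟨v, hv⟩ := hu.exists_hasDerivAt hε
  have hdq : ∀ s ∈ Ioo (-ε) ε, DiscAlg (diffQuot u s) := fun s hs => by
    have : DiscAlg (fun w => (s : ℂ)⁻¹ • (u s - u 0) w) :=
      diffContOnCl_const.smul ((hd s hs).sub (hd 0 h0))
    exact this
  have hC := (hu.tendstoUniformlyOn hε hv).uniformCauchySeqOn
  -- By the maximum principle the uniform Cauchy property on the circle passes to the closed disc.
  have hC' : UniformCauchySeqOn (diffQuot u) (𝓝[≠] 0) (Metric.closedBall 0 1) := by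
    intro V hV
    obtain ⟨δ, hδ, hδV⟩ := Metric.mem_uniformity_dist.1 hV
    filter_upwards [hC _ (Metric.dist_mem_uniformity (half_pos hδ)),
      (eventually_mem_Ioo hε).prod_mk (eventually_mem_Ioo hε)] with m hm hm2 w hw
    refine hδV ?_
    have hmax := Complex.norm_le_of_forall_mem_frontier_norm_le (C := δ / 2)
      (Metric.isBounded_ball (x := (0 : ℂ)) (r := 1)) ((hdq _ hm2.1).sub (hdq _ hm2.2)) (by
        rw [frontier_ball (0 : ℂ) one_ne_zero]
        intro z hz
        have := hm z hz
        simp only [dist_eq_norm] at this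
        exact this.le) (z := w) (by rwa [closure_ball (0 : ℂ) one_ne_zero])
    rw [dist_eq_norm]
    exact lt_of_le_of_lt hmax (half_lt_self hδ)
  have hlim : ∀ w : ℂ, ∃ l, ‖w‖ ≤ 1 → Tendsto (fun s => diffQuot u s w) (𝓝[≠] 0) (𝓝 l) := by
    intro w
    by_cases hw : ‖w‖ ≤ 1
    · have hc := hC'.cauchy_map (mem_closedBall_zero_iff.2 hw)
      obtain ⟨l, hl⟩ := CompleteSpace.complete hc
      exact ⟨l, fun _ => hl⟩
    · exact ⟨0, fun h => absurd h hw⟩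
  choose u' hu' using hlim
  have hU : TendstoUniformlyOn (diffQuot u) u' (𝓝[≠] 0) (Metric.closedBall 0 1) :=
    hC'.tendstoUniformlyOn_of_tendsto fun w hw => hu' w (by simpa using hw)
  refine ⟨u', discAlg_iff.2 ⟨?_, ?_⟩, fun w hw => hasDerivAt_iff_tendsto_diffQuot.2 (hu' w hw)⟩
  · refine (hU.mono Metric.ball_subset_closedBall).tendstoLocallyUniformlyOn.differentiableOn ?_
      Metric.isOpen_ball
    filter_upwards [eventually_mem_Ioo hε] with s hs
    exact (hdq s hs).1
  · refine hU.continuousOn (Eventually.frequently ?_)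
    filter_upwards [eventually_mem_Ioo hε] with s hs
    exact (hdq s hs).continuousOn'

end Regularity

/-! ### Regular maps and polynomial parts. -/

/-- `p` and `P = p - ζ p'` describe the conformal map `ζ ↦ ζ / p ζ` of the disc, which is `C¹` up
to the boundary. -/
structure RegularMap (p P : ℂ → ℂ) : Prop where
  disc : DiscAlg p
  disc' : DiscAlg P
  ne : ∀ w, ‖w‖ ≤ 1 → p w ≠ 0
  ne' : ∀ w, ‖w‖ ≤ 1 → P w ≠ 0
  eq_deriv : ∀ w, ‖w‖ < 1 → P w = p w - w * deriv p w
  c1 : DiscC1 fun w => w / p w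
  circle : ∀ θ : ℝ, HasDerivAt (fun x : ℝ => p (circleMap 0 1 x))
    (I * (p (circleMap 0 1 θ) - P (circleMap 0 1 θ))) θ

lemma RegularMap.map_zero {p P : ℂ → ℂ} (h : RegularMap p P) : P 0 = p 0 := by
  rw [h.eq_deriv 0 (by simp)]; simp

lemma DiscAlg.div {u v : ℂ → ℂ} (hu : DiscAlg u) (hv : DiscAlg v) (h : ∀ w, ‖w‖ ≤ 1 → v w ≠ 0) :
    DiscAlg fun w => u w / v w := by
  rw [discAlg_iff] at *
  exact ⟨hu.1.div hv.1 fun w hw => h w (mem_closedBall_zero_iff.1 (Metric.ball_subset_closedBall hw)),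
    hu.2.div hv.2 fun w hw => h w (mem_closedBall_zero_iff.1 hw)⟩

lemma DiscAlg.mul {u v : ℂ → ℂ} (hu : DiscAlg u) (hv : DiscAlg v) : DiscAlg fun w => u w * v w :=
  hu.smul hv

lemma DiscAlg.pow {u : ℂ → ℂ} (hu : DiscAlg u) (n : ℕ) : DiscAlg fun w => u w ^ n := by
  rw [discAlg_iff] at *
  exact ⟨hu.1.pow n, hu.2.pow n⟩

lemma Differentiable.discAlg {u : ℂ → ℂ} (hu : Differentiable ℂ u) : DiscAlg u := hu.diffContOnCl

lemma discAlg_id : DiscAlg fun w => w := differentiable_id.diffContOnCl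

lemma DiscAlg.continuousOn_sphere {u : ℂ → ℂ} (hu : DiscAlg u) :
    ContinuousOn u (Metric.sphere 0 1) := hu.continuousOn'.mono Metric.sphere_subset_closedBall

lemma continuousOn_inv_sphere : ContinuousOn (fun w : ℂ => w⁻¹) (Metric.sphere 0 1) :=
  continuousOn_id.inv₀ fun w hw h0 => by
    rw [id_eq] at h0
    simp [h0] at hw

lemma ContinuousOn.comp_inv_sphere {u : ℂ → ℂ} (hu : ContinuousOn u (Metric.sphere 0 1)) :
    ContinuousOn (fun w => u w⁻¹) (Metric.sphere 0 1) :=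
  hu.comp continuousOn_inv_sphere fun w hw => by simpa using hw

/-- The source of every integration by parts for means: an angular derivative has mean zero by
periodicity. -/
lemma circleMean_deriv_eq_zero {F F' : ℂ → ℂ} (hF' : ContinuousOn F' (Metric.sphere 0 1))
    (h : ∀ θ : ℝ, HasDerivAt (fun x : ℝ => F (circleMap 0 1 x)) (I * F' (circleMap 0 1 θ)) θ) :
    circleMean F' = 0 := by
  have hc : Continuous fun θ : ℝ => F' (circleMap 0 1 θ) :=
    hF'.comp_continuous (continuous_circleMap 0 1) fun θ => by simp
  have h1 := intervalIntegral.integral_eq_sub_of_hasDerivAt (a := 0) (b := 2 * Real.pi)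
    (fun θ _ => h θ) ((continuous_const.mul hc).intervalIntegrable _ _)
  have h2 : circleMap 0 1 (2 * Real.pi) = circleMap 0 1 0 := by
    simpa using periodic_circleMap 0 1 0
  rw [h2, sub_self, intervalIntegral.integral_const_mul, mul_eq_zero] at h1
  rw [circleMean, Real.circleAverage_def, h1.resolve_left I_ne_zero, smul_zero]

/-- The polynomial part `Σ_{j<n} c_j w^(n-j) + c_n / 2`. -/
def polyPart (c : ℕ → ℂ) (n : ℕ) (w : ℂ) : ℂ :=
  ∑ j ∈ Finset.range n, c j * w ^ (n - j) + c n / 2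

/-- The Euler derivative `w d/dw` of `polyPart`. -/
def polyEuler (c : ℕ → ℂ) (n : ℕ) (w : ℂ) : ℂ :=
  ∑ j ∈ Finset.range n, ((n - j : ℕ) : ℂ) * c j * w ^ (n - j)

lemma differentiable_polyPart (c : ℕ → ℂ) (n : ℕ) : Differentiable ℂ (polyPart c n) := by
  unfold polyPart; fun_prop

lemma differentiable_polyEuler (c : ℕ → ℂ) (n : ℕ) : Differentiable ℂ (polyEuler c n) := by
  unfold polyEuler; fun_prop

lemma hasDerivAt_polyPart (c : ℕ → ℂ) (n : ℕ) {w : ℂ} (hw : w ≠ 0) :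
    HasDerivAt (polyPart c n) (polyEuler c n w / w) w := by
  unfold polyPart
  have : HasDerivAt (fun w : ℂ => ∑ j ∈ Finset.range n, c j * w ^ (n - j))
      (∑ j ∈ Finset.range n, c j * (((n - j : ℕ) : ℂ) * w ^ (n - j - 1))) w :=
    HasDerivAt.fun_sum fun j _ => (hasDerivAt_pow (n - j) w).const_mul (c j)
  refine (this.add_const _).congr_deriv ?_
  rw [polyEuler, Finset.sum_div]
  refine Finset.sum_congr rfl fun j hj => ?_
  have : n - j = (n - j - 1) + 1 := by have := Finset.mem_range.1 hj; omega
  rw [eq_div_iff hw]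
  conv_rhs => rw [this, pow_succ, ← this]
  ring

lemma polyEuler_zero (c : ℕ → ℂ) (n : ℕ) : polyEuler c n 0 = 0 := by
  refine Finset.sum_eq_zero fun j hj => ?_
  rw [zero_pow (by have := Finset.mem_range.1 hj; omega), mul_zero]

lemma polyPart_zero (c : ℕ → ℂ) (n : ℕ) : polyPart c n 0 = c n / 2 := by
  rw [polyPart, Finset.sum_eq_zero, zero_add]
  intro j hj
  rw [zero_pow (by have := Finset.mem_range.1 hj; omega), mul_zero]

/-- Splitting of `ζ⁻ⁿ h(ζ)` into its polynomial part and a disc function. -/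
lemma DiscAlg.exists_split {h : ℂ → ℂ} (hh : DiscAlg h) (n : ℕ) : ∃ R, DiscAlg R ∧
    R 0 = taylorCoeff h n / 2 ∧
    ∀ z, z ≠ 0 → z⁻¹ ^ n * h z = polyPart (taylorCoeff h) n z⁻¹ + R z := by
  obtain ⟨S, hS, hz⟩ := hh.exists_taylor (n + 1)
  refine ⟨fun z => taylorCoeff h n / 2 + z * S z, ?_, by simp, fun z hz0 => ?_⟩
  · exact (diffContOnCl_const (c := taylorCoeff h n / 2)).add
      (DiscAlg.mul discAlg_id hS)
  · conv_lhs => rw [hz z]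
    rw [polyPart, Finset.sum_range_succ, mul_add, mul_add, Finset.mul_sum]
    have : ∀ j ∈ Finset.range n, z⁻¹ ^ n * (taylorCoeff h j * z ^ j) =
        taylorCoeff h j * z⁻¹ ^ (n - j) := by
      intro j hj
      have hj' : n = (n - j) + j := by have := Finset.mem_range.1 hj; omega
      conv_lhs => rw [hj', pow_add]
      have : z⁻¹ ^ j * z ^ j = 1 := by rw [← mul_pow, inv_mul_cancel₀ hz0, one_pow]
      linear_combination taylorCoeff h j * z⁻¹ ^ (n - j) * this
    rw [Finset.sum_congr rfl this]
    have h1 : z⁻¹ ^ n * z ^ n = 1 := by rw [← mul_pow, inv_mul_cancel₀ hz0, one_pow]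
    rw [pow_succ]
    linear_combination (taylorCoeff h n + z * S z) * h1

/-! ### The cross form, its uniqueness properties and its moments. -/

section

variable {p P k K : ℂ → ℂ}

/-- `a(w) K(1/w) + c(1/w) P(w)`: up to a factor, the variation of the symplectic form
`δ(1/f) dg - δg d(1/f)` on the unit circle. -/
def crossForm (P K a c : ℂ → ℂ) (w : ℂ) : ℂ := a w * K w⁻¹ + c w⁻¹ * P w

/-- The symmetry that deduces the negative times from the positive ones. -/
lemma crossForm_inv (P K a c : ℂ → ℂ) (w : ℂ) : crossForm P K a c w⁻¹ = crossForm K P c a w := by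
  simp only [crossForm, inv_inv]; ring

lemma continuousOn_crossForm {a c : ℂ → ℂ} (hP : DiscAlg P) (hK : DiscAlg K) (ha : DiscAlg a)
    (hc : DiscAlg c) : ContinuousOn (crossForm P K a c) (Metric.sphere 0 1) :=
  (ha.continuousOn_sphere.mul (ContinuousOn.comp_inv_sphere hK.continuousOn_sphere)).add
    ((ContinuousOn.comp_inv_sphere hc.continuousOn_sphere).mul hP.continuousOn_sphere)

/-- Variations are determined by `crossForm`. -/
lemma RegularMap.crossForm_injective (hp : RegularMap p P) (hk : RegularMap k K) (h0 : p 0 = k 0)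
    {a c a' c' : ℂ → ℂ} (ha : DiscAlg a) (hc : DiscAlg c) (ha' : DiscAlg a') (hc' : DiscAlg c')
    (hac : a 0 = c 0) (hac' : a' 0 = c' 0)
    (h : ∀ w, ‖w‖ = 1 → crossForm P K a c w = crossForm P K a' c' w) :
    ∀ w, ‖w‖ ≤ 1 → a w = a' w ∧ c w = c' w := by
  have hA : DiscAlg fun w => (a w - a' w) / P w :=
    DiscAlg.div (u := fun w => a w - a' w) (ha.sub ha') hp.disc' hp.ne'
  have hC : DiscAlg fun w => -(c w - c' w) / K w :=
    DiscAlg.div (u := fun w => -(c w - c' w)) (hc.sub hc').neg hk.disc' hk.ne'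
  -- Equality of cross forms separates variables: one side extends into the disc, the other into the
  -- exterior, so both are constant.
  have hcirc : ∀ w, ‖w‖ = 1 → (a w - a' w) / P w = -(c w⁻¹ - c' w⁻¹) / K w⁻¹ := by
    intro w hw
    have hw' : ‖w⁻¹‖ ≤ 1 := by rw [norm_inv, hw, inv_one]
    rw [div_eq_div_iff (hp.ne' w hw.le) (hk.ne' _ hw')]
    have := h w hw
    simp only [crossForm] at this
    linear_combination this
  obtain ⟨e0, e1⟩ := hA.const_of_inv hC hcirc
  obtain ⟨-, e2⟩ := hC.const_of_inv hA fun w hw => by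
    have := hcirc w⁻¹ (by rw [norm_inv, hw, inv_one])
    rw [inv_inv] at this
    exact this.symm
  have hK0 : K 0 ≠ 0 := hk.ne' 0 (by simp)
  -- At 0 the denominators agree, P(0) = p(0) = k(0) = K(0), and so do the numerators up to sign;
  -- the common constant equals its own negative.
  have hz : a 0 - a' 0 = 0 := by
    rw [hp.map_zero, h0, ← hk.map_zero, div_left_inj' hK0, hac, hac'] at e0
    rw [hac, hac']
    linear_combination e0 / 2
  intro w hw
  have f1 := e1 w hw
  have f2 := e2 w hw
  rw [← e0] at f2
  rw [hz, zero_div, div_eq_zero_iff] at f1 f2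
  have g1 := f1.resolve_right (hp.ne' w hw)
  have g2 := f2.resolve_right (hk.ne' w hw)
  exact ⟨by linear_combination g1, by linear_combination -g2⟩

/-- A density on the circle is determined by its moments against powers of the two maps. -/
lemma RegularMap.eq_zero_of_moments (hp : RegularMap p P) (hk : RegularMap k K) {φ : ℂ → ℂ}
    (hφ : ContinuousOn φ (Metric.sphere 0 1))
    (h₁ : ∀ m : ℕ, circleMean (fun w => (w / p w) ^ m * φ w) = 0)
    (h₂ : ∀ m : ℕ, circleMean (fun w => (w⁻¹ / k w⁻¹) ^ m * φ w) = 0) {w : ℂ} (hw : ‖w‖ = 1) :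
    φ w = 0 := by
  refine eq_zero_of_circleMean_eq_zero hφ (hp.c1.circleMean_pow_mul_eq_zero hφ h₁) (fun m => ?_) hw
  have := hk.c1.circleMean_pow_mul_eq_zero (φ := fun w => φ w⁻¹)
    (ContinuousOn.comp_inv_sphere hφ) (fun m => by
      rw [← h₂ m, ← circleMean_inv]
      simp only [inv_inv]) m
  rw [← this, ← circleMean_inv]
  simp only [inv_inv]

/-- The moments of the Euler derivative of the polynomial part of `(k/ζ)ⁿ` against the powers of
`ζ/k`. -/
lemma RegularMap.circleMean_polyEuler (hk : RegularMap k K) (n m : ℕ) :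
    circleMean (fun w => (w / k w) ^ m * polyEuler (taylorCoeff fun z => k z ^ n) n w⁻¹) =
      if m = n then (n : ℂ) else 0 := by
  set c := taylorCoeff fun z => k z ^ n
  obtain ⟨R, hR, hR0, hsplit⟩ := (hk.disc.pow n).exists_split n
  have hne : ∀ θ : ℝ, k (circleMap 0 1 θ) ≠ 0 := fun θ => hk.ne _ (by simp)
  have hne0 : ∀ θ : ℝ, circleMap 0 1 θ ≠ 0 := fun θ => circleMap_ne_center one_ne_zero
  have hG : ∀ θ : ℝ, HasDerivAt (fun x : ℝ => circleMap 0 1 x / k (circleMap 0 1 x))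
      (I * (circleMap 0 1 θ / k (circleMap 0 1 θ) * (K (circleMap 0 1 θ) / k (circleMap 0 1 θ)))) θ := by
    intro θ
    refine ((hasDerivAt_circleMap 0 1 θ).div (hk.circle θ) (hne θ)).congr_deriv ?_
    have := hne θ
    field_simp
    ring
  have hq : DiscAlg fun w => K w / k w := hk.disc'.div hk.disc hk.ne
  have hGd : DiscAlg fun w => w / k w := hk.c1.discAlg
  have hinv : ∀ θ : ℝ, HasDerivAt (fun x : ℝ => (circleMap 0 1 x)⁻¹) (-(I * (circleMap 0 1 θ)⁻¹)) θ := by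
    intro θ
    refine ((hasDerivAt_circleMap 0 1 θ).inv (hne0 θ)).congr_deriv ?_
    have := hne0 θ
    field_simp
  have hcE : ContinuousOn (fun w : ℂ => polyEuler c n w⁻¹) (Metric.sphere 0 1) :=
    (differentiable_polyEuler c n).continuous.comp_continuousOn continuousOn_inv_sphere
  have hcB : ContinuousOn (fun w : ℂ => polyPart c n w⁻¹) (Metric.sphere 0 1) :=
    (differentiable_polyPart c n).continuous.comp_continuousOn continuousOn_inv_sphere
  have hcG := hGd.continuousOn_sphere
  have hcq := hq.continuousOn_sphere
  have hc₁ : ContinuousOn (fun w => (m : ℂ) * ((w / k w) ^ m * (K w / k w) * polyPart c n w⁻¹))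
      (Metric.sphere 0 1) := continuousOn_const.mul (((hcG.pow m).mul hcq).mul hcB)
  have hc₂ : ContinuousOn (fun w => (w / k w) ^ m * polyEuler c n w⁻¹) (Metric.sphere 0 1) :=
    (hcG.pow m).mul hcE
  -- The angular derivative of (w/k)ᵐ times the polynomial part at 1/w has mean zero; here w d/dw
  -- (w/k) = (w/k)(K/k).
  have hmain : circleMean (fun w => (m : ℂ) * ((w / k w) ^ m * (K w / k w) * polyPart c n w⁻¹)
      - (w / k w) ^ m * polyEuler c n w⁻¹) = 0 := by
    refine circleMean_deriv_eq_zero (F := fun w => (w / k w) ^ m * polyPart c n w⁻¹) ?_ fun θ => ?_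
    · exact hc₁.sub hc₂
    · have hB := (hasDerivAt_polyPart c n (inv_ne_zero (hne0 θ))).comp_of_eq θ (hinv θ) rfl
      refine (((hG θ).pow m).mul hB).congr_deriv ?_
      have := hne0 θ
      have h2 := hne θ
      simp only [Function.comp_apply, Pi.pow_apply]
      rcases m with _ | m
      · simp
        field_simp
      · rw [Nat.add_sub_cancel, pow_succ]
        field_simp
        ring
  rw [circleMean_sub hc₁ hc₂, circleMean_const_mul, sub_eq_zero] at hmain
  rw [← hmain]
  rcases Nat.eq_zero_or_pos m with rfl | hm
  · by_cases hn : 0 = n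
    · simp [← hn]
    · simp [hn]
  -- The polynomial part at 1/w is (w/k)⁻ⁿ minus a disc function R. For m > 0 the R-term is a disc
  -- function vanishing at 0, so only (w/k)^{m-n} K/k contributes: a total derivative unless m = n,
  -- and then of mean K(0)/k(0) = 1.
  have hz : ∀ w : ℂ, ‖w‖ = 1 → (w / k w) ^ m * (K w / k w) * polyPart c n w⁻¹ =
      (w / k w) ^ ((m : ℤ) - n) * (K w / k w) - (w / k w) ^ m * (K w / k w) * R w := by
    intro w hw
    have hw0 : w ≠ 0 := by rintro rfl; simp at hw
    have hkw := hk.ne w hw.le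
    have := hsplit w hw0
    rw [zpow_sub₀ (div_ne_zero hw0 hkw), zpow_natCast, zpow_natCast]
    have h3 : polyPart c n w⁻¹ = w⁻¹ ^ n * k w ^ n - R w := by
      rw [eq_sub_iff_add_eq]; exact this.symm
    rw [h3, div_pow w (k w) n, inv_pow]
    field_simp
  have hcz : ContinuousOn (fun w => (w / k w) ^ ((m : ℤ) - n)) (Metric.sphere 0 1) :=
    hcG.zpow₀ _ fun w hw => Or.inl (div_ne_zero (by rintro rfl; simp at hw)
      (hk.ne w (by simpa using (mem_sphere_zero_iff_norm.1 hw).le)))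
  have hcz' : ContinuousOn (fun w => (w / k w) ^ ((m : ℤ) - n) * (K w / k w)) (Metric.sphere 0 1) :=
    hcz.mul hcq
  have hd : DiscAlg fun w => (w / k w) ^ m * (K w / k w) * R w :=
    DiscAlg.mul (DiscAlg.mul (hGd.pow m) hq) hR
  rw [circleMean_congr hz, circleMean_sub hcz' hd.continuousOn_sphere,
    circleMean_discAlg hd]
  simp only [zero_div, zero_pow hm.ne', zero_mul, sub_zero]
  split_ifs with hmn
  · subst hmn
    simp only [sub_self, zpow_zero, one_mul]
    rw [circleMean_discAlg hq, hk.map_zero, div_self (hk.ne 0 (by simp)), mul_one]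
  · have hj : ((m : ℤ) - n : ℤ) ≠ 0 := by omega
    have : circleMean (fun w => ((m - n : ℤ) : ℂ) * ((w / k w) ^ ((m : ℤ) - n) * (K w / k w))) = 0 := by
      refine circleMean_deriv_eq_zero (F := fun w => (w / k w) ^ ((m : ℤ) - n))
        (continuousOn_const.mul (hcz.mul hcq)) fun θ => ?_
      have h1 : circleMap 0 1 θ / k (circleMap 0 1 θ) ≠ 0 := div_ne_zero (hne0 θ) (hne θ)
      refine ((hasDerivAt_zpow ((m : ℤ) - n) _ (Or.inl h1)).comp θ (hG θ)).congr_deriv ?_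
      rw [zpow_sub_one₀ h1]
      field_simp
    rw [circleMean_const_mul, mul_eq_zero] at this
    rw [this.resolve_left (by exact_mod_cast hj), mul_zero]

end

/-! ### Variations expressed by Poisson brackets. -/

section

variable {p P k K : ℂ → ℂ}

/-- If the `t₀`-variation `(p₀, k₀)` is known, the variation whose cross form is the Euler derivative
of the polynomial part of `(k/ζ)ⁿ` is given by Poisson brackets. -/
lemma RegularMap.variation_eq_bracket (hp : RegularMap p P) (hk : RegularMap k K)
    (h0 : p 0 = k 0) {p₀ k₀ a c : ℂ → ℂ} (hp₀ : DiscAlg p₀) (hk₀ : DiscAlg k₀)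
    (hΛ₀ : ∀ w, ‖w‖ = 1 → crossForm P K p₀ k₀ w = 1) {n : ℕ} (hn : 1 ≤ n)
    (ha : DiscAlg a) (hc : DiscAlg c) (hac : a 0 = c 0)
    (hΛ : ∀ w, ‖w‖ = 1 → crossForm P K a c w = polyEuler (taylorCoeff fun z => k z ^ n) n w) :
    ∀ w, ‖w‖ ≤ 1 →
      a w = polyEuler (taylorCoeff fun z => k z ^ n) n w * p₀ w +
        P w * polyPart (taylorCoeff fun z => n * k z ^ (n - 1) * k₀ z) n w ∧
      (w ≠ 0 → c w = polyEuler (taylorCoeff fun z => k z ^ n) n w⁻¹ * k₀ w -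
        K w * polyPart (taylorCoeff fun z => n * k z ^ (n - 1) * k₀ z) n w⁻¹) := by
  set e := polyEuler (taylorCoeff fun z => k z ^ n) n
  set b := polyPart (taylorCoeff fun z => n * k z ^ (n - 1) * k₀ z) n
  have hd₀ : DiscAlg fun z => n * k z ^ (n - 1) * k₀ z :=
    DiscAlg.mul (DiscAlg.mul (diffContOnCl_const (c := (n : ℂ))) (hk.disc.pow (n - 1))) hk₀
  obtain ⟨R, hR, -, hRs⟩ := (hk.disc.pow n).exists_split n
  obtain ⟨R₀, hR₀, hR₀0, hR₀s⟩ := hd₀.exists_split n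
  have he : Differentiable ℂ e := differentiable_polyEuler _ n
  have hb : Differentiable ℂ b := differentiable_polyPart _ n
  have hRd : ∀ z, ‖z‖ < 1 → HasDerivAt R (deriv R z) z := fun z hz =>
    (hR.1.differentiableAt (Metric.isOpen_ball.mem_nhds (mem_ball_zero_iff.2 hz))).hasDerivAt
  have hkd : ∀ z, ‖z‖ < 1 → HasDerivAt k (deriv k z) z := fun z hz =>
    (hk.disc.1.differentiableAt (Metric.isOpen_ball.mem_nhds (mem_ball_zero_iff.2 hz))).hasDerivAt
  -- Euler derivative z d/dz of the splitting z⁻ⁿ kⁿ = B(1/z) + R(z).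
  have hEuler : ∀ z, z ≠ 0 → ‖z‖ < 1 →
      e z⁻¹ = n * z⁻¹ ^ n * k z ^ (n - 1) * K z + z * deriv R z := by
    intro z hz0 hz
    have h1 := (((hasDerivAt_inv hz0).pow n).mul ((hkd z hz).pow n))
    have h2 := ((hasDerivAt_polyPart (taylorCoeff fun z => k z ^ n) n (inv_ne_zero hz0)).comp z
      (hasDerivAt_inv hz0)).add (hRd z hz)
    have h3 := h1.unique (h2.congr_of_eventuallyEq (by
      filter_upwards [isOpen_ne.mem_nhds hz0] with y hy
      simpa using hRs y hy))
    simp only [Pi.pow_apply] at h3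
    obtain ⟨m, rfl⟩ : ∃ m, n = m + 1 := ⟨n - 1, by omega⟩
    rw [hk.eq_deriv z hz]
    simp only [Nat.add_sub_cancel] at h3 ⊢
    have hi : z⁻¹ * z = 1 := inv_mul_cancel₀ hz0
    have h4 : e z⁻¹ / z⁻¹ * -(z ^ 2)⁻¹ = -(e z⁻¹) * z⁻¹ := by
      field_simp
    have h5 : -(z ^ 2)⁻¹ = -(z⁻¹ * z⁻¹) := by rw [← inv_pow, pow_two]
    change _ = e z⁻¹ / z⁻¹ * -(z ^ 2)⁻¹ + deriv R z at h3
    rw [h4, h5] at h3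
    have h6 : z⁻¹ ^ (m + 1) = z⁻¹ ^ m * z⁻¹ := pow_succ _ _
    have h7 : k z ^ (m + 1) = k z ^ m * k z := pow_succ _ _
    rw [h6, h7] at h3
    rw [h6]
    push_cast at h3 ⊢
    linear_combination z * h3 + (-(e z⁻¹) + (m + 1) * z⁻¹ ^ m * z⁻¹ * k z ^ m * k z) * hi
  set cs : ℂ → ℂ := fun z => e z⁻¹ * k₀ z - K z * b z⁻¹ with hcs
  -- Inserting both splittings into `cs`, the singular products n z⁻ⁿ kⁿ⁻¹ K k₀ cancel.
  set ci : ℂ → ℂ := fun z => z * deriv R z * k₀ z + K z * R₀ z with hci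
  have hagree : ∀ z, z ≠ 0 → ‖z‖ < 1 → cs z = ci z := by
    intro z hz0 hz
    have h1 := hEuler z hz0 hz
    have h2 := hR₀s z hz0
    simp only [hcs, hci]
    change _ = b z⁻¹ + R₀ z at h2
    rw [h1]
    linear_combination K z * h2
  -- Neither formula serves alone: `cs` is not given correctly at 0, and `ci` contains R', which is
  -- controlled only in the open disc.
  set c' : ℂ → ℂ := fun z => if ‖z‖ < 1 then ci z else cs z with hc'
  have hc's : ∀ z, z ≠ 0 → c' z = cs z := by
    intro z hz0
    simp only [hc']
    split_ifs with h
    · exact (hagree z hz0 h).symm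
    · rfl
  have hcid : DifferentiableOn ℂ ci (Metric.ball 0 1) :=
    ((differentiableOn_id.mul (hR.1.deriv Metric.isOpen_ball)).mul hk₀.1).add
      (hk.disc'.1.mul hR₀.1)
  have hc'd : DifferentiableOn ℂ c' (Metric.ball 0 1) :=
    hcid.congr fun z hz => by simp only [hc', if_pos (mem_ball_zero_iff.1 hz)]
  have hc'disc : DiscAlg c' := by
    refine discAlg_iff.2 ⟨hc'd, fun z hz => ?_⟩
    by_cases hz0 : z = 0
    · subst hz0
      exact (hc'd.differentiableAt (Metric.ball_mem_nhds _ one_pos)).continuousAt.continuousWithinAt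
    · have hci : ContinuousWithinAt (fun z : ℂ => z⁻¹) (Metric.closedBall 0 1) z :=
        (continuousAt_inv₀ hz0).continuousWithinAt
      have h1 : ContinuousWithinAt cs (Metric.closedBall 0 1) z :=
        ((he.continuous.continuousAt.comp_continuousWithinAt hci).mul (hk₀.continuousOn' z hz)).sub
          ((hk.disc'.continuousOn' z hz).mul (hb.continuous.continuousAt.comp_continuousWithinAt hci))
      refine h1.congr_of_eventuallyEq ?_ (hc's z hz0)
      filter_upwards [nhdsWithin_le_nhds (isOpen_ne.mem_nhds hz0)] with y hy
      exact hc's y hy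
  have ha'disc : DiscAlg fun w => e w * p₀ w + P w * b w :=
    DiffContOnCl.add (DiscAlg.mul he.diffContOnCl hp₀) (DiscAlg.mul hp.disc' hb.diffContOnCl)
  -- Here the weight 1/2 is essential: b(0) and R₀(0) are both half of the same Taylor coefficient,
  -- and P(0) = K(0).
  have hac' : e 0 * p₀ 0 + P 0 * b 0 = c' 0 := by
    simp only [hc', norm_zero, zero_lt_one, if_true, hci, zero_mul, zero_add, hR₀0, b,
      polyPart_zero, e, polyEuler_zero]
    rw [hp.map_zero, hk.map_zero, h0]
  -- In the candidate's cross form the terms P K b cancel, leaving e times the cross form of the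
  -- t_0-variation, which is 1.
  have huniq := hp.crossForm_injective hk h0 ha hc ha'disc hc'disc hac hac' (by
    intro w hw
    have hw0 : w ≠ 0 := by rintro rfl; simp at hw
    rw [hΛ w hw]
    have h1 := hΛ₀ w hw
    simp only [crossForm] at h1 ⊢
    rw [hc's _ (inv_ne_zero hw0)]
    simp only [hcs, inv_inv]
    linear_combination (-e w) * h1)
  intro w hw
  refine ⟨(huniq w hw).1, fun hw0 => ?_⟩
  rw [(huniq w hw).2, hc's w hw0]

end

/-! ### From homeomorphisms of the sphere to affine `C¹` data. -/

lemma isPreconnected_ball_sdiff_singleton (u : ℂ) : IsPreconnected (Metric.ball (0 : ℂ) 1 \ {u}) := by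
  by_cases hu : u ∈ Metric.ball (0 : ℂ) 1
  -- The disc is homeomorphic to the plane, and a plane of real dimension two minus a point is
  -- connected.
  · let e : ℂ ≃ₜ Metric.ball (0 : ℂ) 1 := Homeomorph.unitBall
    have h1 : IsPreconnected ({e.symm ⟨u, hu⟩}ᶜ : Set ℂ) :=
      (isConnected_compl_singleton_of_one_lt_rank (by simp) _).isPreconnected
    have h2 := h1.image (fun z => (e z : ℂ)) (by fun_prop)
    convert h2 using 1
    ext z
    simp only [Set.mem_sdiff, mem_singleton_iff, mem_image, mem_compl_iff]
    constructor
    · rintro ⟨hz, hzu⟩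
      refine ⟨e.symm ⟨z, hz⟩, fun h => hzu ?_, by simp⟩
      simpa using h
    · rintro ⟨y, hy, rfl⟩
      refine ⟨(e y).2, fun h => hy ?_⟩
      rw [Homeomorph.eq_symm_apply]
      exact Subtype.ext h
  · rw [sdiff_singleton_eq_self hu]
    exact Metric.isPreconnected_ball

@[simp] lemma affine_coe (z : ℂ) : affine (z : OnePoint ℂ) = z := rfl

@[simp] lemma affine_infty : affine OnePoint.infty = 0 := rfl

@[simp] lemma sphereInv_infty : sphereInv OnePoint.infty = ((0 : ℂ) : OnePoint ℂ) := rfl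

@[simp] lemma sphereInv_zero : sphereInv ((0 : ℂ) : OnePoint ℂ) = OnePoint.infty := by
  change (if (0 : ℂ) = 0 then OnePoint.infty else _) = _
  simp

lemma sphereInv_coe {z : ℂ} (hz : z ≠ 0) : sphereInv (z : OnePoint ℂ) = ((z⁻¹ : ℂ) : OnePoint ℂ) := by
  change (if z = 0 then OnePoint.infty else _) = _
  simp [hz]

lemma affine_sphereInv (Q : OnePoint ℂ) : affine (sphereInv Q) = (affine Q)⁻¹ := by
  induction Q using OnePoint.rec with
  | infty => simp
  | coe z =>
    by_cases hz : z = 0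
    · simp [hz]
    · simp [sphereInv_coe hz]

lemma sphereInv_sphereInv (Q : OnePoint ℂ) : sphereInv (sphereInv Q) = Q := by
  induction Q using OnePoint.rec with
  | infty => simp
  | coe z =>
    by_cases hz : z = 0
    · simp [hz]
    · rw [sphereInv_coe hz, sphereInv_coe (inv_ne_zero hz), inv_inv]

lemma continuous_sphereInv : Continuous sphereInv := by
  rw [continuous_iff_continuousAt]
  intro Q
  induction Q using OnePoint.rec with
  | infty =>
    rw [OnePoint.continuousAt_infty', sphereInv_infty]
    have h1 : Tendsto (fun z : ℂ => ((z⁻¹ : ℂ) : OnePoint ℂ)) (coclosedCompact ℂ)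
        (𝓝 ((0 : ℂ) : OnePoint ℂ)) := by
      rw [coclosedCompact_eq_cocompact, ← Metric.cobounded_eq_cocompact]
      exact (OnePoint.continuous_coe.tendsto 0).comp tendsto_inv₀_cobounded
    refine h1.congr' ?_
    rw [coclosedCompact_eq_cocompact, ← Metric.cobounded_eq_cocompact]
    filter_upwards [Bornology.eventually_ne_cobounded (0 : ℂ)] with z hz
    exact (sphereInv_coe hz).symm
  | coe z =>
    rw [OnePoint.continuousAt_coe]
    by_cases hz : z = 0
    · subst hz
      rw [continuousAt_iff_punctured_nhds]
      have h1 : Tendsto (fun z : ℂ => ((z⁻¹ : ℂ) : OnePoint ℂ)) (𝓝[≠] 0) (𝓝 OnePoint.infty) := by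
        have h2 := OnePoint.tendsto_coe_infty (X := ℂ)
        rw [coclosedCompact_eq_cocompact, ← Metric.cobounded_eq_cocompact] at h2
        exact h2.comp tendsto_inv₀_nhdsNE_zero
      simp only [Function.comp_apply, sphereInv_zero]
      refine h1.congr' ?_
      filter_upwards [self_mem_nhdsWithin] with y hy
      exact (sphereInv_coe hy).symm
    · have h1 : ContinuousAt (fun z : ℂ => ((z⁻¹ : ℂ) : OnePoint ℂ)) z :=
        OnePoint.continuous_coe.continuousAt.comp (continuousAt_inv₀ hz)
      refine h1.congr ?_
      filter_upwards [isOpen_ne.mem_nhds hz] with y hy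
      exact (sphereInv_coe hy).symm

/-- The inversion as a homeomorphism of the sphere. -/
def sphereInvHomeo : OnePoint ℂ ≃ₜ OnePoint ℂ where
  toFun := sphereInv
  invFun := sphereInv
  left_inv := sphereInv_sphereInv
  right_inv := sphereInv_sphereInv
  continuous_toFun := continuous_sphereInv
  continuous_invFun := continuous_sphereInv

/-- The complement of the image of the closed disc under a homeomorphism of the sphere is
connected. -/
lemma isPreconnected_compl_image {F : OnePoint ℂ ≃ₜ OnePoint ℂ} {h : ℂ → ℂ}
    (hF : ∀ w : ℂ, ‖w‖ ≤ 1 → F (w : OnePoint ℂ) = ((h w : ℂ) : OnePoint ℂ)) :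
    IsPreconnected (h '' Metric.closedBall 0 1)ᶜ := by
  set Q := F.symm OnePoint.infty with hQ
  have hdom : ∀ u ∈ Metric.ball (0 : ℂ) 1 \ {affine (sphereInv Q)},
      F (sphereInv (u : OnePoint ℂ)) ≠ OnePoint.infty := by
    rintro u ⟨-, hu⟩ h1
    refine hu ?_
    have : sphereInv (u : OnePoint ℂ) = Q := by rw [hQ, Homeomorph.eq_symm_apply]; exact h1
    rw [← this, sphereInv_sphereInv]
    rfl
  -- The affine complement is the image of the exterior, parametrised by u = 1/w in the disc, minus
  -- the one point sent to ∞.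
  have himage : (h '' Metric.closedBall 0 1)ᶜ = (fun u : ℂ => affine (F (sphereInv u))) ''
      (Metric.ball (0 : ℂ) 1 \ {affine (sphereInv Q)}) := by
    ext z
    simp only [mem_compl_iff, mem_image]
    constructor
    · intro hz
      have key : ∃ u : ℂ, ‖u‖ < 1 ∧ sphereInv u = F.symm (z : OnePoint ℂ) := by
        induction hy : F.symm (z : OnePoint ℂ) using OnePoint.rec with
        | infty => exact ⟨0, by simp, by simp⟩
        | coe y =>
          have hy1 : 1 < ‖y‖ := by
            by_contra hle
            refine hz ⟨y, mem_closedBall_zero_iff.2 (not_lt.1 hle), ?_⟩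
            have h2 := hF y (not_lt.1 hle)
            rw [← hy, Homeomorph.apply_symm_apply] at h2
            exact (OnePoint.coe_injective h2).symm
          have hy0 : y ≠ 0 := by rintro rfl; simp at hy1; linarith
          refine ⟨y⁻¹, by rw [norm_inv]; exact inv_lt_one_of_one_lt₀ hy1, ?_⟩
          rw [sphereInv_coe (inv_ne_zero hy0), inv_inv]
      obtain ⟨u, hu, hu2⟩ := key
      refine ⟨u, ⟨mem_ball_zero_iff.2 hu, fun h1 => ?_⟩, by
        rw [hu2, Homeomorph.apply_symm_apply]; rfl⟩
      -- F(0) is finite, so Q ≠ 0 and the default value of `affine` at ∞ plays no role for the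
      -- removed point.
      have hne : sphereInv Q ≠ OnePoint.infty := by
        intro h2
        have h3 := congrArg sphereInv h2
        rw [sphereInv_sphereInv, sphereInv_infty] at h3
        have h4 := hF 0 (by simp)
        rw [← h3, hQ, Homeomorph.apply_symm_apply] at h4
        exact OnePoint.infty_ne_coe _ h4
      obtain ⟨y, hy⟩ := OnePoint.ne_infty_iff_exists.1 hne
      rw [← hy, affine_coe, mem_singleton_iff] at h1
      rw [h1, hy, sphereInv_sphereInv, hQ] at hu2
      exact OnePoint.infty_ne_coe _ (F.symm.injective hu2)
    · rintro ⟨u, hu, rfl⟩ ⟨w, hw, hwz⟩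
      have hw' : ‖w‖ ≤ 1 := mem_closedBall_zero_iff.1 hw
      obtain ⟨y, hy⟩ := OnePoint.ne_infty_iff_exists.1 (hdom u hu)
      rw [← hy, affine_coe] at hwz
      have h1 := hF w hw'
      rw [hwz, hy] at h1
      have h2 := F.injective h1
      have hu1 : ‖u‖ < 1 := mem_ball_zero_iff.1 hu.1
      by_cases hu0 : u = 0
      · rw [hu0, sphereInv_zero] at h2
        exact OnePoint.infty_ne_coe _ h2.symm
      · rw [sphereInv_coe hu0] at h2
        have h3 := OnePoint.coe_injective h2
        rw [h3, norm_inv] at hw'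
        have : 1 < ‖u‖⁻¹ := (one_lt_inv₀ (norm_pos_iff.2 hu0)).2 hu1
        linarith
  rw [himage]
  refine (isPreconnected_ball_sdiff_singleton _).image _ fun u hu => ?_
  obtain ⟨y, hy⟩ := OnePoint.ne_infty_iff_exists.1 (hdom u hu)
  have h1 : ContinuousAt affine (F (sphereInv (u : OnePoint ℂ))) := by
    rw [← hy, OnePoint.continuousAt_coe]
    exact continuousAt_id
  have h2 : Continuous fun u : ℂ => F (sphereInv (u : OnePoint ℂ)) :=
    F.continuous.comp (continuous_sphereInv.comp OnePoint.continuous_coe)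
  exact (ContinuousAt.comp (f := fun u : ℂ => F (sphereInv (u : OnePoint ℂ))) h1
    h2.continuousAt).continuousWithinAt

/-- A sphere map that is `C¹` is so in affine coordinates at finite points with finite values. -/
lemma IsC1Sphere.contDiffAt_affine {F : OnePoint ℂ → OnePoint ℂ} (hF : IsC1Sphere F) {w z : ℂ}
    (h : F (w : OnePoint ℂ) = (z : OnePoint ℂ)) :
    ContDiffAt ℝ 1 (fun u : ℂ => affine (F (u : OnePoint ℂ))) w := by
  have := hF (w : OnePoint ℂ)
  rw [h] at this
  simpa [centre] using this

lemma IsC1Sphere.contDiffAt_infty {F : OnePoint ℂ → OnePoint ℂ} (hF : IsC1Sphere F)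
    (h : F OnePoint.infty = OnePoint.infty) :
    ContDiffAt ℝ 1 (fun u : ℂ => affine (sphereInv (F (sphereInv (u : OnePoint ℂ))))) 0 := by
  have := hF OnePoint.infty
  rw [h] at this
  simpa [centre] using this

lemma MemS0.discC1 {f : ℂ → ℂ} (hf : MemS0 f) : DiscC1 f := by
  obtain ⟨F, ⟨hF, hFs⟩, hFf⟩ := hf.ext
  have hdisc : Metric.ball (0 : ℂ) 1 = disc := by ext w; simp [disc]
  refine ⟨hdisc ▸ hf.holo, hf.map_zero, ⟨fun u => affine (F (u : OnePoint ℂ)), fun w hw =>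
    ⟨by simp [hFf w hw], hF.contDiffAt_affine (hFf w hw)⟩⟩,
    ⟨fun u => affine (F.symm (u : OnePoint ℂ)), fun w hw => ?_⟩, isPreconnected_compl_image hFf⟩
  have h1 : F.symm ((f w : ℂ) : OnePoint ℂ) = (w : OnePoint ℂ) := by
    rw [Homeomorph.symm_apply_eq, hFf w hw]
  exact ⟨by simp [h1], hFs.contDiffAt_affine h1⟩

/-- The map `ζ ↦ 1 / g(1/ζ)` of the disc attached to a map of the exterior. -/
def recip (g : ℂ → ℂ) (z : ℂ) : ℂ := if z = 0 then 0 else (g z⁻¹)⁻¹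

lemma recip_of_ne (g : ℂ → ℂ) {z : ℂ} (hz : z ≠ 0) : recip g z = (g z⁻¹)⁻¹ := if_neg hz

lemma MemSInf.hasDerivAt_recip {g : ℂ → ℂ} {b : ℂ} (hg : MemSInf g b) :
    HasDerivAt (recip g) b⁻¹ 0 := by
  rw [hasDerivAt_iff_tendsto_slope]
  have h1 := (hg.lead.comp (tendsto_inv₀_nhdsNE_zero (α := ℂ))).inv₀ hg.lead_ne
  refine h1.congr' ?_
  filter_upwards [self_mem_nhdsWithin] with z hz
  rw [slope_def_field, recip_of_ne g hz]
  simp [recip, div_eq_mul_inv, mul_comm]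

/-- Conjugating the extension G by the inversion turns the exterior problem into one on the disc
with fixed point 0. Away from 0 the affine chart of G suffices; at 0 its `C¹` property in the chart
at ∞ is used. -/
lemma MemSInf.discC1 {g : ℂ → ℂ} {b : ℂ} (hg : MemSInf g b) : DiscC1 (recip g) := by
  obtain ⟨G, ⟨hG, hGs⟩, hGi, hGg⟩ := hg.ext
  have hGsi : G.symm OnePoint.infty = OnePoint.infty := by
    rw [Homeomorph.symm_apply_eq, hGi]
  have hval : ∀ w : ℂ, ‖w‖ ≤ 1 →
      sphereInv (G (sphereInv (w : OnePoint ℂ))) = ((recip g w : ℂ) : OnePoint ℂ) := by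
    intro w hw
    by_cases hw0 : w = 0
    · simp [hw0, hGi, recip]
    · have hw1 : 1 ≤ ‖w⁻¹‖ := by
        rw [norm_inv]; exact (one_le_inv₀ (norm_pos_iff.2 hw0)).2 hw
      rw [sphereInv_coe hw0, hGg _ hw1, sphereInv_coe (hg.ne_zero _ hw1), recip_of_ne g hw0]
  have hinner : ∀ w : ℂ, w ≠ 0 → ‖w‖ ≤ 1 → 1 ≤ ‖w⁻¹‖ := fun w hw0 hw => by
    rw [norm_inv]; exact (one_le_inv₀ (norm_pos_iff.2 hw0)).2 hw
  have hchart : ∀ {F : OnePoint ℂ → OnePoint ℂ}, IsC1Sphere F → ∀ {w z : ℂ}, w ≠ 0 → z ≠ 0 →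
      F ((w⁻¹ : ℂ) : OnePoint ℂ) = ((z : ℂ) : OnePoint ℂ) →
      ContDiffAt ℝ 1 (fun u : ℂ => affine (sphereInv (F (sphereInv (u : OnePoint ℂ))))) w := by
    intro F hF w z hw0 hz0 hFw
    have h1 := hF.contDiffAt_affine hFw
    have hinv : ∀ y : ℂ, y ≠ 0 → ContDiffAt ℝ 1 (fun y : ℂ => y⁻¹) y := fun y hy =>
      (contDiffAt_inv ℂ hy).restrict_scalars ℝ
    have h2 : ContDiffAt ℝ 1 (fun u : ℂ => (affine (F ((u⁻¹ : ℂ) : OnePoint ℂ)))⁻¹) w := by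
      refine ContDiffAt.comp (g := fun y : ℂ => y⁻¹) w (hinv _ (by simpa [hFw] using hz0))
        (ContDiffAt.comp (g := fun u : ℂ => affine (F (u : OnePoint ℂ))) w h1 (hinv w hw0))
    refine h2.congr_of_eventuallyEq ?_
    filter_upwards [isOpen_ne.mem_nhds hw0] with u hu
    rw [affine_sphereInv, sphereInv_coe hu]
  have hdiff : DifferentiableOn ℂ (recip g) (Metric.ball 0 1) := by
    intro w hw
    by_cases hw0 : w = 0
    · rw [hw0]
      exact hg.hasDerivAt_recip.differentiableAt.differentiableWithinAt
    · have hw1 : 1 < ‖w⁻¹‖ := by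
        rw [norm_inv]; exact (one_lt_inv₀ (norm_pos_iff.2 hw0)).2 (mem_ball_zero_iff.1 hw)
      have ho : IsOpen exterior := isOpen_lt continuous_const continuous_norm
      have h1 : DifferentiableAt ℂ g w⁻¹ := hg.holo.differentiableAt (ho.mem_nhds hw1)
      have h2 : DifferentiableAt ℂ (fun w => (g w⁻¹)⁻¹) w :=
        (h1.comp w (differentiableAt_inv hw0)).inv (hg.ne_zero _ hw1.le)
      refine (h2.congr_of_eventuallyEq ?_).differentiableWithinAt
      filter_upwards [isOpen_ne.mem_nhds hw0] with u hu
      exact recip_of_ne g hu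
  refine ⟨hdiff, by simp [recip],
    ⟨fun u => affine (sphereInv (G (sphereInv (u : OnePoint ℂ)))), fun w hw => ⟨by simp [hval w hw], ?_⟩⟩,
    ⟨fun u => affine (sphereInv (G.symm (sphereInv (u : OnePoint ℂ)))), fun w hw => ⟨?_, ?_⟩⟩, ?_⟩
  · by_cases hw0 : w = 0
    · rw [hw0]; exact hG.contDiffAt_infty hGi
    · exact hchart hG hw0 (hg.ne_zero _ (hinner w hw0 hw)) (hGg _ (hinner w hw0 hw))
  · change affine (sphereInv (G.symm (sphereInv ((recip g w : ℂ) : OnePoint ℂ)))) = w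
    rw [← hval w hw, sphereInv_sphereInv, Homeomorph.symm_apply_apply, sphereInv_sphereInv,
      affine_coe]
  · by_cases hw0 : w = 0
    · rw [hw0, recip, if_pos rfl]; exact hGs.contDiffAt_infty hGsi
    · have hg0 := hg.ne_zero _ (hinner w hw0 hw)
      refine hchart hGs (z := w⁻¹) ?_ (inv_ne_zero hw0) ?_
      · rw [recip_of_ne g hw0]; exact inv_ne_zero hg0
      · rw [recip_of_ne g hw0, inv_inv, Homeomorph.symm_apply_eq, hGg _ (hinner w hw0 hw)]
  · exact isPreconnected_compl_image
      (F := (sphereInvHomeo.trans G).trans sphereInvHomeo) fun w hw => hval w hw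

/-! ### The disc functions attached to a point of 𝔇, and calculus on the circle. -/

/-- The quotient `ζ / h ζ`, with its limit at `0`. -/
def ratio (h : ℂ → ℂ) (z : ℂ) : ℂ := (dslope h 0 z)⁻¹

lemma ratio_of_ne {h : ℂ → ℂ} (h0 : h 0 = 0) {z : ℂ} (hz : z ≠ 0) : ratio h z = z / h z := by
  rw [ratio, dslope_of_ne _ hz, slope_def_field, h0, sub_zero, sub_zero, inv_div]

lemma div_ratio {h : ℂ → ℂ} (h0 : h 0 = 0) (z : ℂ) : z / ratio h z = h z := by
  by_cases hz : z = 0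
  · simp [hz, h0]
  · rw [ratio_of_ne h0 hz, div_div_cancel₀ hz]

lemma ratio_zero (h : ℂ → ℂ) : ratio h 0 = (deriv h 0)⁻¹ := by
  rw [ratio, dslope_same]

lemma DiscC1.exists_regularMap {h : ℂ → ℂ} (hh : DiscC1 h) : ∃ P, RegularMap (ratio h) P := by
  obtain ⟨⟨h₁, hd, hne, hder, hcirc⟩, -⟩ := hh.exists_deriv
  have h0 := hh.map_zero
  have hhne : ∀ w, ‖w‖ ≤ 1 → w ≠ 0 → h w ≠ 0 := fun w hw hw0 he =>
    hw0 (hh.injOn hw (by simp) (he.trans h0.symm))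
  have hsne : ∀ w, ‖w‖ ≤ 1 → dslope h 0 w ≠ 0 := by
    intro w hw
    by_cases hw0 : w = 0
    · rw [hw0, dslope_same, (hder 0 (by simp)).deriv]; exact hne 0 (by simp)
    · rw [dslope_of_ne _ hw0, slope_def_field, h0, sub_zero, sub_zero]
      exact div_ne_zero (hhne w hw hw0) hw0
  have hp : DiscAlg (ratio h) := by
    have := DiscAlg.div (u := fun _ => (1 : ℂ)) diffContOnCl_const hh.discAlg.dslope hsne
    simp only [one_div] at this
    exact this
  have hpne : ∀ w, ‖w‖ ≤ 1 → ratio h w ≠ 0 := fun w hw => inv_ne_zero (hsne w hw)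
  -- From h = w/p one gets h' = (p - w p')/p², so P = p² h', which extends to the closed disc with
  -- no zeros because h' does.
  refine ⟨fun w => ratio h w ^ 2 * h₁ w, hp, DiscAlg.mul (hp.pow 2) hd, hpne,
    fun w hw => mul_ne_zero (pow_ne_zero 2 (hpne w hw)) (hne w hw), fun w hw => ?_, ?_, fun θ => ?_⟩
  · have hpd : HasDerivAt (ratio h) (deriv (ratio h) w) w :=
      (hp.1.differentiableAt (Metric.isOpen_ball.mem_nhds (mem_ball_zero_iff.2 hw))).hasDerivAt
    have h2 := (hasDerivAt_id w).div hpd (hpne w hw.le)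
    have h3 : (id / ratio h : ℂ → ℂ) = h := funext fun z => div_ratio h0 z
    rw [h3] at h2
    rw [(hder w hw).unique h2]
    have := hpne w hw.le
    simp only [id_eq]
    field_simp
  · have : (fun w => w / ratio h w) = h := funext fun z => div_ratio h0 z
    rwa [this]
  · have hw0 : circleMap 0 1 θ ≠ 0 := circleMap_ne_center one_ne_zero
    have hn : h (circleMap 0 1 θ) ≠ 0 := hhne _ (by simp) hw0
    have h2 := (hasDerivAt_circleMap 0 1 θ).div (hcirc θ) hn
    have h3 : (fun x : ℝ => ratio h (circleMap 0 1 x)) =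
        (circleMap 0 1 / fun x : ℝ => h (circleMap 0 1 x)) :=
      funext fun x => ratio_of_ne h0 (circleMap_ne_center one_ne_zero)
    rw [h3, ratio_of_ne h0 hw0]
    refine h2.congr_deriv ?_
    field_simp

/-- A family that is `C¹` on the circle, with its derivative `u'` in the parameter at `0` and its
angular derivative `-i ∂/∂θ = uD` at parameter `0`. -/
structure CircleData (ε : ℝ) (u : ℝ → ℂ → ℂ) (u' uD : ℂ → ℂ) : Prop where
  c1 : CircleC1 ε u
  ds : ∀ w, ‖w‖ = 1 → HasDerivAt (fun s => u s w) (u' w) 0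
  dθ : ∀ θ : ℝ, HasDerivAt (fun x : ℝ => u 0 (circleMap 0 1 x)) (I * uD (circleMap 0 1 θ)) θ

section

variable {ε : ℝ} {u v : ℝ → ℂ → ℂ} {u' v' uD vD : ℂ → ℂ}

lemma CircleData.mul (hu : CircleData ε u u' uD) (hv : CircleData ε v v' vD) :
    CircleData ε (fun s w => u s w * v s w) (fun w => u' w * v 0 w + u 0 w * v' w)
      (fun w => uD w * v 0 w + u 0 w * vD w) :=
  ⟨ContDiffOn.mul hu.c1 hv.c1, fun w hw => (hu.ds w hw).mul (hv.ds w hw), fun θ =>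
    ((hu.dθ θ).mul (hv.dθ θ)).congr_deriv (by ring)⟩

lemma CircleData.pow (hu : CircleData ε u u' uD) (n : ℕ) :
    CircleData ε (fun s w => u s w ^ n) (fun w => n * u 0 w ^ (n - 1) * u' w)
      (fun w => n * u 0 w ^ (n - 1) * uD w) :=
  ⟨ContDiffOn.pow hu.c1 n, fun w hw => (hu.ds w hw).pow n, fun θ =>
    ((hu.dθ θ).pow n).congr_deriv (by ring)⟩

lemma CircleData.inv (hε : 0 < ε) (hu : CircleData ε u u' uD)
    (hne : ∀ s ∈ Ioo (-ε) ε, ∀ w, ‖w‖ = 1 → u s w ≠ 0) :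
    CircleData ε (fun s w => (u s w)⁻¹) (fun w => -u' w / u 0 w ^ 2) (fun w => -uD w / u 0 w ^ 2) := by
  have h0 : (0 : ℝ) ∈ Ioo (-ε) ε := ⟨by linarith, hε⟩
  refine ⟨ContDiffOn.inv hu.c1 fun q hq => hne _ hq.1 _ (by simp),
    fun w hw => (hu.ds w hw).inv (hne 0 h0 w hw), fun θ => ?_⟩
  exact ((hu.dθ θ).inv (hne 0 h0 _ (by simp))).congr_deriv (by ring)

lemma circleData_const {φ φD : ℂ → ℂ} (hφ : ContDiff ℝ 1 fun θ : ℝ => φ (circleMap 0 1 θ))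
    (hD : ∀ θ : ℝ, HasDerivAt (fun x : ℝ => φ (circleMap 0 1 x)) (I * φD (circleMap 0 1 θ)) θ) :
    CircleData ε (fun _ => φ) (fun _ => 0) φD :=
  ⟨(hφ.comp contDiff_snd).contDiffOn, fun _ _ => hasDerivAt_const _ _, hD⟩

lemma circleData_id : CircleData ε (fun _ w => w) (fun _ => 0) (fun w => w) :=
  circleData_const (contDiff_circleMap 0 1) fun θ =>
    (hasDerivAt_circleMap 0 1 θ).congr_deriv (by ring)

lemma CircleData.comp_inv (hu : CircleData ε u u' uD) :
    CircleData ε (fun s w => u s w⁻¹) (fun w => u' w⁻¹) (fun w => -uD w⁻¹) := by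
  have hinv : ∀ θ : ℝ, (circleMap 0 1 θ)⁻¹ = circleMap 0 1 (-θ) := fun θ => by
    simp [circleMap_zero_inv]
  refine ⟨?_, fun w hw => hu.ds _ (by rw [norm_inv, hw, inv_one]), fun θ => ?_⟩
  · have h1 : ContDiffOn ℝ 1 (fun q : ℝ × ℝ => (q.1, -q.2)) (Ioo (-ε) ε ×ˢ univ) := by fun_prop
    have h2 := ContDiffOn.comp hu.c1 h1 fun q hq => ⟨hq.1, mem_univ _⟩
    refine h2.congr fun q _ => ?_
    simp [hinv]
  · have h1 := HasDerivAt.scomp θ (hu.dθ (-θ)) (hasDerivAt_neg θ)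
    simp only [hinv]
    exact h1.congr_deriv (by rw [neg_one_smul]; ring)

lemma contour_congr {A A' B B' : ℂ → ℂ} (hA : ∀ w, ‖w‖ = 1 → A w = A' w)
    (hB : ∀ w, ‖w‖ = 1 → B w = B' w) : contour A B = contour A' B' := by
  have h1 : ∀ θ : ℝ, A (circleMap 0 1 θ) = A' (circleMap 0 1 θ) := fun θ => hA _ (by simp)
  have h2 : (fun θ : ℝ => B (circleMap 0 1 θ)) = fun θ => B' (circleMap 0 1 θ) :=
    funext fun θ => hB _ (by simp)
  rw [contour, contour, h2]
  simp only [h1]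

lemma CircleData.contour (hε : 0 < ε) (hu : CircleData ε u u' uD) (hv : CircleData ε v v' vD) :
    HasDerivAt (fun s => contour (u s) (v s)) (circleMean fun w => u' w * vD w - uD w * v' w) 0 :=
  hu.c1.hasDerivAt_contour hv.c1 hε hu.ds hv.ds hu.dθ hv.dθ

end

/-- The disc function `p` attached to a point of `𝔇`: `f(w) = w / p(w)`. -/
abbrev MapPair.inn (q : MapPair) : ℂ → ℂ := ratio q.f

/-- The disc function `k` attached to a point of `𝔇`: `g(w) = w k(1/w)`. -/
abbrev MapPair.out (q : MapPair) : ℂ → ℂ := ratio (recip q.g)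

lemma MapPair.g_eq (q : MapPair) {w : ℂ} (hw : w ≠ 0) : q.g w = w * q.out w⁻¹ := by
  rw [MapPair.out, ratio_of_ne (by simp [recip]) (inv_ne_zero hw), recip_of_ne _ (inv_ne_zero hw),
    inv_inv, div_inv_eq_mul, ← mul_assoc, mul_inv_cancel₀ hw, one_mul]

lemma MapPair.f_eq {q : MapPair} (hq : q ∈ spaceD) (w : ℂ) : q.f w = w / q.inn w :=
  (div_ratio hq.1.map_zero w).symm

/-- A point of `𝔇` with the boundary data of its two maps. -/
structure MapPair.Regular (q : MapPair) (P K : ℂ → ℂ) : Prop where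
  inn : RegularMap q.inn P
  out : RegularMap q.out K
  eq_zero : q.inn 0 = q.out 0

/-- The reciprocal map has derivative 1/b at 0, so the normalisation f'(0) b = 1 says exactly that
the two disc functions agree at 0. -/
lemma exists_regular {q : MapPair} (hq : q ∈ spaceD) : ∃ P K, q.Regular P K := by
  obtain ⟨hf, b, hg, hfg⟩ := hq
  obtain ⟨P, hP⟩ := hf.discC1.exists_regularMap
  obtain ⟨K, hK⟩ := hg.discC1.exists_regularMap
  refine ⟨P, K, hP, hK, ?_⟩
  change ratio q.f 0 = ratio (recip q.g) 0
  rw [ratio_zero, ratio_zero, hg.hasDerivAt_recip.deriv, inv_inv]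
  exact (eq_inv_of_mul_eq_one_right hfg).symm

/-! ### Variations along curves and the variation of the times. -/

/-- The first variation of the pair of maps along a curve in `𝔇`. -/
structure IsVariation (γ : ℝ → MapPair) (a c : ℂ → ℂ) : Prop where
  inn : DiscAlg a
  out : DiscAlg c
  eq_zero : a 0 = c 0
  hasDerivAt_inn : ∀ w, ‖w‖ ≤ 1 → HasDerivAt (fun s => (γ s).inn w) (a w) 0
  hasDerivAt_out : ∀ w, ‖w‖ ≤ 1 → HasDerivAt (fun s => (γ s).out w) (c w) 0

lemma IsCurveAt.exists_circleC1 {p : MapPair} {γ : ℝ → MapPair} (hγ : IsCurveAt p γ) :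
    ∃ ε : ℝ, 0 < ε ∧ (∀ s ∈ Ioo (-ε) ε, γ s ∈ spaceD) ∧ CircleC1 ε (fun s => (γ s).inn) ∧
      CircleC1 ε (fun s => (γ s).out) := by
  obtain ⟨ε, hε, hmem, hf, hg⟩ := hγ.smooth
  have hg' : CircleC1 ε fun s => (γ s).g := hg
  refine ⟨ε, hε, hmem, ?_, ?_⟩
  · have h1 : ContDiffOn ℝ 1 (fun q : ℝ × ℝ => circleMap 0 1 q.2) (Ioo (-ε) ε ×ˢ univ) :=
      ((contDiff_circleMap 0 1).comp contDiff_snd).contDiffOn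
    have h2 := h1.mul (ContDiffOn.inv hf fun q hq => by
      have := (hmem _ hq.1).1.discC1
      intro h0
      have h3 := this.injOn (by simp) (by simp : ‖(0 : ℂ)‖ ≤ 1) (h0.trans this.map_zero.symm)
      exact circleMap_ne_center one_ne_zero h3)
    refine ContDiffOn.congr h2 fun q hq => ?_
    exact (ratio_of_ne (hmem _ hq.1).1.map_zero (circleMap_ne_center one_ne_zero)).trans
      (div_eq_mul_inv _ _)
  · have h1 : ContDiffOn ℝ 1 (fun q : ℝ × ℝ => (q.1, -q.2)) (Ioo (-ε) ε ×ˢ univ) := by fun_prop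
    have h2 := ContDiffOn.comp hg' h1 fun q hq => ⟨hq.1, mem_univ _⟩
    have h3 : ContDiffOn ℝ 1 (fun q : ℝ × ℝ => circleMap 0 1 q.2) (Ioo (-ε) ε ×ˢ univ) :=
      ((contDiff_circleMap 0 1).comp contDiff_snd).contDiffOn
    refine ContDiffOn.congr (h3.mul h2) fun q hq => ?_
    have hne : circleMap 0 1 q.2 ≠ 0 := circleMap_ne_center one_ne_zero
    have h4 : (circleMap 0 1 q.2)⁻¹ = circleMap 0 1 (-q.2) := by simp [circleMap_zero_inv]
    simp only [Function.comp_apply]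
    rw [← h4, MapPair.g_eq _ (inv_ne_zero hne), inv_inv, ← mul_assoc, mul_inv_cancel₀ hne, one_mul]

lemma IsCurveAt.exists_variation {p : MapPair} {γ : ℝ → MapPair} (hγ : IsCurveAt p γ) :
    ∃ a c, IsVariation γ a c := by
  obtain ⟨ε, hε, hmem, hi, ho⟩ := hγ.exists_circleC1
  obtain ⟨a, ha, had⟩ := hi.exists_discAlg_variation hε fun s hs => by
    obtain ⟨P, K, h⟩ := exists_regular (hmem s hs)
    exact h.inn.disc
  obtain ⟨c, hc, hcd⟩ := ho.exists_discAlg_variation hε fun s hs => by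
    obtain ⟨P, K, h⟩ := exists_regular (hmem s hs)
    exact h.out.disc
  refine ⟨a, c, ha, hc, ?_, had, hcd⟩
  refine (had 0 (by simp)).unique ((hcd 0 (by simp)).congr_of_eventuallyEq ?_)
  filter_upwards [isOpen_Ioo.mem_nhds (show (0 : ℝ) ∈ Ioo (-ε) ε from ⟨by linarith, hε⟩)] with s hs
  obtain ⟨P, K, h⟩ := exists_regular (hmem s hs)
  exact h.eq_zero

/-- The first variation of the times. -/
lemma IsVariation.hasDerivAt_time {p : MapPair} {γ : ℝ → MapPair} (hγ : IsCurveAt p γ)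
    {P K a c : ℂ → ℂ} (hp : p.Regular P K) (hv : IsVariation γ a c) (m : ℕ) :
    HasDerivAt (fun s => contour (fun w => (γ s).g w ^ (-(m : ℤ)) / (γ s).f w) (γ s).g)
      (circleMean fun w => (w⁻¹ / p.out w⁻¹) ^ m * crossForm P K a c w) 0 ∧
    HasDerivAt (fun s => contour (fun w => (γ s).g w * (γ s).f w ^ ((m : ℤ) - 2)) (γ s).f)
      (circleMean fun w => (w / p.inn w) ^ m * crossForm P K a c w) 0 := by
  obtain ⟨ε, hε, hmem, hi, ho⟩ := hγ.exists_circleC1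
  have hγ0 := hγ.base
  have hreg : ∀ s ∈ Ioo (-ε) ε, ∃ P K, (γ s).Regular P K := fun s hs => exists_regular (hmem s hs)
  have hine : ∀ s ∈ Ioo (-ε) ε, ∀ w : ℂ, ‖w‖ = 1 → (γ s).inn w ≠ 0 := fun s hs w hw => by
    obtain ⟨P, K, h⟩ := hreg s hs
    exact h.inn.ne w hw.le
  have hone : ∀ s ∈ Ioo (-ε) ε, ∀ w : ℂ, ‖w‖ = 1 → (γ s).out w⁻¹ ≠ 0 := fun s hs w hw => by
    obtain ⟨P, K, h⟩ := hreg s hs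
    exact h.out.ne _ (by rw [norm_inv, hw, inv_one])
  have hn0 : ∀ w : ℂ, ‖w‖ = 1 → w ≠ 0 := by rintro w hw rfl; simp at hw
  have hI : CircleData ε (fun s => (γ s).inn) a (fun w => p.inn w - P w) :=
    ⟨hi, fun w hw => hv.hasDerivAt_inn w hw.le, fun θ => by rw [hγ0]; exact hp.inn.circle θ⟩
  have hO : CircleData ε (fun s => (γ s).out) c (fun w => p.out w - K w) :=
    ⟨ho, fun w hw => hv.hasDerivAt_out w hw.le, fun θ => by rw [hγ0]; exact hp.out.circle θ⟩
  have hG := circleData_id.mul hO.comp_inv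
  have hF := circleData_id.mul (hI.inv hε hine)
  have hGne : ∀ s ∈ Ioo (-ε) ε, ∀ w : ℂ, ‖w‖ = 1 → w * (γ s).out w⁻¹ ≠ 0 := fun s hs w hw =>
    mul_ne_zero (hn0 w hw) (hone s hs w hw)
  have hFne : ∀ s ∈ Ioo (-ε) ε, ∀ w : ℂ, ‖w‖ = 1 → w * ((γ s).inn w)⁻¹ ≠ 0 := fun s hs w hw =>
    mul_ne_zero (hn0 w hw) (inv_ne_zero (hine s hs w hw))
  have hev : ∀ᶠ s in 𝓝 (0 : ℝ), s ∈ Ioo (-ε) ε :=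
    isOpen_Ioo.mem_nhds ⟨by linarith, hε⟩
  have h0 : (0 : ℝ) ∈ Ioo (-ε) ε := ⟨by linarith, hε⟩
  have hgeq : ∀ s, ∀ w : ℂ, ‖w‖ = 1 → (γ s).g w = w * (γ s).out w⁻¹ := fun s w hw =>
    (γ s).g_eq (hn0 w hw)
  have hfeq : ∀ s ∈ Ioo (-ε) ε, ∀ w : ℂ, (γ s).f w = w * ((γ s).inn w)⁻¹ := fun s hs w => by
    rw [MapPair.f_eq (hmem s hs), div_eq_mul_inv]
  constructor
  -- With A = g⁻ᵐ F, F = 1/f and B = g, the terms from varying g⁻ᵐ cancel in δA dB - dA δB, leaving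
  -- g⁻ᵐ (δF dg - dF δg).
  · have h1 := (((hG.inv hε hGne).pow m).mul (hF.inv hε hFne)).contour hε hG
    have h2 := h1.congr_of_eventuallyEq (f₁ := fun s =>
      contour (fun w => (γ s).g w ^ (-(m : ℤ)) / (γ s).f w) (γ s).g) (by
        filter_upwards [hev] with s hs
        refine contour_congr (fun w hw => ?_) (hgeq s)
        rw [hgeq s w hw, hfeq s hs w, zpow_neg, zpow_natCast, inv_pow, div_eq_mul_inv])
    refine h2.congr_deriv (circleMean_congr fun w hw => ?_)
    have e1 := hn0 w hw
    have e2 := hine 0 h0 w hw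
    have e3 := hone 0 h0 w hw
    simp only [hγ0, crossForm] at e2 e3 ⊢
    have e4 : w⁻¹ / p.out w⁻¹ = (w * p.out w⁻¹)⁻¹ := by rw [mul_inv, div_eq_mul_inv]
    rw [e4]
    rcases m with _ | m
    · simp only [Nat.cast_zero, zero_mul, pow_zero, zero_add, one_mul]
      field_simp
      ring
    · simp only [Nat.add_sub_cancel, pow_succ]
      generalize (w * p.out w⁻¹)⁻¹ ^ m = X
      generalize p.out w⁻¹ = κ at e3 ⊢
      field_simp
      ring
  -- The factor f^{m-2} is written as fᵐ (1/f)², with natural exponents even for m < 2; what remains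
  -- is fᵐ (δg df - dg δf)/f², the same cross form.
  · have h1 := (hG.mul ((hF.pow m).mul ((hF.inv hε hFne).pow 2))).contour hε hF
    have h2 := h1.congr_of_eventuallyEq (f₁ := fun s =>
      contour (fun w => (γ s).g w * (γ s).f w ^ ((m : ℤ) - 2)) (γ s).f) (by
        filter_upwards [hev] with s hs
        refine contour_congr (fun w hw => ?_) (fun w _ => hfeq s hs w)
        have hne := hFne s hs w hw
        rw [hgeq s w hw, hfeq s hs w, zpow_sub₀ hne, zpow_natCast, inv_pow, div_eq_mul_inv]
        rfl)
    refine h2.congr_deriv (circleMean_congr fun w hw => ?_)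
    have e1 := hn0 w hw
    have e2 := hine 0 h0 w hw
    have e3 := hone 0 h0 w hw
    simp only [hγ0, crossForm] at e2 e3 ⊢
    rw [div_eq_mul_inv w]
    rcases m with _ | m
    · simp only [Nat.cast_zero, zero_mul, pow_zero, zero_add, one_mul]
      field_simp
      ring
    · simp only [Nat.add_sub_cancel, pow_succ]
      generalize (w * (p.inn w)⁻¹) ^ m = X
      field_simp
      ring

/-! ### Coordinate directions and their densities on the circle. -/

section

variable {p : MapPair} {γ : ℝ → MapPair} {P K a c : ℂ → ℂ} {n : ℤ} {v : ℂ}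

/-- The case distinction at m = 0 reflects that t_0 carries no factor 1/n. -/
lemma IsCoordCurve.circleMean_out (hγ : IsCoordCurve p n v γ) (hp : p.Regular P K)
    (hv : IsVariation γ a c) (m : ℕ) :
    circleMean (fun w => (w⁻¹ / p.out w⁻¹) ^ m * crossForm P K a c w) =
      (if m = 0 then 1 else (m : ℂ)) * if (m : ℤ) = n then v else 0 := by
  have h1 := (hv.hasDerivAt_time hγ.curve hp m).1
  have h2 := hγ.velocity m
  rcases Nat.eq_zero_or_pos m with rfl | hm
  · rw [if_pos rfl, one_mul]
    refine h1.unique ?_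
    simpa [time] using h2
  · rw [if_neg hm.ne']
    have hm' : (m : ℂ) ≠ 0 := by exact_mod_cast hm.ne'
    refine h1.unique ((h2.const_mul (m : ℂ)).congr_of_eventuallyEq (.of_forall fun s => ?_))
    simp only [time, Int.natCast_pos.2 hm, if_true, Int.cast_natCast]
    rw [mul_inv_cancel_left₀ hm']

lemma IsCoordCurve.circleMean_inn (hγ : IsCoordCurve p n v γ) (hp : p.Regular P K)
    (hv : IsVariation γ a c) (m : ℕ) :
    circleMean (fun w => (w / p.inn w) ^ m * crossForm P K a c w) =
      (if m = 0 then 1 else -(m : ℂ)) * if -(m : ℤ) = n then v else 0 := by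
  have h1 := (hv.hasDerivAt_time hγ.curve hp m).2
  have h2 := hγ.velocity (-m)
  rcases Nat.eq_zero_or_pos m with rfl | hm
  · simpa using hγ.circleMean_out hp hv 0
  · rw [if_neg hm.ne']
    have hm' : -(m : ℂ) ≠ 0 := neg_ne_zero.2 (by exact_mod_cast hm.ne')
    refine h1.unique ((h2.const_mul (-(m : ℂ))).congr_of_eventuallyEq (.of_forall fun s => ?_))
    have h3 : ¬ (0 : ℤ) < -(m : ℤ) := by omega
    have h4 : ¬ -(m : ℤ) = 0 := by omega
    simp only [time, if_neg h3, if_neg h4, Int.cast_neg, Int.cast_natCast, neg_neg]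
    rw [mul_inv_cancel_left₀ hm']

/-- `T` is the density on the circle whose moments are those of the cross form of the variation in
the direction `∂/∂t_n`. -/
structure IsTimeDensity (p : MapPair) (n : ℤ) (T : ℂ → ℂ) : Prop where
  cont : ContinuousOn T (Metric.sphere 0 1)
  out : ∀ m : ℕ, circleMean (fun w => (w⁻¹ / p.out w⁻¹) ^ m * T w) =
    (if m = 0 then 1 else (m : ℂ)) * if (m : ℤ) = n then 1 else 0
  inn : ∀ m : ℕ, circleMean (fun w => (w / p.inn w) ^ m * T w) =
    (if m = 0 then 1 else -(m : ℂ)) * if -(m : ℤ) = n then 1 else 0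

lemma MapPair.Regular.discAlg_inn_pow (hp : p.Regular P K) (m : ℕ) :
    DiscAlg fun w => (w / p.inn w) ^ m := hp.inn.c1.discAlg.pow m

lemma MapPair.Regular.discAlg_out_pow (hp : p.Regular P K) (m : ℕ) :
    DiscAlg fun w => (w / p.out w) ^ m := hp.out.c1.discAlg.pow m

/-- The difference of the two sides has zero moments against all powers of f and of 1/g, hence
vanishes. -/
lemma IsCoordCurve.crossForm_eq (hγ : IsCoordCurve p n v γ) (hp : p.Regular P K)
    (hv : IsVariation γ a c) {T : ℂ → ℂ} (hT : IsTimeDensity p n T) {w : ℂ} (hw : ‖w‖ = 1) :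
    crossForm P K a c w = v * T w := by
  have hΛ := continuousOn_crossForm hp.inn.disc' hp.out.disc' hv.inn hv.out
  have hvT : ContinuousOn (fun w => v * T w) (Metric.sphere 0 1) := continuousOn_const.mul hT.cont
  have key : ∀ h : ℂ → ℂ, ContinuousOn h (Metric.sphere 0 1) →
      circleMean (fun w => h w * crossForm P K a c w) = v * circleMean (fun w => h w * T w) →
      circleMean (fun w => h w * (crossForm P K a c w - v * T w)) = 0 := by
    intro h hh he
    have h1 : ContinuousOn (fun w => h w * crossForm P K a c w) (Metric.sphere 0 1) := hh.mul hΛ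
    have h2 : ContinuousOn (fun w => v * (h w * T w)) (Metric.sphere 0 1) :=
      continuousOn_const.mul (hh.mul hT.cont)
    rw [← circleMean_const_mul, ← sub_eq_zero, ← circleMean_sub h1 h2] at he
    rw [← he]
    exact circleMean_congr fun w _ => by ring
  refine sub_eq_zero.1 (hp.inn.eq_zero_of_moments hp.out
    (φ := fun w => crossForm P K a c w - v * T w) (hΛ.sub hvT) (fun m => ?_) (fun m => ?_) hw)
  · refine key _ (hp.discAlg_inn_pow m).continuousOn_sphere ?_
    rw [hγ.circleMean_inn hp hv, hT.inn]
    split_ifs <;> ring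
  · refine key _ (ContinuousOn.comp_inv_sphere (hp.discAlg_out_pow m).continuousOn_sphere) ?_
    rw [hγ.circleMean_out hp hv, hT.out]
    split_ifs <;> ring

lemma isTimeDensity_zero (hp : p.Regular P K) : IsTimeDensity p 0 fun _ => 1 := by
  refine ⟨continuousOn_const, fun m => ?_, fun m => ?_⟩
  · simp only [mul_one]
    rw [circleMean_discAlg_inv (hp.discAlg_out_pow m)]
    rcases m with _ | m
    · simp
    · simp; omega
  · simp only [mul_one]
    rw [circleMean_discAlg (hp.discAlg_inn_pow m)]
    rcases m with _ | m
    · simp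
    · simp; omega

/-- Moments against g⁻ᵐ are those of `RegularMap.circleMean_polyEuler` after w ↦ 1/w; moments
against fᵐ vanish since the density is a polynomial without constant term. -/
lemma isTimeDensity_pos (hp : p.Regular P K) {N : ℕ} (hN : 1 ≤ N) :
    IsTimeDensity p N (polyEuler (taylorCoeff fun z => p.out z ^ N) N) := by
  have hE := differentiable_polyEuler (taylorCoeff fun z => p.out z ^ N) N
  refine ⟨hE.continuous.continuousOn, fun m => ?_, fun m => ?_⟩
  · rw [← circleMean_inv]
    simp only [inv_inv]
    rw [hp.out.circleMean_polyEuler]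
    by_cases h : m = N
    · subst h
      simp [show m ≠ 0 by omega]
    · simp [h]
  · rw [circleMean_discAlg ((hp.discAlg_inn_pow m).mul (Differentiable.discAlg hE)), polyEuler_zero, mul_zero,
      if_neg (by omega : ¬ -(m : ℤ) = N), mul_zero]

/-- The minus sign is that of w d/dw acting on a polynomial in 1/w; it matches the sign in the
definition of t_{-n}. -/
lemma isTimeDensity_neg (hp : p.Regular P K) {N : ℕ} (hN : 1 ≤ N) :
    IsTimeDensity p (-N) fun w => -polyEuler (taylorCoeff fun z => p.inn z ^ N) N w⁻¹ := by
  have hE := differentiable_polyEuler (taylorCoeff fun z => p.inn z ^ N) N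
  refine ⟨(ContinuousOn.comp_inv_sphere hE.continuous.continuousOn).neg, fun m => ?_, fun m => ?_⟩
  · have h := circleMean_discAlg_inv (((hp.discAlg_out_pow m).mul (Differentiable.discAlg hE)).neg)
    simp only [Pi.neg_apply, polyEuler_zero, mul_zero, neg_zero] at h
    simp only [mul_neg]
    rw [h, if_neg (by omega : ¬ (m : ℤ) = -N), mul_zero]
  · have h := circleMean_const_mul (-1) fun w => (w / p.inn w) ^ m *
      polyEuler (taylorCoeff fun z => p.inn z ^ N) N w⁻¹
    rw [hp.inn.circleMean_polyEuler] at h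
    simp only [mul_neg]
    simp only [neg_one_mul] at h
    rw [h]
    by_cases h : m = N
    · subst h
      simp [show m ≠ 0 by omega]
    · simp [h]

lemma polyPart_const_mul (x : ℂ) (b : ℕ → ℂ) (N : ℕ) (w : ℂ) :
    polyPart (fun j => x * b j) N w = x * polyPart b N w := by
  simp only [polyPart, mul_add, Finset.mul_sum, mul_assoc, mul_div_assoc]

/-- The variations along the two curves of a coordinate frame. -/
lemma CoordFrame.exists_variation (e : CoordFrame p n) (hp : p.Regular P K) {T : ℂ → ℂ}
    (hT : IsTimeDensity p n T) : ∃ a c, IsVariation e.x a c ∧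
      IsVariation e.y (fun w => I * a w) (fun w => I * c w) ∧
      ∀ w, ‖w‖ = 1 → crossForm P K a c w = T w := by
  obtain ⟨a, c, hx⟩ := e.hx.curve.exists_variation
  obtain ⟨a', c', hy⟩ := e.hy.curve.exists_variation
  have ex := fun w (hw : ‖w‖ = 1) => e.hx.crossForm_eq hp hx hT hw
  have ey := fun w (hw : ‖w‖ = 1) => e.hy.crossForm_eq hp hy hT hw
  have hIa : DiscAlg fun w => I * a w := DiscAlg.mul (diffContOnCl_const (c := I)) hx.inn
  have hIc : DiscAlg fun w => I * c w := DiscAlg.mul (diffContOnCl_const (c := I)) hx.out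
  have hI0 : I * a 0 = I * c 0 := by rw [hx.eq_zero]
  -- The curves `e.x` and `e.y` are chosen independently, but their cross forms are T and iT, so the
  -- second variation must be i times the first.
  have huniq := hp.inn.crossForm_injective hp.out hp.eq_zero hy.inn hy.out hIa hIc hy.eq_zero hI0
    fun w hw => by
      rw [ey w hw, ← one_mul (T w), ← ex w hw]
      simp only [crossForm]
      ring
  refine ⟨a, c, hx, ⟨hIa, hIc, hI0, fun w hw => ?_, fun w hw => ?_⟩, fun w hw => ?_⟩
  · rw [← (huniq w hw).1]
    exact hy.hasDerivAt_inn w hw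
  · rw [← (huniq w hw).2]
    exact hy.hasDerivAt_out w hw
  · rw [ex w hw, one_mul]

/-- For derivatives A and iA in the two directions, (Ā + i · conj(iA))/2 = Ā: a complex-linear
derivative becomes, after conjugation, a pure ∂/∂t̄ derivative. -/
lemma hasTBarDeriv_conj {e : CoordFrame p n} {Φ : MapPair → ℂ} {A : ℂ}
    (hx : HasDerivAt (fun s => Φ (e.x s)) A 0) (hy : HasDerivAt (fun s => Φ (e.y s)) (I * A) 0) :
    HasTBarDeriv e (fun q => (starRingEnd ℂ) (Φ q)) ((starRingEnd ℂ) A) := by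
  refine ⟨_, _, hx.star, hy.star, ?_⟩
  simp only [star_def, map_mul, conj_I]
  linear_combination ((starRingEnd ℂ) A / 2) * I_mul_I

lemma IsVariation.hasDerivAt_g (hv : IsVariation γ a c) {w : ℂ} (hw : 1 ≤ ‖w‖) :
    HasDerivAt (fun s => (γ s).g w) (w * c w⁻¹) 0 := by
  have hw0 : w ≠ 0 := norm_pos_iff.1 (by linarith)
  simp only [fun s => (γ s).g_eq hw0]
  exact (hv.hasDerivAt_out w⁻¹ (by rw [norm_inv]; exact inv_le_one_of_one_le₀ hw)).const_mul w

lemma IsVariation.hasDerivAt_f (hv : IsVariation γ a c) (hγ : IsCurveAt p γ) (hp : p.Regular P K)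
    {w : ℂ} (hw : ‖w‖ ≤ 1) : HasDerivAt (fun s => (γ s).f w) (-(w * a w) / p.inn w ^ 2) 0 := by
  obtain ⟨ε, hε, hmem, -⟩ := hγ.smooth
  have h0 := hγ.base
  have h1 := (hv.hasDerivAt_inn w hw).inv (by rw [h0]; exact hp.inn.ne w hw)
  rw [h0] at h1
  have h2 := (h1.const_mul w).congr_of_eventuallyEq (f₁ := fun s => (γ s).f w) (by
    filter_upwards [isOpen_Ioo.mem_nhds (show (0 : ℝ) ∈ Ioo (-ε) ε from ⟨by linarith, hε⟩)]
      with s hs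
    rw [MapPair.f_eq (hmem s hs), div_eq_mul_inv]
    rfl)
  exact h2.congr_deriv (by ring)

lemma CircleC1.hasDerivAt_polyPart {ε : ℝ} {u : ℝ → ℂ → ℂ} {u' : ℂ → ℂ} (hu : CircleC1 ε u)
    (hε : 0 < ε) (hu' : ∀ w, ‖w‖ = 1 → HasDerivAt (fun s => u s w) (u' w) 0) (N : ℕ) (w : ℂ) :
    HasDerivAt (fun s => polyPart (taylorCoeff fun z => u s z ^ N) N w)
      (polyPart (taylorCoeff fun z => N * u 0 z ^ (N - 1) * u' z) N w) 0 := by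
  have key : ∀ j, HasDerivAt (fun s => taylorCoeff (fun z => u s z ^ N) j)
      (taylorCoeff (fun z => N * u 0 z ^ (N - 1) * u' z) j) 0 := by
    intro j
    have hc : CircleC1 ε fun s w => w⁻¹ ^ j * u s w ^ N := by
      have h1 : ContDiff ℝ 1 fun q : ℝ × ℝ => (circleMap 0 1 q.2)⁻¹ ^ j :=
        (((contDiff_circleMap 0 1).comp contDiff_snd).inv
          fun q => circleMap_ne_center one_ne_zero).pow j
      exact h1.contDiffOn.mul (ContDiffOn.pow hu N)
    exact hc.hasDerivAt_circleMean hε fun w hw => ((hu' w hw).pow N).const_mul (w⁻¹ ^ j)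
  unfold polyPart
  exact (HasDerivAt.fun_sum fun j _ => (key j).mul_const _).add ((key N).div_const 2)

lemma IsVariation.hasDerivAt_polyPart_out (hv : IsVariation γ a c) (hγ : IsCurveAt p γ) (N : ℕ)
    (w : ℂ) : HasDerivAt (fun s => polyPart (taylorCoeff fun z => (γ s).out z ^ N) N w)
      (polyPart (taylorCoeff fun z => N * p.out z ^ (N - 1) * c z) N w) 0 := by
  obtain ⟨ε, hε, -, -, h⟩ := hγ.exists_circleC1
  have := h.hasDerivAt_polyPart hε (fun w hw => hv.hasDerivAt_out w hw.le) N w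
  rwa [hγ.base] at this

lemma IsVariation.hasDerivAt_polyPart_inn (hv : IsVariation γ a c) (hγ : IsCurveAt p γ) (N : ℕ)
    (w : ℂ) : HasDerivAt (fun s => polyPart (taylorCoeff fun z => (γ s).inn z ^ N) N w)
      (polyPart (taylorCoeff fun z => N * p.inn z ^ (N - 1) * a z) N w) 0 := by
  obtain ⟨ε, hε, -, h, -⟩ := hγ.exists_circleC1
  have := h.hasDerivAt_polyPart hε (fun w hw => hv.hasDerivAt_inn w hw.le) N w
  rwa [hγ.base] at this

lemma taylorCoeff_const_mul (x : ℂ) (h : ℂ → ℂ) (j : ℕ) :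
    taylorCoeff (fun z => x * h z) j = x * taylorCoeff h j := by
  rw [taylorCoeff, taylorCoeff, ← circleMean_const_mul]
  exact circleMean_congr fun w _ => by ring

lemma polyPart_taylorCoeff_I_mul (h u : ℂ → ℂ) (N : ℕ) (w : ℂ) :
    polyPart (taylorCoeff fun z => h z * (I * u z)) N w =
      I * polyPart (taylorCoeff fun z => h z * u z) N w := by
  rw [← polyPart_const_mul]
  congr 1
  funext j
  rw [← taylorCoeff_const_mul]
  congr 1
  funext z
  ring

end

/-! ### Conjugation and the Laurent parts of the hierarchy. -/

lemma laurentCoeff_eq_circleMean (h : ℂ → ℂ) (m : ℤ) :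
    laurentCoeff h m = circleMean fun w => w ^ (-m) * h w := by
  rw [circleMean, Real.circleAverage_eq_circleIntegral one_ne_zero, laurentCoeff, smul_eq_mul]
  congr 1
  refine circleIntegral.integral_congr zero_le_one fun w hw => ?_
  have hw0 : w ≠ 0 := by rintro rfl; simp at hw
  rw [zpow_sub_one₀ hw0, sub_zero, smul_eq_mul]
  ring

lemma circleMean_conj (u : ℂ → ℂ) :
    circleMean (fun w => (starRingEnd ℂ) (u w)) = (starRingEnd ℂ) (circleMean u) := by
  rw [circleMean, circleMean, Real.circleAverage_def, Real.circleAverage_def,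
    intervalIntegral.integral_of_le Real.two_pi_pos.le,
    intervalIntegral.integral_of_le Real.two_pi_pos.le, integral_conj, real_smul, real_smul,
    map_mul, conj_ofReal]

lemma conj_eq_inv_of_norm_eq_one {w : ℂ} (hw : ‖w‖ = 1) : (starRingEnd ℂ) w = w⁻¹ := by
  rw [inv_def, normSq_eq_norm_sq, hw]
  simp

lemma sum_zpow_eq_conj_polyPart {l : ℕ → ℂ} {b : ℕ → ℂ} {n : ℕ}
    (h : ∀ m ≤ n, l m = (starRingEnd ℂ) (b (n - m))) (w : ℂ) :
    ∑ m ∈ Finset.Icc 1 n, l m * w ^ (m : ℤ) + l 0 / 2 =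
      (starRingEnd ℂ) (polyPart b n ((starRingEnd ℂ) w)) := by
  rw [polyPart, map_add, map_sum, map_div₀, h 0 n.zero_le, Nat.sub_zero]
  congr 1
  · refine Finset.sum_nbij' (fun m => n - m) (fun j => n - j) ?_ ?_ ?_ ?_ ?_
    · intro m hm; have := Finset.mem_Icc.1 hm; simp only [Finset.mem_range]; omega
    · intro m hm; have := Finset.mem_range.1 hm; simp only [Finset.mem_Icc]; omega
    · intro m hm; have := Finset.mem_Icc.1 hm; omega
    · intro m hm; have := Finset.mem_range.1 hm; omega
    · intro m hm
      have := (Finset.mem_Icc.1 hm).2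
      rw [h m this, map_mul, map_pow, conj_conj, zpow_natCast, Nat.sub_sub_self this]
  · rw [map_ofNat]

/-- On the circle conjugation is inversion, and gⁿ = wⁿ k(1/w)ⁿ, so the coefficient of w^m in ḡⁿ is
the conjugate of Taylor coefficient n - m of kⁿ. -/
lemma todaB_conjMap (q : MapPair) (n : ℕ) :
    todaB n (conjMap q.g) = conjMap (polyPart (taylorCoeff fun z => q.out z ^ n) n) := by
  funext w
  refine sum_zpow_eq_conj_polyPart
    (l := fun m : ℕ => laurentCoeff (fun z => conjMap q.g z ^ n) m) (fun m hm => ?_) w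
  rw [laurentCoeff_eq_circleMean, taylorCoeff, ← circleMean_conj]
  refine circleMean_congr fun w hw => ?_
  have hw0 : w ≠ 0 := by rintro rfl; simp at hw
  obtain ⟨j, rfl⟩ := Nat.exists_eq_add_of_le hm
  simp only [conjMap, conj_eq_inv_of_norm_eq_one hw, q.g_eq (inv_ne_zero hw0), inv_inv, map_mul,
    map_pow, map_inv₀, Nat.add_sub_cancel_left, zpow_neg, zpow_natCast]
  rw [mul_pow, pow_add]
  field_simp

/-- Membership in 𝔇 supplies f(0) = 0, without which f = w / p would fail at the origin. -/
lemma todaBt_conjMap {q : MapPair} (hq : q ∈ spaceD) (n : ℕ) :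
    todaBt n (conjMap q.f) =
      conjMap fun z => polyPart (taylorCoeff fun z => q.inn z ^ n) n z⁻¹ := by
  funext w
  -- The negative powers of w are handled as positive powers of w⁻¹.
  have h := sum_zpow_eq_conj_polyPart (b := taylorCoeff fun z => q.inn z ^ n) (n := n)
    (l := fun m : ℕ => laurentCoeff (fun z => conjMap q.f z ^ (-(n : ℤ))) (-m)) (fun m hm => ?_) w⁻¹
  · simp only [inv_zpow', map_inv₀, Nat.cast_zero, neg_zero] at h
    exact h
  rw [laurentCoeff_eq_circleMean, taylorCoeff, ← circleMean_conj, ← circleMean_inv]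
  refine circleMean_congr fun w hw => ?_
  have hw0 : w ≠ 0 := by rintro rfl; simp at hw
  obtain ⟨j, rfl⟩ := Nat.exists_eq_add_of_le hm
  have hw' : ‖w⁻¹‖ = 1 := by rw [norm_inv, hw, inv_one]
  simp only [conjMap, conj_eq_inv_of_norm_eq_one hw', MapPair.f_eq hq, inv_inv, map_mul,
    map_pow, Nat.add_sub_cancel_left, zpow_neg, zpow_natCast, map_div₀, neg_neg, div_pow,
    conj_eq_inv_of_norm_eq_one hw, pow_add]
  have hj : (w⁻¹) ^ j * w ^ j = 1 := by rw [← mul_pow, inv_mul_cancel₀ hw0, one_pow]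
  field_simp
  rw [one_div]
  linear_combination (-(starRingEnd ℂ) (q.inn w) ^ m * (starRingEnd ℂ) (q.inn w) ^ j) * hj

lemma HasDerivAt.conjMap {h : ℂ → ℂ} {d w : ℂ} (hh : HasDerivAt h d ((starRingEnd ℂ) w)) :
    HasDerivAt (conjMap h) ((starRingEnd ℂ) d) w := by
  have := hh.conj_conj
  rwa [conj_conj] at this

section

variable {p : MapPair} {n : ℤ} {e : CoordFrame p n} {e₀ : CoordFrame p 0}

/-- A Lax equation for conjugated families, from the derivatives of the unconjugated ones. -/
lemma laxAt_conjMap {B L : MapPair → ℂ → ℂ} {w Bw Lw B₀ L₀ d : ℂ}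
    (hB : HasDerivAt (B p) Bw ((starRingEnd ℂ) w)) (hL : HasDerivAt (L p) Lw ((starRingEnd ℂ) w))
    (hB₀ : HasTBarDeriv e₀ (fun q => conjMap (B q) w) ((starRingEnd ℂ) B₀))
    (hL₀ : HasTBarDeriv e₀ (fun q => conjMap (L q) w) ((starRingEnd ℂ) L₀))
    (hd : HasTBarDeriv e (fun q => conjMap (L q) w) ((starRingEnd ℂ) d))
    (h : d = (starRingEnd ℂ) w * Bw * L₀ - (starRingEnd ℂ) w * B₀ * Lw) :
    LaxAt e e₀ (fun q => conjMap (B q)) (fun q => conjMap (L q)) w :=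
  ⟨_, hd, _, _, _, _, HasDerivAt.conjMap hB, HasDerivAt.conjMap hL, hB₀, hL₀, by
    rw [h]; simp only [map_sub, map_mul, conj_conj]⟩

end

section

variable {p : MapPair} {P K : ℂ → ℂ} {n : ℤ} {e : CoordFrame p n} {a c : ℂ → ℂ}

lemma hasTBarDeriv_g (hx : IsVariation e.x a c)
    (hy : IsVariation e.y (fun w => I * a w) fun w => I * c w) {w : ℂ} (hw : 1 ≤ ‖w‖) :
    HasTBarDeriv e (fun q => conjMap q.g w)
      ((starRingEnd ℂ) ((starRingEnd ℂ) w * c ((starRingEnd ℂ) w)⁻¹)) := by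
  rw [← norm_conj] at hw
  exact hasTBarDeriv_conj (hx.hasDerivAt_g hw) ((hy.hasDerivAt_g hw).congr_deriv (by ring))

lemma hasTBarDeriv_f (hp : p.Regular P K) (hx : IsVariation e.x a c)
    (hy : IsVariation e.y (fun w => I * a w) fun w => I * c w) {w : ℂ} (hw : ‖w‖ ≤ 1) :
    HasTBarDeriv e (fun q => conjMap q.f w) ((starRingEnd ℂ)
      (-((starRingEnd ℂ) w * a ((starRingEnd ℂ) w)) / p.inn ((starRingEnd ℂ) w) ^ 2)) := by
  rw [← norm_conj] at hw
  exact hasTBarDeriv_conj (hx.hasDerivAt_f e.hx.curve hp hw)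
    ((hy.hasDerivAt_f e.hy.curve hp hw).congr_deriv (by ring))

lemma hasTBarDeriv_polyPart_out (hx : IsVariation e.x a c)
    (hy : IsVariation e.y (fun w => I * a w) fun w => I * c w) (N : ℕ) (w : ℂ) :
    HasTBarDeriv e (fun q => conjMap (polyPart (taylorCoeff fun z => q.out z ^ N) N) w)
      ((starRingEnd ℂ) (polyPart (taylorCoeff fun z => N * p.out z ^ (N - 1) * c z) N
        ((starRingEnd ℂ) w))) :=
  hasTBarDeriv_conj (hx.hasDerivAt_polyPart_out e.hx.curve N _)
    ((hy.hasDerivAt_polyPart_out e.hy.curve N _).congr_deriv (polyPart_taylorCoeff_I_mul _ _ _ _))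

lemma hasTBarDeriv_polyPart_inn (hx : IsVariation e.x a c)
    (hy : IsVariation e.y (fun w => I * a w) fun w => I * c w) (N : ℕ) (w : ℂ) :
    HasTBarDeriv e
      (fun q => conjMap (fun z => polyPart (taylorCoeff fun z => q.inn z ^ N) N z⁻¹) w)
      ((starRingEnd ℂ) (polyPart (taylorCoeff fun z => N * p.inn z ^ (N - 1) * a z) N
        ((starRingEnd ℂ) w)⁻¹)) :=
  hasTBarDeriv_conj (hx.hasDerivAt_polyPart_inn e.hx.curve N _)
    ((hy.hasDerivAt_polyPart_inn e.hy.curve N _).congr_deriv (polyPart_taylorCoeff_I_mul _ _ _ _))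

end

/-! ### The Lax equations. -/

section

variable {p : MapPair} {P K : ℂ → ℂ}

lemma RegularMap.hasDerivAt {k K : ℂ → ℂ} (hk : RegularMap k K) {w : ℂ} (hw : ‖w‖ < 1) :
    HasDerivAt k (deriv k w) w :=
  (hk.disc.1.differentiableAt (Metric.isOpen_ball.mem_nhds (mem_ball_zero_iff.2 hw))).hasDerivAt

lemma MapPair.Regular.hasDerivAt_g (hp : p.Regular P K) {w : ℂ} (hw : 1 < ‖w‖) :
    HasDerivAt p.g (K w⁻¹) w := by
  have hw0 : w ≠ 0 := norm_pos_iff.1 (by linarith)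
  have hw' : ‖w⁻¹‖ < 1 := by rw [norm_inv]; exact inv_lt_one_of_one_lt₀ hw
  have h := (hasDerivAt_id w).mul ((hp.out.hasDerivAt hw').comp w (hasDerivAt_inv hw0))
  refine (h.congr_of_eventuallyEq ?_).congr_deriv ?_
  · filter_upwards [isOpen_ne.mem_nhds hw0] with z hz
    exact p.g_eq hz
  · rw [hp.out.eq_deriv _ hw']
    simp only [Function.comp_apply, id]
    field_simp
    ring

lemma MapPair.Regular.hasDerivAt_f (hp : p.Regular P K) (hmem : p ∈ spaceD) {w : ℂ}
    (hw : ‖w‖ < 1) : HasDerivAt p.f (P w / p.inn w ^ 2) w := by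
  have h := (hasDerivAt_id w).div (hp.inn.hasDerivAt hw) (hp.inn.ne w hw.le)
  refine (h.congr_of_eventuallyEq (.of_forall fun z => MapPair.f_eq hmem z)).congr_deriv ?_
  rw [hp.inn.eq_deriv _ hw, id, one_mul]

lemma hasDerivAt_polyPart_inv (b : ℕ → ℂ) (n : ℕ) {w : ℂ} (hw : w ≠ 0) :
    HasDerivAt (fun z => polyPart b n z⁻¹) (-polyEuler b n w⁻¹ / w) w := by
  refine ((hasDerivAt_polyPart b n (inv_ne_zero hw)).comp w (hasDerivAt_inv hw)).congr_deriv ?_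
  field_simp

lemma isTodaPair_conjMap (hp : p ∈ spaceD) : IsTodaPair (conjMap p.g) (conjMap p.f) := by
  obtain ⟨hf, b, hg, hfb⟩ := hp
  have hopen : IsOpen exterior := isOpen_lt continuous_const continuous_norm
  have hdisc : IsOpen disc := isOpen_lt continuous_norm continuous_const
  refine ⟨(starRingEnd ℂ) b, by simpa using hg.lead_ne, fun w hw => ?_, ?_, fun w hw => ?_, ?_,
    fun w hw hw0 => ?_, ?_⟩
  · have hw' : (starRingEnd ℂ) w ∈ exterior := by simpa [exterior] using hw
    exact (HasDerivAt.conjMap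
      (hg.holo.differentiableAt (hopen.mem_nhds hw')).hasDerivAt).differentiableAt.differentiableWithinAt
  · have hc : Tendsto (starRingEnd ℂ) (Bornology.cobounded ℂ) (Bornology.cobounded ℂ) := by
      rw [← tendsto_norm_atTop_iff_cobounded]
      simpa using tendsto_norm_cobounded_atTop (E := ℂ)
    have := (continuous_conj.tendsto b).comp (hg.lead.comp hc)
    refine this.congr fun w => ?_
    simp [conjMap]
  · have hw' : (starRingEnd ℂ) w ∈ disc := by simpa [disc] using hw
    exact (HasDerivAt.conjMap
      (hf.holo.differentiableAt (hdisc.mem_nhds hw')).hasDerivAt).differentiableAt.differentiableWithinAt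
  · simp [conjMap, hf.map_zero]
  · have hw' : (starRingEnd ℂ) w ∈ disc := by simpa [disc] using hw
    intro h
    have h1 : p.f ((starRingEnd ℂ) w) = p.f 0 := by
      rw [hf.map_zero]
      simpa [conjMap] using h
    exact hw0 (by simpa using hf.inj hw' (by simp [disc]) h1)
  · have h0 : HasDerivAt p.f (deriv p.f 0) ((starRingEnd ℂ) 0) := by
      rw [map_zero]
      exact (hf.holo.differentiableAt (hdisc.mem_nhds (by simp [disc]))).hasDerivAt
    rw [(HasDerivAt.conjMap h0).deriv, ← map_inv₀, eq_inv_of_mul_eq_one_left hfb]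

/-- Curves stay in 𝔇 for small parameters, so identities valid only on 𝔇 may be used under the
derivative. -/
lemma HasTBarDeriv.congr_curve {n : ℤ} {e : CoordFrame p n} {Φ Ψ : MapPair → ℂ} {d : ℂ}
    (h : HasTBarDeriv e Φ d) (hΦ : ∀ q ∈ spaceD, Ψ q = Φ q) : HasTBarDeriv e Ψ d := by
  obtain ⟨dx, dy, hx, hy, hd⟩ := h
  obtain ⟨ε, hε, hex, -⟩ := e.hx.curve.smooth
  obtain ⟨δ, hδ, hey, -⟩ := e.hy.curve.smooth
  refine ⟨dx, dy, hx.congr_of_eventuallyEq ?_, hy.congr_of_eventuallyEq ?_, hd⟩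
  · filter_upwards [isOpen_Ioo.mem_nhds (show (0 : ℝ) ∈ Ioo (-ε) ε from ⟨by linarith, hε⟩)]
      with s hs using hΦ _ (hex s hs)
  · filter_upwards [isOpen_Ioo.mem_nhds (show (0 : ℝ) ∈ Ioo (-δ) δ from ⟨by linarith, hδ⟩)]
      with s hs using hΦ _ (hey s hs)

lemma LaxAt.congr_curve {n : ℤ} {e : CoordFrame p n} {e₀ : CoordFrame p 0}
    {B B' L : MapPair → ℂ → ℂ} {w : ℂ} (h : LaxAt e e₀ B L w) (hp : p ∈ spaceD)
    (hB : ∀ q ∈ spaceD, B' q = B q) : LaxAt e e₀ B' L w := by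
  obtain ⟨d, hd, Bw, Lw, B₀, L₀, h1, h2, h3, h4, h5⟩ := h
  refine ⟨d, hd, Bw, Lw, B₀, L₀, ?_, h2, h3.congr_curve fun q hq => ?_, h4, h5⟩
  · rwa [hB p hp]
  · rw [hB q hq]

theorem laxAt_pos (hp : p ∈ spaceD) {n : ℕ} (hn : 1 ≤ n) (e : CoordFrame p (n : ℤ))
    (e₀ : CoordFrame p 0) :
    (∀ w ∈ exterior, LaxAt e e₀ (fun q => todaB n (conjMap q.g)) (fun q => conjMap q.g) w) ∧
    (∀ w ∈ disc, w ≠ 0 →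
      LaxAt e e₀ (fun q => todaB n (conjMap q.g)) (fun q => conjMap q.f) w) := by
  obtain ⟨P, K, hr⟩ := exists_regular hp
  obtain ⟨a, c, hx, hy, hΛ⟩ := e.exists_variation hr (isTimeDensity_pos hr hn)
  obtain ⟨p₀, k₀, hx₀, hy₀, hΛ₀⟩ := e₀.exists_variation hr (isTimeDensity_zero hr)
  have key := hr.inn.variation_eq_bracket hr.out hr.eq_zero hx₀.inn hx₀.out hΛ₀ hn hx.inn hx.out
    hx.eq_zero hΛ
  simp only [todaB_conjMap]
  constructor
  · intro w hw
    have hw' : 1 < ‖(starRingEnd ℂ) w‖ := by rw [norm_conj]; exact hw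
    have hne : (starRingEnd ℂ) w ≠ 0 := norm_pos_iff.1 (by linarith)
    refine laxAt_conjMap (hasDerivAt_polyPart _ n hne) (hr.hasDerivAt_g hw')
      (hasTBarDeriv_polyPart_out hx₀ hy₀ n w) (hasTBarDeriv_g hx₀ hy₀ (le_of_lt hw))
      (hasTBarDeriv_g hx hy (le_of_lt hw)) ?_
    -- With ω the conjugate of w, the Lax equation for g is the bracket formula for c at 1/ω,
    -- multiplied by ω.
    rw [(key _ (by rw [norm_inv]; exact inv_le_one_of_one_le₀ hw'.le)).2 (inv_ne_zero hne), inv_inv]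
    field_simp
  · intro w hw hw0
    have hw' : ‖(starRingEnd ℂ) w‖ < 1 := by rw [norm_conj]; exact hw
    have hne : (starRingEnd ℂ) w ≠ 0 := by simpa using hw0
    refine laxAt_conjMap (hasDerivAt_polyPart _ n hne) (hr.hasDerivAt_f hp hw')
      (hasTBarDeriv_polyPart_out hx₀ hy₀ n w) (hasTBarDeriv_f hr hx₀ hy₀ (le_of_lt hw))
      (hasTBarDeriv_f hr hx hy (le_of_lt hw)) ?_
    rw [(key _ hw'.le).1]
    field_simp
    ring

theorem laxAt_neg (hp : p ∈ spaceD) {n : ℕ} (hn : 1 ≤ n) (e : CoordFrame p (-(n : ℤ)))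
    (e₀ : CoordFrame p 0) :
    (∀ w ∈ exterior, LaxAt e e₀ (fun q => todaBt n (conjMap q.f)) (fun q => conjMap q.g) w) ∧
    (∀ w ∈ disc, w ≠ 0 →
      LaxAt e e₀ (fun q => todaBt n (conjMap q.f)) (fun q => conjMap q.f) w) := by
  obtain ⟨P, K, hr⟩ := exists_regular hp
  obtain ⟨a, c, hx, hy, hΛ⟩ := e.exists_variation hr (isTimeDensity_neg hr hn)
  obtain ⟨p₀, k₀, hx₀, hy₀, hΛ₀⟩ := e₀.exists_variation hr (isTimeDensity_zero hr)
  have hinv : ∀ w : ℂ, ‖w‖ = 1 → ‖w⁻¹‖ = 1 := fun w hw => by rw [norm_inv, hw, inv_one]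
  have ha : DiscAlg fun w => -a w := hx.inn.neg
  have hc : DiscAlg fun w => -c w := hx.out.neg
  -- The inversion w ↦ 1/w exchanges the two maps, and negating both variations absorbs the sign of
  -- the density for t_{-n}.
  have key := hr.out.variation_eq_bracket hr.inn hr.eq_zero.symm hx₀.out hx₀.inn
    (fun w hw => by rw [← crossForm_inv]; exact hΛ₀ _ (hinv w hw)) hn hc ha
    (by rw [hx.eq_zero]) (fun w hw => by
      have h := hΛ _ (hinv w hw)
      rw [crossForm_inv, inv_inv] at h
      rw [← neg_eq_iff_eq_neg] at h
      rw [← h]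
      simp only [crossForm]
      ring)
  constructor
  · intro w hw
    refine LaxAt.congr_curve ?_ hp fun q hq => todaBt_conjMap hq n
    have hw' : 1 < ‖(starRingEnd ℂ) w‖ := by rw [norm_conj]; exact hw
    have hne : (starRingEnd ℂ) w ≠ 0 := norm_pos_iff.1 (by linarith)
    refine laxAt_conjMap (hasDerivAt_polyPart_inv _ n hne) (hr.hasDerivAt_g hw')
      (hasTBarDeriv_polyPart_inn hx₀ hy₀ n w) (hasTBarDeriv_g hx₀ hy₀ (le_of_lt hw))
      (hasTBarDeriv_g hx hy (le_of_lt hw)) ?_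
    have := (key _ (by rw [norm_inv]; exact inv_le_one_of_one_le₀ hw'.le)).1
    rw [neg_eq_iff_eq_neg] at this
    rw [this]
    field_simp
    ring
  · intro w hw hw0
    refine LaxAt.congr_curve ?_ hp fun q hq => todaBt_conjMap hq n
    have hw' : ‖(starRingEnd ℂ) w‖ < 1 := by rw [norm_conj]; exact hw
    have hne : (starRingEnd ℂ) w ≠ 0 := by simpa using hw0
    refine laxAt_conjMap (hasDerivAt_polyPart_inv _ n hne) (hr.hasDerivAt_f hp hw')
      (hasTBarDeriv_polyPart_inn hx₀ hy₀ n w) (hasTBarDeriv_f hr hx₀ hy₀ (le_of_lt hw))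
      (hasTBarDeriv_f hr hx hy (le_of_lt hw)) ?_
    have := (key _ hw'.le).2 hne
    rw [neg_eq_iff_eq_neg] at this
    rw [this]
    field_simp

end

end DToda

end

/-- The evolution of the conjugate pair `(ḡ, f̄)` with respect to the times `t̄_n`, `n ∈ ℤ`, on `𝔇`
satisfies the dispersionless Toda hierarchy. -/
theorem theorem3p10 :
    DToda.EvolvesByDToda (fun p => DToda.conjMap p.g) (fun p => DToda.conjMap p.f) :=
  ⟨fun _ hp => DToda.isTodaPair_conjMap hp, fun _ hp _ hn e e₀ => DToda.laxAt_pos hp hn e e₀,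
    fun _ hp _ hn e e₀ => DToda.laxAt_neg hp hn e e₀⟩
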